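/- **Setting.** Let $d\in\{2,3\}$, $L>0$, and let $J\ge 1$ be an integer, $h=L/J$. Consider real grid functions on the $L$-periodic uniform mesh with $J$ points in each of the $d$ directions. Let $D_k^+,D_k^-,D_k^c$ be the forward, backward and central differences in direction $k$, $\nabla_h=(D_k^+)_k$, $\Delta_h=\sum_k D_k^+D_k^-$, $D_h^2u=(D_k^cD_l^cu)_{k,l}$ and $\nabla_h\cdot(\nabla_h\cdot\Phi)=\sum_{i,j}D_i^-D_j^-\Phi^{ij}$. Put $\langle U,V\rangle_h=h^d\sum UV$ (sum over one period; for matrix-valued functions, sum over components as well), $\|U\|_h^2=\langle U,U\rangle_h$, $\|U\|_{H_h^2}^2=\|U\|_h^2+\|\nabla_hU\|_h^2+\|\Delta_hU\|_h^2$ and $\|U\|_{H_h^4}^2=\|U\|_{H_h^2}^2+\|\nabla_h\Delta_hU\|_h^2+\|\Delta_h^2U\|_h^2$. Let $K,C,c,B_0,\kappa_1,\kappa_2>0$, $\eta_0\in[0,1]$, $A,B,a,b,q\in\mathbb R$, with $A<0$ if $d=2$, and $B>0$, $A<B^2/(27C)$ if $d=3$. Put $s_+=\sqrt{-2A/C}$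 if $d=2$ and $s_+=\frac{B+\sqrt{B^2-24AC}}{4C}$ if $d=3$. For a grid function $\mathbf Q$ with values in the symmetric traceless $d\times d$ matrices, a real grid function $u$ and $s\in\mathbb R$, let $\mathbf M=\mathbf Q/s_++\mathbf I/d$, $$E_{1h}=2B_0q^2\langle D_h^2u,\mathbf Mu\rangle_h+B_0q^4\|\mathbf Mu\|_h^2+\langle f_{bn}(\mathbf Q),1\rangle_h+\langle f_s(u),1\rangle_h,\qquad g=e^{s}/e^{E_{1h}},$$ where $f_{bn}(\mathbf Q)=\frac A2\operatorname{tr}\mathbf Q^2-\frac B3\operatorname{tr}\mathbf Q^3+\frac C4(\operatorname{tr}\mathbf Q^2)^2$ (without the $B$-term if $d=2$) and $f_s(u)=\frac a2u^2+\frac b3u^3+\frac c4u^4$, and let $$\mathbf H=A\mathbf Q-B\Big(\mathbf Q^2-\tfrac{\operatorname{tr}\mathbf Q^2}{d}\mathbf I\Big)+C\operatorname{tr}(\mathbf Q^2)\mathbf Q+\tfrac{2B_0q^2}{s_+}\Big(uD_h^2u-\tfrac{\operatorname{tr}(uD_h^2u)}{d}\mathbf I\Big)+\tfrac{2B_0q^4}{s_+^2}u^2\mathbf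 Q,$$ $$\mu=au+bu^2+cu^3+2B_0q^2\,\mathbf M:D_h^2u+2B_0q^2\,\nabla_h\cdot(\nabla_h\cdot(\mathbf Mu))+2B_0q^4|\mathbf M|_F^2u,$$ $$\mathbf N=-g\mathbf H+g\kappa_1\mathbf Q,\quad \mathcal N=-g\mu+g\kappa_2u,\quad \mathcal L=-K\Delta_h+g\kappa_1,\quad \mathcal D=2B_0\Delta_h^2+g\kappa_2 .$$ A superscript $n$ denotes evaluation at $(\mathbf Q_h^n,u_h^n,s^n)$. With $\phi_1(z)=(e^z-1)/z$, the R-GSAV-EI scheme with time step $\tau>0$ is $$\mathbf Q_h^{n+1}=e^{-\tau\mathcal L^n}\mathbf Q_h^n+\tau\phi_1(-\tau\mathcal L^n)\mathbf N_h^n,\qquad u_h^{n+1}=e^{-\tau\mathcal D^n}u_h^n+\tau\phi_1(-\tau\mathcal D^n)\mathcal N_h^n,$$ $$\tilde s^{\,n+1}=s^n+g^n\big(\langle\mathbf H_h^n,\mathbf Q_h^{n+1}-\mathbf Q_h^n\rangle_h+\langle\mu_h^n,u_h^{n+1}-u_h^n\rangle_h\big),\qquad s^{n+1}=\xi^{n+1}\tilde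 s^{\,n+1}+(1-\xi^{n+1})E_{1h}^{n+1},$$ where $\xi^{n+1}\in[0,1]$ is any number such that $s^{n+1}-\tilde s^{\,n+1}\le\eta_0\tau\mathcal R^{n+1}$. Here, with $\mathcal Q_1(z)=\frac z{e^z-1}+\frac z2$, $\delta\mathbf Q=\mathbf Q_h^{n+1}-\mathbf Q_h^n$ and $\delta u=u_h^{n+1}-u_h^n$, $$\mathcal R^{n+1}=\tfrac1\tau\big(\langle\mathcal Q_1(\tau\mathcal L^n)\delta\mathbf Q,\delta\mathbf Q\rangle_h+\langle\mathcal Q_1(\tau\mathcal D^n)\delta u,\delta u\rangle_h\big).$$ **Theorem 8 (higher-order regularity of the numerical solution).** Let the parameters $d,L,K,A,B,C,a,b,c,B_0,q,\kappa_1,\kappa_2,\eta_0$ be as above, and let $T>0$ and $R_0,S_0\in\mathbb R$. For every $0<\epsilon<\frac14$ there is a constant $C_\epsilon$, and there is a constant $C_1$, depending only on these data (and $C_\epsilon$ on $\epsilon$), such that for every $J\ge1$, $\tau>0$ and $N\ge0$ with $N\tau\le T$, and every numerical solution $(\mathbf Q_h^n,u_h^n,s^n)_{0\le n\le N}$ of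 the scheme whose initial data ($\mathbf Q_h^0$ symmetric and traceless) satisfy $\|\mathbf Q_h^0\|_{H_h^2}\le R_0$, $\|u_h^0\|_{H_h^4}\le R_0$ and $|s^0-E_{1h}^0|\le S_0$ (for instance $s^0=E_{1h}^0$), $$\sup_{0\le n\le N}\|\mathbf Q_h^n\|_{H_h^2}+\sup_{0\le n\le N}\|\Delta_hu_h^n\|_h\le C_\epsilon,\qquad \sup_{0\le n\le N}\|\mathbf N_h^n\|_h+\sup_{0\le n\le N}\|\mathcal N_h^n\|_h\le C_1 .$$ In particular the bounds are uniform in $n$, $\tau$ and $h$. -/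

import Mathlib

noncomputable section

namespace SmA

/-! ### Parameters -/

/-- The real parameters of the modified Landau-de Gennes model for smectic-A liquid crystals
(side length `L` of the periodic box, elastic constant `K`, bulk constants `A B C`, smectic
constants `a b c`, coupling strength `B₀`, wave number `q`) and of the scheme (stabilization
parameters `κ₁ κ₂`, relaxation parameter `η₀`). -/
structure Params where
  (L K A B C a b c B₀ q κ₁ κ₂ η₀ : ℝ)

/-- The standing assumptions on the parameters in dimension `d ∈ {2, 3}`; `regime` is the
temperature range in which the orientational and positional orders are coupled. -/
structure Params.Admissible (p : Params) (d : ℕ) : Prop where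
  L_pos : 0 < p.L
  K_pos : 0 < p.K
  C_pos : 0 < p.C
  c_pos : 0 < p.c
  B₀_pos : 0 < p.B₀
  κ₁_pos : 0 < p.κ₁
  κ₂_pos : 0 < p.κ₂
  η₀_nonneg : 0 ≤ p.η₀
  η₀_le_one : p.η₀ ≤ 1
  regime : (d = 2 ∧ p.A < 0) ∨ (d = 3 ∧ 0 < p.B ∧ p.A < p.B ^ 2 / (27 * p.C))

/-- The equilibrium scalar order parameter `s₊`. -/
def sPlus (p : Params) (d : ℕ) : ℝ :=
  if d = 2 then √(-2 * p.A / p.C)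
  else (p.B + √(p.B ^ 2 - 24 * p.A * p.C)) / (4 * p.C)

/-! ### Periodic grid functions and difference operators -/

/-- Real grid functions on the uniform periodic mesh with `J` points in each of the `d`
directions: periodicity is encoded by indexing the mesh points by `(ℤ/J)^d`. -/
abbrev Grid (d J : ℕ) : Type := (Fin d → ZMod J) → ℝ

/-- Matrix-valued grid functions. -/
abbrev TGrid (d J : ℕ) : Type := (Fin d → ZMod J) → Matrix (Fin d) (Fin d) ℝ

/-- The unit index vector in direction `k`. -/
def unitVec (d J : ℕ) (k : Fin d) : Fin d → ZMod J := Pi.single k 1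

/-- Forward difference in direction `k` with mesh size `h`. -/
def Dp {d J : ℕ} (h : ℝ) (k : Fin d) : Grid d J →ₗ[ℝ] Grid d J where
  toFun U x := (U (x + unitVec d J k) - U x) / h
  map_add' U V := by ext x; simp only [Pi.add_apply]; ring
  map_smul' r U := by ext x; simp only [Pi.smul_apply, smul_eq_mul, RingHom.id_apply]; ring

/-- Backward difference in direction `k` with mesh size `h`. -/
def Dm {d J : ℕ} (h : ℝ) (k : Fin d) : Grid d J →ₗ[ℝ] Grid d J where
  toFun U x := (U x - U (x - unitVec d J k)) / h
  map_add' U V := by ext x; simp only [Pi.add_apply]; ring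
  map_smul' r U := by ext x; simp only [Pi.smul_apply, smul_eq_mul, RingHom.id_apply]; ring

/-- Central difference in direction `k` with mesh size `h`. -/
def Dc {d J : ℕ} (h : ℝ) (k : Fin d) : Grid d J →ₗ[ℝ] Grid d J where
  toFun U x := (U (x + unitVec d J k) - U (x - unitVec d J k)) / (2 * h)
  map_add' U V := by ext x; simp only [Pi.add_apply]; ring
  map_smul' r U := by ext x; simp only [Pi.smul_apply, smul_eq_mul, RingHom.id_apply]; ring

/-- The discrete Laplacian `Δ_h = ∑ₖ Dₖ⁺ Dₖ⁻`. -/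
def lap {d J : ℕ} (h : ℝ) : Grid d J →ₗ[ℝ] Grid d J :=
  ∑ k : Fin d, Dp h k ∘ₗ Dm h k

/-- The discrete Hessian `D_h² u = (Dₖᶜ Dₗᶜ u)ₖₗ`. -/
def hess {d J : ℕ} (h : ℝ) (u : Grid d J) : TGrid d J :=
  fun x => Matrix.of fun k l => Dc h k (Dc h l u) x

/-- The component `Φⁱʲ` of a matrix-valued grid function. -/
def comp {d J : ℕ} (Φ : TGrid d J) (i j : Fin d) : Grid d J := fun x => Φ x i j

/-- The double discrete divergence `∇_h · (∇_h · Φ)`, with the divergence built from backward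
differences. -/
def divDiv {d J : ℕ} (h : ℝ) (Φ : TGrid d J) : Grid d J :=
  ∑ i, Dm h i (∑ j, Dm h j (comp Φ i j))

/-- The space of symmetric traceless matrix-valued grid functions. -/
def SymTraceless (d J : ℕ) : Set (TGrid d J) :=
  {Φ | ∀ x, (Φ x).IsSymm ∧ (Φ x).trace = 0}

/-! ### Discrete inner products and norms -/

/-- `⟨U, V⟩_h = h^d ∑ U V`, the sum over one period of the mesh. -/
def inn {d J : ℕ} [NeZero J] (h : ℝ) (U V : Grid d J) : ℝ :=
  h ^ d * ∑ x, U x * V x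

/-- `‖U‖_h`. -/
def nrm {d J : ℕ} [NeZero J] (h : ℝ) (U : Grid d J) : ℝ := √(inn h U U)

/-- `‖∇_h U‖_h`. -/
def gradNrm {d J : ℕ} [NeZero J] (h : ℝ) (U : Grid d J) : ℝ :=
  √(∑ k : Fin d, nrm h (Dp h k U) ^ 2)

/-- `‖U‖_{H_h^4}`. -/
def h4Nrm {d J : ℕ} [NeZero J] (h : ℝ) (U : Grid d J) : ℝ :=
  √(nrm h U ^ 2 + gradNrm h U ^ 2 + nrm h (lap h U) ^ 2
    + gradNrm h (lap h U) ^ 2 + nrm h (lap h (lap h U)) ^ 2)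

/-- `⟨Φ, Ψ⟩_h` for matrix-valued grid functions. -/
def tInn {d J : ℕ} [NeZero J] (h : ℝ) (Φ Ψ : TGrid d J) : ℝ :=
  ∑ i, ∑ j, inn h (comp Φ i j) (comp Ψ i j)

/-- `‖Φ‖_h` for matrix-valued grid functions. -/
def tNrm {d J : ℕ} [NeZero J] (h : ℝ) (Φ : TGrid d J) : ℝ :=
  √(∑ i, ∑ j, nrm h (comp Φ i j) ^ 2)

/-- `‖Φ‖_{H_h^2}` for matrix-valued grid functions. -/
def tH2Nrm {d J : ℕ} [NeZero J] (h : ℝ) (Φ : TGrid d J) : ℝ :=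
  √(tNrm h Φ ^ 2 + (∑ i, ∑ j, gradNrm h (comp Φ i j) ^ 2)
    + ∑ i, ∑ j, nrm h (lap h (comp Φ i j)) ^ 2)

/-! ### Discrete energy and nonlinear terms -/

/-- The mesh size `h = L / J`. -/
def mesh (p : Params) (J : ℕ) : ℝ := p.L / J

/-- The bulk energy density of the tensor order parameter. -/
def fbn (p : Params) {d : ℕ} (X : Matrix (Fin d) (Fin d) ℝ) : ℝ :=
  p.A / 2 * (X ^ 2).trace - (if d = 3 then p.B / 3 * (X ^ 3).trace else 0)
    + p.C / 4 * (X ^ 2).trace ^ 2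

/-- The smectic bulk energy density. -/
def fs (p : Params) (y : ℝ) : ℝ := p.a / 2 * y ^ 2 + p.b / 3 * y ^ 3 + p.c / 4 * y ^ 4

/-- `M_h = Q_h / s₊ + I / d`. -/
def Mten (p : Params) {d J : ℕ} (Q : TGrid d J) : TGrid d J :=
  fun x => (1 / sPlus p d) • Q x + (1 / (d : ℝ)) • (1 : Matrix (Fin d) (Fin d) ℝ)

/-- The product `M_h u_h`. -/
def Mu (p : Params) {d J : ℕ} (Q : TGrid d J) (u : Grid d J) : TGrid d J :=
  fun x => u x • Mten p Q x

/-- The discrete nonlinear energy `E_{1h}`. -/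
def E1 (p : Params) {d J : ℕ} [NeZero J] (Q : TGrid d J) (u : Grid d J) : ℝ :=
  2 * p.B₀ * p.q ^ 2 * tInn (mesh p J) (hess (mesh p J) u) (Mu p Q u)
    + p.B₀ * p.q ^ 4 * tNrm (mesh p J) (Mu p Q u) ^ 2
    + inn (mesh p J) (fun x => fbn p (Q x)) 1
    + inn (mesh p J) (fun x => fs p (u x)) 1

/-- The scalar factor `g = e^s / e^{E_{1h}}`. -/
def gfac (p : Params) {d J : ℕ} [NeZero J] (Q : TGrid d J) (u : Grid d J) (s : ℝ) : ℝ :=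
  Real.exp s / Real.exp (E1 p Q u)

/-- The discrete variation `H_h` of the nonlinear energy in the tensor variable (projected to
symmetric traceless matrices). -/
def Hvar (p : Params) {d J : ℕ} (Q : TGrid d J) (u : Grid d J) : TGrid d J := fun x =>
  p.A • Q x
    - p.B • (Q x ^ 2 - ((Q x ^ 2).trace / d) • (1 : Matrix (Fin d) (Fin d) ℝ))
    + (p.C * (Q x ^ 2).trace) • Q x
    + (2 * p.B₀ * p.q ^ 2 / sPlus p d) •
        (u x • hess (mesh p J) u x
          - ((u x • hess (mesh p J) u x).trace / d) • (1 : Matrix (Fin d) (Fin d) ℝ))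
    + (2 * p.B₀ * p.q ^ 4 / sPlus p d ^ 2 * u x ^ 2) • Q x

/-- The discrete variation `μ_h` of the nonlinear energy in the scalar variable. -/
def muvar (p : Params) {d J : ℕ} (Q : TGrid d J) (u : Grid d J) : Grid d J := fun x =>
  p.a * u x + p.b * u x ^ 2 + p.c * u x ^ 3
    + 2 * p.B₀ * p.q ^ 2 * ∑ i, ∑ j, Mten p Q x i j * hess (mesh p J) u x i j
    + 2 * p.B₀ * p.q ^ 2 * divDiv (mesh p J) (Mu p Q u) x
    + 2 * p.B₀ * p.q ^ 4 * (∑ i, ∑ j, Mten p Q x i j ^ 2) * u x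

/-- The nonlinear term `N_h = -g H_h + g κ₁ Q_h` of the tensor equation. -/
def NQ (p : Params) {d J : ℕ} [NeZero J] (Q : TGrid d J) (u : Grid d J) (s : ℝ) : TGrid d J :=
  -(gfac p Q u s • Hvar p Q u) + (gfac p Q u s * p.κ₁) • Q

/-- The nonlinear term `-g μ_h + g κ₂ u_h` of the scalar equation. -/
def Nu (p : Params) {d J : ℕ} [NeZero J] (Q : TGrid d J) (u : Grid d J) (s : ℝ) : Grid d J :=
  -(gfac p Q u s • muvar p Q u) + (gfac p Q u s * p.κ₂) • u

/-! ### Linear operators and operator functions -/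

/-- `L_h = -K Δ_h + g κ₁` on scalar grid functions; on matrix-valued ones it acts
componentwise. -/
def Lop (p : Params) (d J : ℕ) [NeZero J] (g : ℝ) : Grid d J →L[ℝ] Grid d J :=
  -(p.K • LinearMap.toContinuousLinearMap (lap (d := d) (J := J) (mesh p J)))
    + (g * p.κ₁) • ContinuousLinearMap.id ℝ (Grid d J)

/-- `D_h = 2 B₀ Δ_h² + g κ₂`. -/
def Dop (p : Params) (d J : ℕ) [NeZero J] (g : ℝ) : Grid d J →L[ℝ] Grid d J :=
  (2 * p.B₀) • LinearMap.toContinuousLinearMap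
      (lap (d := d) (J := J) (mesh p J) ∘ₗ lap (mesh p J))
    + (g * p.κ₂) • ContinuousLinearMap.id ℝ (Grid d J)

/-- `φ₁(X) = X⁻¹ (e^X - 1)` for an invertible operator `X`. -/
def phi1 {d J : ℕ} [NeZero J] (X : Grid d J →L[ℝ] Grid d J) : Grid d J →L[ℝ] Grid d J :=
  Ring.inverse X * (NormedSpace.exp X - 1)

/-- `𝒬(X) = X (e^X - 1)⁻¹` for an operator `X` with `e^X - 1` invertible. -/
def calQ {d J : ℕ} [NeZero J] (X : Grid d J →L[ℝ] Grid d J) : Grid d J →L[ℝ] Grid d J :=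
  X * Ring.inverse (NormedSpace.exp X - 1)

/-- `𝒬₁(X) = 𝒬(X) + X / 2`. -/
def calQ1 {d J : ℕ} [NeZero J] (X : Grid d J →L[ℝ] Grid d J) : Grid d J →L[ℝ] Grid d J :=
  calQ X + (1 / 2 : ℝ) • X

/-- Componentwise action of a scalar operator on matrix-valued grid functions. -/
def onComp {d J : ℕ} (S : Grid d J →L[ℝ] Grid d J) (Φ : TGrid d J) : TGrid d J :=
  fun x => Matrix.of fun i j => S (comp Φ i j) x

/-! ### The scheme -/

/-- One exponential time differencing step for the tensor variable. -/
def stepQ (p : Params) {d J : ℕ} [NeZero J] (τ : ℝ)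
    (Q : TGrid d J) (u : Grid d J) (s : ℝ) : TGrid d J :=
  onComp (NormedSpace.exp (-(τ • Lop p d J (gfac p Q u s)))) Q
    + τ • onComp (phi1 (-(τ • Lop p d J (gfac p Q u s)))) (NQ p Q u s)

/-- One exponential time differencing step for the scalar variable. -/
def stepU (p : Params) {d J : ℕ} [NeZero J] (τ : ℝ)
    (Q : TGrid d J) (u : Grid d J) (s : ℝ) : Grid d J :=
  NormedSpace.exp (-(τ • Dop p d J (gfac p Q u s))) u
    + τ • phi1 (-(τ • Dop p d J (gfac p Q u s))) (Nu p Q u s)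

/-- The provisional auxiliary variable computed from the old state `(Q, u, s)` and the new
fields `(Q', u')`. -/
def sTilde (p : Params) {d J : ℕ} [NeZero J] (Q : TGrid d J) (u : Grid d J) (s : ℝ)
    (Q' : TGrid d J) (u' : Grid d J) : ℝ :=
  s + gfac p Q u s *
    (tInn (mesh p J) (Hvar p Q u) (Q' - Q) + inn (mesh p J) (muvar p Q u) (u' - u))

/-- The discrete dissipation rate
`R = τ⁻¹ (⟨𝒬₁(τ L_h) δQ, δQ⟩_h + ⟨𝒬₁(τ D_h) δu, δu⟩_h)`. -/
def dissip (p : Params) {d J : ℕ} [NeZero J] (τ : ℝ) (Q : TGrid d J) (u : Grid d J) (s : ℝ)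
    (Q' : TGrid d J) (u' : Grid d J) : ℝ :=
  1 / τ *
    (tInn (mesh p J) (onComp (calQ1 (τ • Lop p d J (gfac p Q u s))) (Q' - Q)) (Q' - Q)
      + inn (mesh p J) (calQ1 (τ • Dop p d J (gfac p Q u s)) (u' - u)) (u' - u))

/-- The set of feasible relaxation factors `ξ`. -/
def feasible (p : Params) {d J : ℕ} [NeZero J] (τ : ℝ) (Q : TGrid d J) (u : Grid d J) (s : ℝ)
    (Q' : TGrid d J) (u' : Grid d J) : Set ℝ :=
  {ξ | 0 ≤ ξ ∧ ξ ≤ 1 ∧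
    (ξ * sTilde p Q u s Q' u' + (1 - ξ) * E1 p Q' u') - sTilde p Q u s Q' u'
      ≤ p.η₀ * τ * dissip p τ Q u s Q' u'}

/-- `(Q, u, s)` is a numerical solution over the time levels `0, …, N` with time step `τ`:
the initial tensor is symmetric and traceless, both fields are advanced by the exponential time
differencing step, and the auxiliary variable by the relaxed update with some feasible
relaxation factor. -/
structure IsNumericalSolution (p : Params) {d J : ℕ} [NeZero J] (τ : ℝ) (N : ℕ)
    (Q : ℕ → TGrid d J) (u : ℕ → Grid d J) (s : ℕ → ℝ) : Prop where
  init_mem : Q 0 ∈ SymTraceless d J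
  step_Q : ∀ n < N, Q (n + 1) = stepQ p τ (Q n) (u n) (s n)
  step_u : ∀ n < N, u (n + 1) = stepU p τ (Q n) (u n) (s n)
  step_s : ∀ n < N, ∃ ξ ∈ feasible p τ (Q n) (u n) (s n) (Q (n + 1)) (u (n + 1)),
    s (n + 1) = ξ * sTilde p (Q n) (u n) (s n) (Q (n + 1)) (u (n + 1))
      + (1 - ξ) * E1 p (Q (n + 1)) (u (n + 1))

end SmA

end

open SmA

noncomputable section
set_option linter.unusedSectionVars false
namespace SmA
open ComplexConjugate

/-! ### Discrete Fourier transform on the periodic mesh -/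

section Fourier
variable {d J : ℕ} [NeZero J]

/-! The argument rests on one structural fact: the auxiliary factor `gfac` equals exp(s - E₁) and is
exponentially small where the fields are large. The modified energy `modE` is K/2‖∇Q‖² + B₀‖Δu‖² +
s. Coercivity (`exists_coercive`) says that the same quadratic terms plus E₁ dominate a multiple of
`ctrl`, which collects the gradient of Q, the Laplacian of u and both fourth-power integrals. If
`modE` is at most E, then s - E₁ ≤ const - c·`ctrl`, so `gfac` absorbs every power of `ctrl`
(`exists_gfac_mul_ctrl_pow_le`). No separate bound on s, Q or u is needed for this.

Under such a bound the scaled nonlinear terms cost only higher-order norms. With l the squared norm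
of ΔQ, interpolation through the discrete Sobolev inequality `exists_sup_le` yields ‖N_Q‖² ≤ C + δl
for every δ > 0, ‖N_u‖² ≤ C(1 + l), and ‖∇N_Q‖² ≤ C(1 + l² + ‖∇Δu‖²). The double divergence in the
scalar equation needs an algebra estimate, `nrm_Dm_Dm_mul_le`, obtained from a discrete
Gagliardo–Nirenberg inequality.

The linear operators are Fourier multipliers, and `mode_regularity` gives maximal regularity of one
exponential step mode by mode, uniformly in the mesh and in the zeroth-order shift. The bounds then
close in three rounds. The small δ is absorbed, so ∑ τ l is bounded (`exists_sum_tLap2_le`). The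
scalar equation then gives sup ‖Δu‖ and ∑ τ‖∇Δu‖² (`exists_lap_u_le`). Finally l² = l·l is handled
by Gronwall with the summable coefficient τl (`exists_tLap2_le`), which bounds l pointwise in time.

It remains to bound the modified energy. The exact identity `inn_etd_sub` shows that a step
dissipates R, while relaxation returns at most η₀τR. For τ ≤ 1 the energy therefore decreases. For τ
> 1 there are at most T steps, and each raises the energy by an amount controlled by the regularity
already proved up to that level (`exists_dissip_le`, `exists_energy_le`). -/

/-- The character of `(ℤ/J)^d` with frequency `k`. -/
def chr (k x : Fin d → ZMod J) : ℂ := ∏ i, ZMod.stdAddChar (k i * x i)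

lemma chr_add (k x y : Fin d → ZMod J) : chr k (x + y) = chr k x * chr k y := by
  simp [chr, mul_add, AddChar.map_add_eq_mul, Finset.prod_mul_distrib]

lemma norm_chr (k x : Fin d → ZMod J) : ‖chr k x‖ = 1 := by
  simp [chr]

lemma chr_neg (k x : Fin d → ZMod J) : chr k (-x) = conj (chr k x) := by
  simp [chr, AddChar.map_neg_eq_conj]

lemma chr_unitVec (k : Fin d → ZMod J) (j : Fin d) :
    chr k (unitVec d J j) = ZMod.stdAddChar (k j) := by
  rw [chr, Finset.prod_eq_single j]
  · simp [unitVec]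
  · intro i _ hi; simp [unitVec, hi]
  · simp

/-- Orthogonality of characters: the sum factorises over coordinates, and a nonzero coordinate
annihilates its one-dimensional factor because the standard character is primitive. -/
lemma sum_chr (x : Fin d → ZMod J) :
    ∑ k : Fin d → ZMod J, chr k x = if x = 0 then (J : ℂ) ^ d else 0 := by
  have h1 : ∑ k : Fin d → ZMod J, chr k x
      = ∏ i, ∑ m : ZMod J, (ZMod.stdAddChar (m * x i) : ℂ) := by
    rw [Finset.prod_univ_sum, Fintype.piFinset_univ]; rfl
  rw [h1]
  simp_rw [AddChar.sum_mulShift _ (ZMod.isPrimitive_stdAddChar J)]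
  split_ifs with h
  · subst h; simp [ZMod.card]
  · obtain ⟨i, hi⟩ : ∃ i, x i ≠ 0 := by
      by_contra! hc; exact h (funext hc)
    exact Finset.prod_eq_zero (Finset.mem_univ i) (by simp [hi])

/-- The (unnormalised) Fourier coefficient of a real grid function. -/
def ft (k : Fin d → ZMod J) : Grid d J →ₗ[ℝ] ℂ where
  toFun U := ∑ x, (U x : ℂ) * chr k x
  map_add' U V := by simp [add_mul, Finset.sum_add_distrib]
  map_smul' r U := by simp [Finset.mul_sum, mul_assoc]

lemma ft_apply (k : Fin d → ZMod J) (U : Grid d J) : ft k U = ∑ x, (U x : ℂ) * chr k x := rfl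

lemma ft_inversion (U : Grid d J) (y : Fin d → ZMod J) :
    ∑ k, ft k U * chr k (-y) = (J : ℂ) ^ d * U y := by
  simp_rw [ft_apply, Finset.sum_mul]
  rw [Finset.sum_comm]
  have : ∀ x, ∑ k : Fin d → ZMod J, (U x : ℂ) * chr k x * chr k (-y)
      = if x = y then (J : ℂ) ^ d * U y else 0 := by
    intro x
    simp_rw [mul_assoc, ← chr_add]
    rw [← Finset.mul_sum, sum_chr]
    by_cases h : x = y
    · subst h; simp [mul_comm]
    · have : ¬ (x + -y = 0) := fun hh => h (by simpa [sub_eq_zero, ← sub_eq_add_neg] using hh)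
      simp [h, this]
  simp_rw [this]; simp

lemma ft_injective {U V : Grid d J} (h : ∀ k, ft k U = ft k V) : U = V := by
  ext y
  have h1 := ft_inversion U y
  have h2 := ft_inversion V y
  simp_rw [h] at h1
  rw [h1] at h2
  have hJ : (J : ℂ) ^ d ≠ 0 := pow_ne_zero _ (by exact_mod_cast NeZero.ne J)
  exact_mod_cast mul_left_cancel₀ hJ h2

lemma parseval (U V : Grid d J) :
    ∑ k, ft k U * conj (ft k V) = (J : ℂ) ^ d * ∑ x, ((U x * V x : ℝ) : ℂ) := by
  have : ∀ k, ft k U * conj (ft k V) = ∑ x, (V x : ℂ) * (ft k U * chr k (-x)) := by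
    intro k
    rw [ft_apply k V, map_sum, Finset.mul_sum]
    refine Finset.sum_congr rfl fun x _ => ?_
    rw [chr_neg, map_mul, Complex.conj_ofReal]; ring
  simp_rw [this]
  rw [Finset.sum_comm]
  simp_rw [← Finset.mul_sum, ft_inversion, Finset.mul_sum]
  refine Finset.sum_congr rfl fun x _ => ?_
  push_cast; ring

/-- The weight relating Fourier sums and the discrete inner product. -/
def fw (d J : ℕ) (h : ℝ) : ℝ := h ^ d / (J : ℝ) ^ d

lemma fw_nonneg {h : ℝ} (hh : 0 ≤ h) : 0 ≤ fw d J h := by unfold fw; positivity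

lemma inn_eq_ft (h : ℝ) (U V : Grid d J) :
    inn h U V = fw d J h * ∑ k, (ft k U * conj (ft k V)).re := by
  have hJ : (J : ℝ) ^ d ≠ 0 := pow_ne_zero _ (by exact_mod_cast NeZero.ne J)
  have := congrArg Complex.re (parseval U V)
  rw [Complex.re_sum] at this
  rw [this, inn, fw]
  have h2 : ((J : ℂ) ^ d * ∑ x, ((U x * V x : ℝ) : ℂ)).re = (J : ℝ) ^ d * ∑ x, U x * V x := by
    rw [← Complex.ofReal_sum, ← Complex.ofReal_natCast, ← Complex.ofReal_pow, ← Complex.ofReal_mul,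
      Complex.ofReal_re]
  rw [h2]; field_simp

lemma inn_self_nonneg {h : ℝ} (hh : 0 ≤ h) (U : Grid d J) : 0 ≤ inn h U U :=
  mul_nonneg (by positivity) (Finset.sum_nonneg fun x _ => mul_self_nonneg _)

lemma nrm_sq {h : ℝ} (hh : 0 ≤ h) (U : Grid d J) : nrm h U ^ 2 = inn h U U :=
  Real.sq_sqrt (inn_self_nonneg hh U)

lemma nrm_nonneg (h : ℝ) (U : Grid d J) : 0 ≤ nrm h U := Real.sqrt_nonneg _

lemma gradNrm_nonneg (h : ℝ) (U : Grid d J) : 0 ≤ gradNrm h U := Real.sqrt_nonneg _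

lemma gradNrm_sq (h : ℝ) (U : Grid d J) : gradNrm h U ^ 2 = ∑ k, nrm h (Dp h k U) ^ 2 :=
  Real.sq_sqrt (Finset.sum_nonneg fun _ _ => sq_nonneg _)

lemma nrm_sq_ft {h : ℝ} (hh : 0 ≤ h) (U : Grid d J) :
    nrm h U ^ 2 = fw d J h * ∑ k, ‖ft k U‖ ^ 2 := by
  rw [nrm_sq hh, inn_eq_ft]
  congr 1
  refine Finset.sum_congr rfl fun k _ => ?_
  rw [Complex.mul_conj, Complex.ofReal_re, Complex.normSq_eq_norm_sq]

/-- The transform uses the unconjugated character, so a shift by e produces the character at -e.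
This is why the conjugate sits in `symP` and not in `symM`. -/
lemma ft_shift (k e : Fin d → ZMod J) (U : Grid d J) :
    ft k (fun x => U (x + e)) = chr k (-e) * ft k U := by
  rw [ft_apply, ft_apply, Finset.mul_sum]
  refine Fintype.sum_equiv (Equiv.addRight e) _ _ fun x => ?_
  simp only [Equiv.coe_addRight]
  rw [mul_comm (chr k (-e)), mul_assoc, ← chr_add, add_neg_cancel_right]

/-- Fourier symbol of the forward difference. -/
def symP (h : ℝ) (i : Fin d) (k : Fin d → ZMod J) : ℂ :=
  (conj (ZMod.stdAddChar (k i)) - 1) / h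

/-- Fourier symbol of the backward difference. -/
def symM (h : ℝ) (i : Fin d) (k : Fin d → ZMod J) : ℂ :=
  (1 - ZMod.stdAddChar (k i)) / h

/-- Fourier symbol of the central difference. -/
def symC (h : ℝ) (i : Fin d) (k : Fin d → ZMod J) : ℂ := (symP h i k + symM h i k) / 2

/-- One-dimensional contribution to the Fourier symbol of `-Δ_h`. -/
def lam1 (h : ℝ) (m : ZMod J) : ℝ := ‖(ZMod.stdAddChar m : ℂ) - 1‖ ^ 2 / h ^ 2

/-- Fourier symbol of `-Δ_h`. -/
def lam (h : ℝ) (k : Fin d → ZMod J) : ℝ := ∑ i, lam1 h (k i)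

lemma lam1_nonneg (h : ℝ) (m : ZMod J) : 0 ≤ lam1 h m := by unfold lam1; positivity

lemma lam_nonneg (h : ℝ) (k : Fin d → ZMod J) : 0 ≤ lam h k :=
  Finset.sum_nonneg fun _ _ => lam1_nonneg _ _

lemma ft_Dp (h : ℝ) (i : Fin d) (U : Grid d J) (k : Fin d → ZMod J) :
    ft k (Dp h i U) = symP h i k * ft k U := by
  have : Dp h i U = h⁻¹ • ((fun x => U (x + unitVec d J i)) - U) := by
    ext x; simp [Dp]; ring
  rw [this, map_smul, map_sub, ft_shift, chr_neg, chr_unitVec, symP, Complex.real_smul]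
  push_cast; ring

lemma ft_Dm (h : ℝ) (i : Fin d) (U : Grid d J) (k : Fin d → ZMod J) :
    ft k (Dm h i U) = symM h i k * ft k U := by
  have : Dm h i U = h⁻¹ • (U - (fun x => U (x + -unitVec d J i))) := by
    ext x; simp [Dm, ← sub_eq_add_neg]; ring
  rw [this, map_smul, map_sub, ft_shift, neg_neg, chr_unitVec, symM, Complex.real_smul]
  push_cast; ring

lemma ft_Dc (h : ℝ) (i : Fin d) (U : Grid d J) (k : Fin d → ZMod J) :
    ft k (Dc h i U) = symC h i k * ft k U := by
  have : Dc h i U = (2 : ℝ)⁻¹ • (Dp h i U + Dm h i U) := by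
    ext x; simp [Dc, Dp, Dm]; ring
  rw [this, map_smul, map_add, ft_Dp, ft_Dm, symC, Complex.real_smul]
  push_cast; ring

lemma norm_symP (h : ℝ) (i : Fin d) (k : Fin d → ZMod J) :
    ‖symP h i k‖ ^ 2 = lam1 h (k i) := by
  rw [symP, lam1, norm_div, div_pow, ← Complex.norm_conj ((ZMod.stdAddChar (k i) : ℂ) - 1)]
  simp

lemma norm_symM (h : ℝ) (i : Fin d) (k : Fin d → ZMod J) :
    ‖symM h i k‖ ^ 2 = lam1 h (k i) := by
  rw [symM, lam1, norm_div, div_pow, ← norm_neg, neg_sub]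
  simp

/-- The central symbol is the mean of two complex numbers of equal modulus. Consequently the
wide-stencil Hessian is controlled by the compact Laplacian. -/
lemma norm_symC_le (h : ℝ) (i : Fin d) (k : Fin d → ZMod J) :
    ‖symC h i k‖ ^ 2 ≤ lam1 h (k i) := by
  have h1 := norm_symP h i k
  have h2 := norm_symM h i k
  have h3 := norm_add_le (symP h i k) (symM h i k)
  have h4 : ‖symC h i k‖ = ‖symP h i k + symM h i k‖ / 2 := by rw [symC, norm_div]; simp
  have h5 : ‖symP h i k‖ = ‖symM h i k‖ := by
    rw [← h2] at h1
    exact (pow_left_inj₀ (norm_nonneg _) (norm_nonneg _) two_ne_zero).1 h1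
  rw [h4, ← h1]
  have := norm_nonneg (symP h i k + symM h i k)
  gcongr; linarith

/-- The forward difference is minus the adjoint of the backward one, so the product of symbols is
minus a squared modulus. The discrete Laplacian thus has a real nonpositive symbol. -/
lemma symP_mul_symM (h : ℝ) (i : Fin d) (k : Fin d → ZMod J) :
    symP h i k * symM h i k = -(lam1 h (k i) : ℂ) := by
  have h2 := norm_symM h i k
  have : symP h i k = - conj (symM h i k) := by
    rw [symP, symM, map_div₀, Complex.conj_ofReal, map_sub, map_one]; ring
  rw [this, neg_mul, mul_comm, Complex.mul_conj, Complex.normSq_eq_norm_sq, h2]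

lemma ft_lap (h : ℝ) (U : Grid d J) (k : Fin d → ZMod J) :
    ft k (lap h U) = -(lam h k : ℂ) * ft k U := by
  have : lap h U = ∑ i, Dp h i (Dm h i U) := by simp [lap]
  rw [this, map_sum]
  simp_rw [ft_Dp, ft_Dm, ← mul_assoc, symP_mul_symM]
  rw [← Finset.sum_mul, lam]; push_cast; simp

lemma gradNrm_sq_ft {h : ℝ} (hh : 0 ≤ h) (U : Grid d J) :
    gradNrm h U ^ 2 = fw d J h * ∑ k, lam h k * ‖ft k U‖ ^ 2 := by
  rw [gradNrm_sq]
  simp_rw [nrm_sq_ft hh, ft_Dp, norm_mul, mul_pow, norm_symP]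
  rw [← Finset.mul_sum, Finset.sum_comm]
  simp_rw [← Finset.sum_mul]; rfl

lemma nrm_lap_sq_ft {h : ℝ} (hh : 0 ≤ h) (U : Grid d J) :
    nrm h (lap h U) ^ 2 = fw d J h * ∑ k, lam h k ^ 2 * ‖ft k U‖ ^ 2 := by
  simp_rw [nrm_sq_ft hh, ft_lap, norm_mul, mul_pow]
  simp

lemma gradNrm_lap_sq_ft {h : ℝ} (hh : 0 ≤ h) (U : Grid d J) :
    gradNrm h (lap h U) ^ 2 = fw d J h * ∑ k, lam h k ^ 3 * ‖ft k U‖ ^ 2 := by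
  simp_rw [gradNrm_sq_ft hh, ft_lap, norm_mul, mul_pow]
  congr 1; refine Finset.sum_congr rfl fun k _ => ?_
  simp; ring

lemma nrm_lap_lap_sq_ft {h : ℝ} (hh : 0 ≤ h) (U : Grid d J) :
    nrm h (lap h (lap h U)) ^ 2 = fw d J h * ∑ k, lam h k ^ 4 * ‖ft k U‖ ^ 2 := by
  simp_rw [nrm_lap_sq_ft hh, ft_lap, norm_mul, mul_pow]
  congr 1; refine Finset.sum_congr rfl fun k _ => ?_
  simp; ring

end Fourier

/-! ### Uniform discrete Sobolev inequality -/

section Sobolev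
variable {d J : ℕ} [NeZero J]

/-- The chord length is 2|sin(θ/2)|, and Jordan's inequality |sin x| ≥ 2|x|/π applies because the
representative of least absolute value keeps |θ/2| ≤ π/2. -/
lemma norm_stdAddChar_sub_one (m : ZMod J) :
    4 * (m.valMinAbs.natAbs : ℝ) / J ≤ ‖(ZMod.stdAddChar m : ℂ) - 1‖ := by
  have hJ : (0 : ℝ) < J := by exact_mod_cast NeZero.pos J
  set n : ℤ := m.valMinAbs with hn
  have hm : (ZMod.stdAddChar m : ℂ) = Complex.exp (Complex.I * ((2 * Real.pi * n / J : ℝ) : ℂ)) := by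
    conv_lhs => rw [← ZMod.coe_valMinAbs m]
    rw [ZMod.stdAddChar_coe]
    congr 1; push_cast; ring
  rw [hm, Complex.norm_exp_I_mul_ofReal_sub_one, norm_mul, Real.norm_eq_abs, Real.norm_eq_abs,
    abs_of_pos (two_pos : (0 : ℝ) < 2)]
  have h1 : (m.valMinAbs.natAbs : ℝ) ≤ J / 2 := by
    have := ZMod.natAbs_valMinAbs_le m
    have h2 : ((m.valMinAbs.natAbs : ℕ) : ℝ) ≤ ((J / 2 : ℕ) : ℝ) := by exact_mod_cast this
    exact h2.trans Nat.cast_div_le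
  have h3 : ((m.valMinAbs.natAbs : ℕ) : ℝ) = |(n : ℝ)| := by
    rw [Nat.cast_natAbs]; push_cast; rfl
  rw [h3] at h1 ⊢
  have habs : |2 * Real.pi * n / J / 2| = Real.pi * |(n : ℝ)| / J := by
    rw [abs_div, abs_div, abs_mul, abs_mul, abs_of_pos Real.pi_pos, abs_of_pos hJ]
    rw [abs_of_pos (two_pos : (0 : ℝ) < 2)]; ring
  have := Real.mul_abs_le_abs_sin (x := 2 * Real.pi * n / J / 2) (by
    rw [habs, div_le_iff₀ hJ]
    nlinarith [Real.pi_pos])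
  rw [habs] at this
  calc 4 * |(n : ℝ)| / J = 2 * (2 / Real.pi * (Real.pi * |(n : ℝ)| / J)) := by
        field_simp; ring
    _ ≤ _ := by gcongr

lemma lam1_ge {h L : ℝ} (hh : 0 < h) (hL : h * J = L) (m : ZMod J) :
    16 / L ^ 2 * (m.valMinAbs.natAbs : ℝ) ^ 2 ≤ lam1 h m := by
  have hJ : (0 : ℝ) < J := by exact_mod_cast NeZero.pos J
  have h1 := norm_stdAddChar_sub_one m
  rw [lam1, le_div_iff₀ (by positivity), ← hL]
  calc _ = (4 * (m.valMinAbs.natAbs : ℝ) / J) ^ 2 := by field_simp; ring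
    _ ≤ _ := by gcongr

/-- Each natural number is the absolute value of at most two residues: after splitting by sign,
`natAbs` is injective on each half. -/
lemma sum_valMinAbs_le (f : ℕ → ℝ) (hf : ∀ n, 0 ≤ f n) (hs : Summable f) :
    ∑ m : ZMod J, f m.valMinAbs.natAbs ≤ 2 * ∑' n, f n := by
  classical
  have hsplit := Finset.sum_filter_add_sum_filter_not (Finset.univ : Finset (ZMod J))
    (fun m => 0 ≤ m.valMinAbs) (fun m => f m.valMinAbs.natAbs)
  rw [← hsplit, two_mul]
  have key : ∀ s : Finset (ZMod J), Set.InjOn (fun m : ZMod J => m.valMinAbs.natAbs) s →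
      ∑ m ∈ s, f m.valMinAbs.natAbs ≤ ∑' n, f n := by
    intro s hs'
    rw [← Finset.sum_image (f := f) (g := fun m : ZMod J => m.valMinAbs.natAbs) hs']
    exact hs.sum_le_tsum _ (fun i _ => hf i)
  refine add_le_add (key _ ?_) (key _ ?_)
  · intro a ha b hb hab
    simp only [Finset.coe_filter, Finset.mem_univ, true_and, Set.mem_ofPred_eq] at ha hb
    apply ZMod.injective_valMinAbs
    simp only at hab; omega
  · intro a ha b hb hab
    simp only [Finset.coe_filter, Finset.mem_univ, true_and, Set.mem_ofPred_eq] at ha hb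
    apply ZMod.injective_valMinAbs
    simp only at hab; omega

lemma summable_decay {c : ℝ} (hc : 0 < c) :
    Summable fun n : ℕ => (1 + c * (n : ℝ) ^ 2) ^ (-(7 / 12) : ℝ) := by
  -- Dropping n = 0 keeps the base of the comparison power positive.
  rw [← summable_nat_add_iff 1]
  have h0 : Summable fun n : ℕ => ((n : ℝ)) ^ (-(7 / 6) : ℝ) :=
    Real.summable_nat_rpow.2 (by norm_num)
  have h1 := ((summable_nat_add_iff 1).2 h0).mul_left (c ^ (-(7 / 12) : ℝ))
  refine Summable.of_nonneg_of_le (fun n => by positivity) (fun n => ?_) h1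
  have hn : (0 : ℝ) < ((n + 1 : ℕ) : ℝ) := by positivity
  calc _ ≤ (c * ((n + 1 : ℕ) : ℝ) ^ 2) ^ (-(7 / 12) : ℝ) := by
        apply Real.rpow_le_rpow_of_nonpos (by positivity) (by linarith) (by norm_num)
    _ = _ := by
        rw [Real.mul_rpow hc.le (by positivity), ← Real.rpow_natCast, ← Real.rpow_mul hn.le]
        norm_num

/-- The lattice sums controlling the embedding into bounded functions are uniform in the mesh. -/
lemma exists_sum_lam_le (d : ℕ) (hd : d ≤ 3) (L : ℝ) (hL : 0 < L) :
    ∃ S : ℝ, 0 < S ∧ ∀ (J : ℕ) [NeZero J] (h : ℝ), 0 < h → h * J = L →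
      ∑ k : Fin d → ZMod J, (1 + lam h k) ^ (-(7 / 4) : ℝ) ≤ S := by
  set f : ℕ → ℝ := fun n => (1 + 16 / L ^ 2 * (n : ℝ) ^ 2) ^ (-(7 / 12) : ℝ) with hf
  have hfs : Summable f := summable_decay (by positivity)
  have hf0 : ∀ n, 0 ≤ f n := fun n => by positivity
  refine ⟨(2 * ∑' n, f n) ^ d + 1, ?_, ?_⟩
  · have : 0 ≤ ∑' n, f n := tsum_nonneg hf0
    positivity
  intro J _ h hh hJ
  have hpt : ∀ k : Fin d → ZMod J, (1 + lam h k) ^ (-(7 / 4) : ℝ)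
      ≤ ∏ i, f (k i).valMinAbs.natAbs := by
    intro k
    have hl := lam_nonneg h k
    -- The exponent 7/4 = 3 · 7/12 is spread over the d ≤ 3 coordinates. Each factor then sees only
    -- its own frequency and decays like n^(-7/6), which is summable.
    have h1 : (1 + lam h k) ^ (-(7 / 4) : ℝ) ≤ ∏ _i : Fin d, (1 + lam h k) ^ (-(7 / 12) : ℝ) := by
      rw [Finset.prod_const, Finset.card_univ, Fintype.card_fin, ← Real.rpow_natCast,
        ← Real.rpow_mul (by positivity)]
      apply Real.rpow_le_rpow_of_exponent_le (by linarith)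
      have : (d : ℝ) ≤ 3 := by exact_mod_cast hd
      linarith
    refine h1.trans (Finset.prod_le_prod (fun i _ => by positivity) fun i _ => ?_)
    apply Real.rpow_le_rpow_of_nonpos (by positivity) _ (by norm_num)
    have h2 := lam1_ge hh hJ (k i)
    have h3 : lam1 h (k i) ≤ lam h k :=
      Finset.single_le_sum (f := fun i => lam1 h (k i)) (fun _ _ => lam1_nonneg _ _)
        (Finset.mem_univ i)
    linarith
  have hprod : ∑ k : Fin d → ZMod J, ∏ i, f (k i).valMinAbs.natAbs
      = ∏ _i : Fin d, ∑ m : ZMod J, f m.valMinAbs.natAbs := by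
    rw [Finset.prod_univ_sum, Fintype.piFinset_univ]
  calc _ ≤ ∑ k : Fin d → ZMod J, ∏ i, f (k i).valMinAbs.natAbs := Finset.sum_le_sum fun k _ => hpt k
    _ = (∑ m : ZMod J, f m.valMinAbs.natAbs) ^ d := by rw [hprod]; simp
    _ ≤ (2 * ∑' n, f n) ^ d := by
        have := sum_valMinAbs_le (J := J) f hf0 hfs
        gcongr
    _ ≤ _ := by linarith

/-- Fourier inversion followed by Cauchy–Schwarz with the weights (1 + λ)^(±7/4). The exponent
exceeds 3/2, so the sum of negative powers converges uniformly in the mesh, and is below 2, so the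
positive power is dominated by a small multiple of λ². -/
lemma sq_apply_le {h L : ℝ} (hh : 0 < h) (hL : h * J = L) (U : Grid d J) (y : Fin d → ZMod J) :
    U y ^ 2 ≤ (∑ k : Fin d → ZMod J, (1 + lam h k) ^ (-(7 / 4) : ℝ)) / L ^ d
      * (fw d J h * ∑ k, (1 + lam h k) ^ (7 / 4 : ℝ) * ‖ft k U‖ ^ 2) := by
  have hJ : (0 : ℝ) < J := by exact_mod_cast NeZero.pos J
  have hJd : (0 : ℝ) < (J : ℝ) ^ d := by positivity
  have h1 : (J : ℝ) ^ d * |U y| ≤ ∑ k : Fin d → ZMod J, ‖ft k U‖ := by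
    have := congrArg norm (ft_inversion U y)
    rw [norm_mul, norm_pow, Complex.norm_natCast, Complex.norm_real, Real.norm_eq_abs] at this
    rw [← this]
    refine (norm_sum_le _ _).trans (Finset.sum_le_sum fun k _ => ?_)
    rw [norm_mul, norm_chr, mul_one]
  have h2 : (∑ k : Fin d → ZMod J, ‖ft k U‖) ^ 2 ≤
      (∑ k : Fin d → ZMod J, (1 + lam h k) ^ (-(7 / 4) : ℝ))
        * ∑ k, (1 + lam h k) ^ (7 / 4 : ℝ) * ‖ft k U‖ ^ 2 := by
    refine Finset.sum_sq_le_sum_mul_sum_of_sq_le_mul _ (fun k _ => ?_) (fun k _ => ?_)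
      (fun k _ => ?_)
    · have := lam_nonneg h k; positivity
    · have := lam_nonneg h k; positivity
    · have := lam_nonneg h k
      rw [← mul_assoc, ← Real.rpow_add (by positivity)]; simp
  have h3 : ((J : ℝ) ^ d * |U y|) ^ 2 ≤ (∑ k : Fin d → ZMod J, ‖ft k U‖) ^ 2 := by gcongr
  rw [mul_pow, sq_abs] at h3
  have h4 := h3.trans h2
  set A := ∑ k : Fin d → ZMod J, (1 + lam h k) ^ (-(7 / 4) : ℝ)
  set B := ∑ k : Fin d → ZMod J, (1 + lam h k) ^ (7 / 4 : ℝ) * ‖ft k U‖ ^ 2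
  have h5 : A / L ^ d * (fw d J h * B) = A * B / ((J : ℝ) ^ d) ^ 2 := by
    rw [← hL, fw, mul_pow]; field_simp
  rw [h5, le_div_iff₀ (by positivity)]
  linarith

lemma exists_rpow_le {δ : ℝ} (hδ : 0 < δ) :
    ∃ C : ℝ, 0 < C ∧ ∀ t : ℝ, 0 ≤ t → (1 + t) ^ (7 / 4 : ℝ) ≤ δ * t ^ 2 + C := by
  -- The base is the threshold beyond which (1 + t)^(-1/4) ≤ δ/2; below it the power is bounded by
  -- its value there. The extra δ pays for (1 + t)² ≤ 2t² + 2.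
  refine ⟨(1 + (δ / 2)⁻¹ ^ 4) ^ (7 / 4 : ℝ) + δ, by positivity, fun t ht => ?_⟩
  set R := 1 + (δ / 2)⁻¹ ^ 4 with hR
  have hR0 : 0 < R := by positivity
  rcases le_or_gt (1 + t) R with h | h
  · have := Real.rpow_le_rpow (by positivity) h (by norm_num : (0 : ℝ) ≤ 7 / 4)
    nlinarith [sq_nonneg t]
  · have ht1 : 0 < 1 + t := by linarith
    have h1 : (1 + t) ^ (7 / 4 : ℝ) = (1 + t) ^ 2 * (1 + t) ^ (-(1 / 4) : ℝ) := by
      rw [← Real.rpow_natCast, ← Real.rpow_add ht1]; norm_num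
    have h2 : (1 + t) ^ (-(1 / 4) : ℝ) ≤ δ / 2 := by
      have : (1 + t) ^ (-(1 / 4) : ℝ) ≤ ((δ / 2)⁻¹ ^ 4) ^ (-(1 / 4) : ℝ) :=
        Real.rpow_le_rpow_of_nonpos (by positivity) (by linarith) (by norm_num)
      refine this.trans (le_of_eq ?_)
      rw [← Real.rpow_natCast, ← Real.rpow_mul (by positivity)]
      norm_num
      rw [Real.rpow_neg_one]; field_simp
    have h3 : 0 ≤ R ^ (7 / 4 : ℝ) := by positivity
    rw [h1]
    calc (1 + t) ^ 2 * (1 + t) ^ (-(1 / 4) : ℝ) ≤ (1 + t) ^ 2 * (δ / 2) := by gcongr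
      _ ≤ δ * t ^ 2 + δ := by nlinarith [mul_nonneg hδ.le (sq_nonneg (1 - t))]
      _ ≤ _ := by linarith

/-- The discrete Sobolev embedding into bounded functions, in interpolated form. -/
lemma exists_sup_le (d : ℕ) (hd : d ≤ 3) (L : ℝ) (hL : 0 < L) {δ : ℝ} (hδ : 0 < δ) :
    ∃ C : ℝ, 0 < C ∧ ∀ (J : ℕ) [NeZero J] (h : ℝ), 0 < h → h * J = L → ∀ U : Grid d J,
      ‖U‖ ^ 2 ≤ δ * nrm h (lap h U) ^ 2 + C * nrm h U ^ 2 := by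
  obtain ⟨S, hS, hsum⟩ := exists_sum_lam_le d hd L hL
  -- The small parameter is scaled to cancel the factor S / L^d that the lattice sum contributes.
  obtain ⟨C, hC, hpow⟩ := exists_rpow_le (δ := δ * L ^ d / S) (by positivity)
  refine ⟨S / L ^ d * C, by positivity, fun J _ h hh hJ U => ?_⟩
  have hpt : ∀ y, U y ^ 2 ≤ δ * nrm h (lap h U) ^ 2 + S / L ^ d * C * nrm h U ^ 2 := by
    intro y
    refine (sq_apply_le hh hJ U y).trans ?_
    have hw := fw_nonneg (d := d) (J := J) hh.le
    have h1 : ∑ k, (1 + lam h k) ^ (7 / 4 : ℝ) * ‖ft k U‖ ^ 2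
        ≤ ∑ k, (δ * L ^ d / S * lam h k ^ 2 + C) * ‖ft k U‖ ^ 2 :=
      Finset.sum_le_sum fun k _ => by
        have := hpow _ (lam_nonneg h k)
        gcongr
    have h2 := hsum J h hh hJ
    have h0 : 0 ≤ ∑ k, (1 + lam h k) ^ (7 / 4 : ℝ) * ‖ft k U‖ ^ 2 :=
      Finset.sum_nonneg fun k _ => by have := lam_nonneg h k; positivity
    calc _ ≤ S / L ^ d * (fw d J h * ∑ k, (δ * L ^ d / S * lam h k ^ 2 + C) * ‖ft k U‖ ^ 2) := by
          gcongr
      _ = _ := by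
          simp_rw [nrm_lap_sq_ft hh.le, nrm_sq_ft hh.le, add_mul, Finset.sum_add_distrib, mul_assoc,
            ← Finset.mul_sum]
          field_simp
  have hR : 0 ≤ δ * nrm h (lap h U) ^ 2 + S / L ^ d * C * nrm h U ^ 2 := by positivity
  have : ‖U‖ ≤ √(δ * nrm h (lap h U) ^ 2 + S / L ^ d * C * nrm h U ^ 2) := by
    rw [pi_norm_le_iff_of_nonneg (Real.sqrt_nonneg _)]
    intro y
    rw [Real.norm_eq_abs]
    exact Real.abs_le_sqrt (hpt y)
  calc ‖U‖ ^ 2 ≤ _ := pow_le_pow_left₀ (norm_nonneg _) this 2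
    _ = _ := Real.sq_sqrt hR

end Sobolev

/-! ### Estimates for differences and products -/

section Differences
variable {d J : ℕ} [NeZero J]

lemma nrm_eq_norm {h : ℝ} (hh : 0 ≤ h) (U : Grid d J) :
    nrm h U = √(h ^ d) * ‖(WithLp.toLp 2 U : EuclideanSpace ℝ (Fin d → ZMod J))‖ := by
  rw [nrm, inn, EuclideanSpace.norm_eq, ← Real.sqrt_mul (by positivity)]
  simp [pow_two]

/-- The discrete `L²` norm as a seminorm. -/
def nrmSem (d J : ℕ) [NeZero J] {h : ℝ} (hh : 0 ≤ h) : Seminorm ℝ (Grid d J) :=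
  Seminorm.of (nrm h)
    (fun U V => by
      simp_rw [nrm_eq_norm hh, WithLp.toLp_add, ← mul_add]
      gcongr
      exact norm_add_le _ _)
    (fun r U => by
      simp_rw [nrm_eq_norm hh, WithLp.toLp_smul, norm_smul]; ring)

@[simp] lemma nrmSem_apply {h : ℝ} (hh : 0 ≤ h) (U : Grid d J) : nrmSem d J hh U = nrm h U := rfl

lemma nrm_add_le {h : ℝ} (hh : 0 ≤ h) (U V : Grid d J) : nrm h (U + V) ≤ nrm h U + nrm h V :=
  map_add_le_add (nrmSem d J hh) U V

lemma nrm_smul {h : ℝ} (hh : 0 ≤ h) (r : ℝ) (U : Grid d J) : nrm h (r • U) = |r| * nrm h U :=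
  map_smul_eq_mul (nrmSem d J hh) r U

lemma nrm_neg {h : ℝ} (hh : 0 ≤ h) (U : Grid d J) : nrm h (-U) = nrm h U :=
  map_neg_eq_map (nrmSem d J hh) U

lemma seminorm_sum_le {ι E : Type*} [AddCommGroup E] [Module ℝ E] (ν : Seminorm ℝ E)
    (s : Finset ι) (f : ι → E) : ν (∑ i ∈ s, f i) ≤ ∑ i ∈ s, ν (f i) :=
  Finset.le_sum_of_subadditive ν (map_zero ν).le (map_add_le_add ν) s f

lemma inn_le {h : ℝ} (hh : 0 ≤ h) (U V : Grid d J) : inn h U V ≤ nrm h U * nrm h V := by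
  rw [nrm, nrm, inn, inn, inn, Real.sqrt_mul (by positivity), Real.sqrt_mul (by positivity)]
  have h1 : ∑ x, U x * V x ≤ √(∑ x, U x * U x) * √(∑ x, V x * V x) := by
    simpa [pow_two] using Real.sum_mul_le_sqrt_mul_sqrt Finset.univ U V
  have h2 : √(h ^ d) * √(h ^ d) = h ^ d := Real.mul_self_sqrt (by positivity)
  calc _ ≤ h ^ d * (√(∑ x, U x * U x) * √(∑ x, V x * V x)) := by gcongr
    _ = _ := by linear_combination -(√(∑ x, U x * U x) * √(∑ x, V x * V x)) * h2

lemma abs_inn_le {h : ℝ} (hh : 0 ≤ h) (U V : Grid d J) : |inn h U V| ≤ nrm h U * nrm h V := by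
  rw [abs_le]
  have h1 := inn_le hh (-U) V
  rw [nrm_neg hh] at h1
  have h2 : inn h (-U) V = - inn h U V := by simp [inn]
  exact ⟨by linarith, inn_le hh U V⟩

lemma nrm_mono {h : ℝ} (hh : 0 ≤ h) {U V : Grid d J} (H : ∀ x, |U x| ≤ |V x|) :
    nrm h U ≤ nrm h V := by
  unfold nrm inn
  refine Real.sqrt_le_sqrt (mul_le_mul_of_nonneg_left (Finset.sum_le_sum fun x _ => ?_)
    (by positivity))
  rw [← abs_mul_abs_self (U x), ← abs_mul_abs_self (V x)]
  exact mul_self_le_mul_self (abs_nonneg _) (H x)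

lemma abs_apply_le (U : Grid d J) (x : Fin d → ZMod J) : |U x| ≤ ‖U‖ := norm_le_pi_norm U x

lemma nrm_mul_le {h : ℝ} (hh : 0 ≤ h) (U V : Grid d J) : nrm h (U * V) ≤ ‖U‖ * nrm h V := by
  have : nrm h (U * V) ≤ nrm h (‖U‖ • V) := nrm_mono hh fun x => by
    simp only [Pi.mul_apply, Pi.smul_apply, smul_eq_mul, abs_mul, abs_norm]
    gcongr
    exact abs_apply_le U x
  rwa [nrm_smul hh, abs_norm] at this

lemma nrm_mul_le' {h : ℝ} (hh : 0 ≤ h) (U V : Grid d J) : nrm h (U * V) ≤ nrm h U * ‖V‖ := by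
  rw [mul_comm U V, mul_comm (nrm h U)]; exact nrm_mul_le hh V U

/-- Translation of a grid function. -/
def sh (e : Fin d → ZMod J) (U : Grid d J) : Grid d J := fun x => U (x + e)

lemma sum_sh (e : Fin d → ZMod J) (f : (Fin d → ZMod J) → ℝ) : ∑ x, f (x + e) = ∑ x, f x :=
  Fintype.sum_equiv (Equiv.addRight e) _ _ fun _ => rfl

lemma norm_sh_le (e : Fin d → ZMod J) (U : Grid d J) : ‖sh e U‖ ≤ ‖U‖ :=
  (pi_norm_le_iff_of_nonneg (norm_nonneg _)).2 fun x => norm_le_pi_norm U (x + e)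

lemma Dp_mul (h : ℝ) (k : Fin d) (U V : Grid d J) :
    Dp h k (U * V) = Dp h k U * V + sh (unitVec d J k) U * Dp h k V := by
  ext x; simp [Dp, sh]; ring

lemma Dm_mul (h : ℝ) (k : Fin d) (U V : Grid d J) :
    Dm h k (U * V) = Dm h k U * V + sh (-unitVec d J k) U * Dm h k V := by
  ext x; simp [Dm, sh, ← sub_eq_add_neg]; ring

lemma Dm_sh (h : ℝ) (k : Fin d) (e : Fin d → ZMod J) (U : Grid d J) :
    Dm h k (sh e U) = sh e (Dm h k U) := by
  ext x; simp only [Dm, sh, LinearMap.coe_mk, AddHom.coe_mk]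
  rw [add_sub_right_comm]

lemma nrm_Dp_mul_le {h : ℝ} (hh : 0 ≤ h) (k : Fin d) (U V : Grid d J) :
    nrm h (Dp h k (U * V)) ≤ nrm h (Dp h k U) * ‖V‖ + ‖U‖ * nrm h (Dp h k V) := by
  rw [Dp_mul]
  refine (nrm_add_le hh _ _).trans (add_le_add (nrm_mul_le' hh _ _) ?_)
  refine (nrm_mul_le hh _ _).trans ?_
  gcongr
  · exact nrm_nonneg _ _
  · exact norm_sh_le _ _

/-- Variant with the differenced factor in the supremum norm. It serves the product of u with its
Hessian, where the Hessian is only square-summable. -/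
lemma nrm_Dp_mul_le' {h : ℝ} (hh : 0 ≤ h) (k : Fin d) (U V : Grid d J) :
    nrm h (Dp h k (U * V)) ≤ ‖Dp h k U‖ * nrm h V + ‖U‖ * nrm h (Dp h k V) := by
  rw [Dp_mul]
  refine (nrm_add_le hh _ _).trans (add_le_add (nrm_mul_le hh _ _) ?_)
  refine (nrm_mul_le hh _ _).trans ?_
  gcongr
  · exact nrm_nonneg _ _
  · exact norm_sh_le _ _

/-! #### Comparison of Fourier symbols -/

lemma nrm_le_nrm_lap {h : ℝ} (hh : 0 ≤ h) {U V : Grid d J}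
    (H : ∀ k, ‖ft k V‖ ^ 2 ≤ lam h k ^ 2 * ‖ft k U‖ ^ 2) : nrm h V ≤ nrm h (lap h U) := by
  refine le_of_sq_le_sq ?_ (nrm_nonneg _ _)
  rw [nrm_lap_sq_ft hh, nrm_sq_ft hh]
  have := fw_nonneg (d := d) (J := J) hh
  gcongr with k
  exact H k

lemma lam1_le_lam (h : ℝ) (i : Fin d) (k : Fin d → ZMod J) : lam1 h (k i) ≤ lam h k :=
  Finset.single_le_sum (f := fun i => lam1 h (k i)) (fun _ _ => lam1_nonneg _ _)
    (Finset.mem_univ i)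

lemma nrm_Dm_Dm_le {h : ℝ} (hh : 0 ≤ h) (i j : Fin d) (U : Grid d J) :
    nrm h (Dm h i (Dm h j U)) ≤ nrm h (lap h U) := by
  refine nrm_le_nrm_lap hh fun k => ?_
  have h1 := lam1_nonneg h (k j)
  have h2 := lam_nonneg h k
  rw [ft_Dm, ft_Dm, norm_mul, norm_mul, mul_pow, mul_pow, norm_symM, norm_symM, ← mul_assoc, pow_two (lam h k)]
  gcongr
  · exact lam1_le_lam h i k
  · exact lam1_le_lam h j k

lemma nrm_Dp_Dm_le {h : ℝ} (hh : 0 ≤ h) (i j : Fin d) (U : Grid d J) :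
    nrm h (Dp h i (Dm h j U)) ≤ nrm h (lap h U) := by
  refine nrm_le_nrm_lap hh fun k => ?_
  have h1 := lam1_nonneg h (k j)
  have h2 := lam_nonneg h k
  rw [ft_Dp, ft_Dm, norm_mul, norm_mul, mul_pow, mul_pow, norm_symM, norm_symP, ← mul_assoc, pow_two (lam h k)]
  gcongr
  · exact lam1_le_lam h i k
  · exact lam1_le_lam h j k

/-- For each frequency the double sum factorises into (∑ᵢ |`symC`|²)² ≤ λ². The constant is exactly
one, which lets the coupling energy be completed to a square in `exists_coercive`. -/
lemma sum_nrm_hess_le {h : ℝ} (hh : 0 ≤ h) (U : Grid d J) :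
    ∑ i, ∑ j, nrm h (comp (hess h U) i j) ^ 2 ≤ nrm h (lap h U) ^ 2 := by
  have hw := fw_nonneg (d := d) (J := J) hh
  have hc : ∀ i j, nrm h (comp (hess h U) i j) ^ 2
      = fw d J h * ∑ k, ‖symC h i k‖ ^ 2 * ‖symC h j k‖ ^ 2 * ‖ft k U‖ ^ 2 := by
    intro i j
    have : comp (hess h U) i j = Dc h i (Dc h j U) := by ext x; simp [comp, hess]
    simp_rw [this, nrm_sq_ft hh, ft_Dc, norm_mul, mul_pow, mul_assoc]
  simp_rw [hc, ← Finset.mul_sum]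
  rw [nrm_lap_sq_ft hh]
  gcongr
  calc _ = ∑ k, (∑ i, ‖symC h i k‖ ^ 2) ^ 2 * ‖ft k U‖ ^ 2 := by
        simp_rw [Finset.sum_comm (s := (Finset.univ : Finset (Fin d)))
          (t := (Finset.univ : Finset (Fin d → ZMod J)))]
        refine Finset.sum_congr rfl fun k _ => ?_
        rw [pow_two (∑ i, _), Finset.sum_mul_sum, Finset.sum_mul]
        simp_rw [Finset.sum_mul]
    _ ≤ _ := by
        gcongr with k
        exact Finset.sum_le_sum fun i _ => norm_symC_le h i k

lemma nrm_hess_le {h : ℝ} (hh : 0 ≤ h) (U : Grid d J) (i j : Fin d) :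
    nrm h (comp (hess h U) i j) ≤ nrm h (lap h U) := by
  refine le_of_sq_le_sq ((le_trans ?_ (sum_nrm_hess_le hh U))) (nrm_nonneg _ _)
  refine le_trans ?_ (Finset.single_le_sum (f := fun i => ∑ j, nrm h (comp (hess h U) i j) ^ 2)
    (fun _ _ => Finset.sum_nonneg fun _ _ => sq_nonneg _) (Finset.mem_univ i))
  exact Finset.single_le_sum (f := fun j => nrm h (comp (hess h U) i j) ^ 2)
    (fun _ _ => sq_nonneg _) (Finset.mem_univ j)

lemma nrm_Dp_le (h : ℝ) (i : Fin d) (U : Grid d J) :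
    nrm h (Dp h i U) ≤ gradNrm h U := by
  refine le_of_sq_le_sq ?_ (gradNrm_nonneg _ _)
  rw [gradNrm_sq]
  exact Finset.single_le_sum (f := fun i => nrm h (Dp h i U) ^ 2)
    (fun _ _ => sq_nonneg _) (Finset.mem_univ i)

lemma nrm_Dp_hess_le {h : ℝ} (hh : 0 ≤ h) (m i j : Fin d) (U : Grid d J) :
    nrm h (Dp h m (comp (hess h U) i j)) ≤ gradNrm h (lap h U) := by
  refine le_of_sq_le_sq ?_ (gradNrm_nonneg _ _)
  have hw := fw_nonneg (d := d) (J := J) hh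
  have : comp (hess h U) i j = Dc h i (Dc h j U) := by ext x; simp [comp, hess]
  rw [gradNrm_lap_sq_ft hh, this, nrm_sq_ft hh]
  gcongr with k
  have h2 := lam_nonneg h k
  rw [ft_Dp, ft_Dc, ft_Dc, norm_mul, norm_mul, norm_mul, mul_pow, mul_pow, mul_pow, norm_symP]
  have h3 := (norm_symC_le h i k).trans (lam1_le_lam h i k)
  have h4 := (norm_symC_le h j k).trans (lam1_le_lam h j k)
  have h5 := lam1_le_lam h m k
  calc _ ≤ lam h k * (lam h k * (lam h k * ‖ft k U‖ ^ 2)) := by gcongr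
    _ = _ := by ring

lemma nrm_lap_Dp_le (h : ℝ) (m : Fin d) (U : Grid d J) :
    nrm h (lap h (Dp h m U)) ≤ gradNrm h (lap h U) := by
  have : lap h (Dp h m U) = Dp h m (lap h U) := by
    apply ft_injective; intro k; rw [ft_lap, ft_Dp, ft_Dp, ft_lap]; ring
  rw [this]; exact nrm_Dp_le h m _

lemma gradNrm_sq_le {h : ℝ} (hh : 0 ≤ h) (U : Grid d J) :
    gradNrm h U ^ 2 ≤ nrm h U ^ 2 + nrm h (lap h U) ^ 2 := by
  have hw := fw_nonneg (d := d) (J := J) hh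
  rw [gradNrm_sq_ft hh, nrm_sq_ft hh, nrm_lap_sq_ft hh, ← mul_add, ← Finset.sum_add_distrib]
  gcongr with k
  nlinarith [sq_nonneg (lam h k - 1), sq_nonneg ‖ft k U‖, lam_nonneg h k]

/-! #### A discrete Gagliardo–Nirenberg inequality -/

lemma sum_Dm_mul (h : ℝ) (k : Fin d) (U V : Grid d J) :
    ∑ x, Dm h k U x * V x = - ∑ x, U x * Dp h k V x := by
  have h1 : ∑ x, U (x - unitVec d J k) * V x = ∑ x, U x * V (x + unitVec d J k) := by
    rw [← sum_sh (unitVec d J k) fun x => U (x - unitVec d J k) * V x]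
    simp
  have h2 : ∑ x, Dm h k U x * V x
      = h⁻¹ * (∑ x, U x * V x - ∑ x, U (x - unitVec d J k) * V x) := by
    rw [← Finset.sum_sub_distrib, Finset.mul_sum]
    refine Finset.sum_congr rfl fun x _ => ?_
    simp only [Dm, LinearMap.coe_mk, AddHom.coe_mk]; ring
  rw [h2, h1, ← Finset.sum_sub_distrib, Finset.mul_sum, ← Finset.sum_neg_distrib]
  refine Finset.sum_congr rfl fun x _ => ?_
  simp only [Dp, LinearMap.coe_mk, AddHom.coe_mk]; ring

/-- Discrete form of ∫|u'|⁴ ≤ 9‖u‖∞² ∫|u''|². With v the backward difference, summation by parts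
moves one factor v off U and onto v³. The difference of a cube factors as the difference of v times
a quadratic in two neighbouring values, and Cauchy–Schwarz returns the square root of the left side,
which is divided out. -/
lemma sum_Dm_pow_four_le (h : ℝ) (k : Fin d) (U : Grid d J) :
    ∑ x, Dm h k U x ^ 4 ≤ 9 * ‖U‖ ^ 2 * ∑ x, Dp h k (Dm h k U) x ^ 2 := by
  set v := Dm h k U with hv
  set w := Dp h k v with hw
  set e := unitVec d J k with he
  have h1 : ∑ x, v x ^ 4 = - ∑ x, U x * Dp h k (fun x => v x ^ 3) x := by
    rw [← sum_Dm_mul]; exact Finset.sum_congr rfl fun x _ => by rw [← hv]; ring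
  have h2 : ∀ x, -(U x * Dp h k (fun x => v x ^ 3) x)
      ≤ ‖U‖ * (|w x| * (3 / 2 * (v (x + e) ^ 2 + v x ^ 2))) := by
    intro x
    have h3 : Dp h k (fun x => v x ^ 3) x
        = w x * (v (x + e) ^ 2 + v (x + e) * v x + v x ^ 2) := by
      simp only [hw, Dp, LinearMap.coe_mk, AddHom.coe_mk, ← he]; ring
    refine (neg_le_abs _).trans ?_
    rw [h3, abs_mul, abs_mul]
    have h4 : |v (x + e) ^ 2 + v (x + e) * v x + v x ^ 2| ≤ 3 / 2 * (v (x + e) ^ 2 + v x ^ 2) := by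
      rw [abs_le]
      constructor <;> nlinarith [sq_nonneg (v (x + e) - v x), sq_nonneg (v (x + e) + v x)]
    gcongr
    exact abs_apply_le U x
  have h5 : ∑ x, v x ^ 4 ≤ ‖U‖ * ∑ x, |w x| * (3 / 2 * (v (x + e) ^ 2 + v x ^ 2)) := by
    rw [h1, ← Finset.sum_neg_distrib, Finset.mul_sum]
    exact Finset.sum_le_sum fun x _ => h2 x
  set S := ∑ x, v x ^ 4 with hS
  have hS0 : 0 ≤ S := Finset.sum_nonneg fun x _ => by positivity
  have h6 : (∑ x, |w x| * (3 / 2 * (v (x + e) ^ 2 + v x ^ 2))) ^ 2 ≤ (∑ x, w x ^ 2) * (9 * S) := by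
    refine (Finset.sum_mul_sq_le_sq_mul_sq _ _ _).trans ?_
    simp_rw [sq_abs]
    gcongr
    calc _ ≤ ∑ x, (9 / 2 * v (x + e) ^ 4 + 9 / 2 * v x ^ 4) :=
          Finset.sum_le_sum fun x _ => by nlinarith [sq_nonneg (v (x + e) ^ 2 - v x ^ 2)]
      _ = _ := by
          rw [Finset.sum_add_distrib, sum_sh e fun x => 9 / 2 * v x ^ 4, ← Finset.mul_sum]
          ring
  have h7 : S * S ≤ (9 * ‖U‖ ^ 2 * ∑ x, w x ^ 2) * S := by
    calc S * S = S ^ 2 := by ring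
      _ ≤ (‖U‖ * ∑ x, |w x| * (3 / 2 * (v (x + e) ^ 2 + v x ^ 2))) ^ 2 := by gcongr
      _ ≤ ‖U‖ ^ 2 * ((∑ x, w x ^ 2) * (9 * S)) := by rw [mul_pow]; gcongr
      _ = _ := by ring
  -- Dividing by S requires S > 0; for S = 0 the claim is trivial.
  rcases hS0.eq_or_lt with h0 | h0
  · rw [← h0]; positivity
  · exact le_of_mul_le_mul_right h7 h0

lemma nrm_mul_sq_le {h : ℝ} (hh : 0 ≤ h) (A B : Grid d J) :
    (nrm h (A * B) ^ 2) ^ 2 ≤ (h ^ d * ∑ x, A x ^ 4) * (h ^ d * ∑ x, B x ^ 4) := by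
  rw [nrm_sq hh, inn, mul_pow]
  have := Finset.sum_mul_sq_le_sq_mul_sq Finset.univ (fun x => A x ^ 2) (fun x => B x ^ 2)
  simp only [Pi.mul_apply]
  calc _ = (h ^ d) ^ 2 * (∑ x, A x ^ 2 * B x ^ 2) ^ 2 := by
        congr 2; exact Finset.sum_congr rfl fun x _ => by ring
    _ ≤ (h ^ d) ^ 2 * ((∑ x, (A x ^ 2) ^ 2) * ∑ x, (B x ^ 2) ^ 2) := by gcongr
    _ = _ := by simp_rw [← pow_mul]; ring

lemma pow_four_Dm_le {h : ℝ} (hh : 0 ≤ h) (k : Fin d) (U : Grid d J) :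
    h ^ d * ∑ x, Dm h k U x ^ 4 ≤ (3 * ‖U‖ * nrm h (lap h U)) ^ 2 := by
  have h1 := sum_Dm_pow_four_le h k U
  have h2 := nrm_Dp_Dm_le hh k k U
  have h3 := nrm_nonneg h (Dp h k (Dm h k U))
  calc _ ≤ h ^ d * (9 * ‖U‖ ^ 2 * ∑ x, Dp h k (Dm h k U) x ^ 2) := by gcongr
    _ = 9 * ‖U‖ ^ 2 * nrm h (Dp h k (Dm h k U)) ^ 2 := by
        rw [nrm_sq hh, inn]; simp_rw [← pow_two]; ring
    _ ≤ 9 * ‖U‖ ^ 2 * nrm h (lap h U) ^ 2 := by gcongr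
    _ = _ := by ring

/-- Hölder with two fourth-power norms, the preceding interpolation inequality for each factor, and
the arithmetic–geometric mean. The translation is invisible to the periodic sum. -/
lemma nrm_Dm_mul_Dm_le {h : ℝ} (hh : 0 ≤ h) (i j : Fin d) (e : Fin d → ZMod J) (U V : Grid d J) :
    nrm h (sh e (Dm h i U) * Dm h j V)
      ≤ 3 / 2 * (‖U‖ * nrm h (lap h V) + ‖V‖ * nrm h (lap h U)) := by
  have h1 := nrm_mul_sq_le hh (sh e (Dm h i U)) (Dm h j V)
  have h2 : ∑ x, sh e (Dm h i U) x ^ 4 = ∑ x, Dm h i U x ^ 4 := sum_sh e fun x => Dm h i U x ^ 4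
  rw [h2] at h1
  have hU := nrm_nonneg h (lap h U)
  have hV := nrm_nonneg h (lap h V)
  have h3 : (nrm h (sh e (Dm h i U) * Dm h j V) ^ 2) ^ 2
      ≤ ((3 * ‖U‖ * nrm h (lap h U)) * (3 * ‖V‖ * nrm h (lap h V))) ^ 2 := by
    rw [mul_pow]
    refine h1.trans (mul_le_mul (pow_four_Dm_le hh i U) (pow_four_Dm_le hh j V) ?_ (by positivity))
    positivity
  have h4 := le_of_sq_le_sq h3 (by positivity)
  refine le_of_sq_le_sq (h4.trans ?_) (by positivity)
  nlinarith [sq_nonneg (‖U‖ * nrm h (lap h V) - ‖V‖ * nrm h (lap h U))]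

/-- Bounded grid functions with bounded discrete Laplacian form an algebra. -/
lemma nrm_Dm_Dm_mul_le {h : ℝ} (hh : 0 ≤ h) (i j : Fin d) (U V : Grid d J) :
    nrm h (Dm h i (Dm h j (U * V))) ≤ 4 * (‖U‖ * nrm h (lap h V) + ‖V‖ * nrm h (lap h U)) := by
  -- Discrete Leibniz rule: the two outer terms cost 1 together, and each of the two mixed
  -- first-difference terms costs 3/2, giving the constant 4.
  have hexp : Dm h i (Dm h j (U * V)) = Dm h i (Dm h j U) * V
      + sh (-unitVec d J i) (Dm h j U) * Dm h i V
      + (sh (-unitVec d J j) (Dm h i U) * Dm h j V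
      + sh (-unitVec d J i) (sh (-unitVec d J j) U) * Dm h i (Dm h j V)) := by
    rw [Dm_mul, map_add, Dm_mul, Dm_mul, Dm_sh]
  rw [hexp]
  refine (nrm_add_le hh _ _).trans ?_
  have h1 := nrm_add_le hh (Dm h i (Dm h j U) * V) (sh (-unitVec d J i) (Dm h j U) * Dm h i V)
  have h2 := nrm_add_le hh (sh (-unitVec d J j) (Dm h i U) * Dm h j V)
    (sh (-unitVec d J i) (sh (-unitVec d J j) U) * Dm h i (Dm h j V))
  have h3 := nrm_Dm_mul_Dm_le hh j i (-unitVec d J i) U V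
  have h4 := nrm_Dm_mul_Dm_le hh i j (-unitVec d J j) U V
  have h5 : nrm h (Dm h i (Dm h j U) * V) ≤ nrm h (lap h U) * ‖V‖ :=
    (nrm_mul_le' hh _ _).trans (by gcongr; exact nrm_Dm_Dm_le hh i j U)
  have h6 : nrm h (sh (-unitVec d J i) (sh (-unitVec d J j) U) * Dm h i (Dm h j V))
      ≤ ‖U‖ * nrm h (lap h V) := by
    refine (nrm_mul_le hh _ _).trans ?_
    gcongr
    · exact nrm_nonneg _ _
    · exact (norm_sh_le _ _).trans (norm_sh_le _ _)
    · exact nrm_Dm_Dm_le hh i j V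
  linarith

end Differences

/-! ### Functional calculus for Fourier multipliers and exponential time differencing -/

section Multipliers
variable {d J : ℕ} [NeZero J]

/-- `S` acts on Fourier coefficients as multiplication by the real symbol `m`. -/
def IsMult (S : Grid d J →L[ℝ] Grid d J) (m : (Fin d → ZMod J) → ℝ) : Prop :=
  ∀ k U, ft k (S U) = (m k : ℂ) * ft k U

lemma IsMult.one : IsMult (1 : Grid d J →L[ℝ] Grid d J) fun _ => 1 := fun k U => by simp

lemma IsMult.add {S T : Grid d J →L[ℝ] Grid d J} {m n : (Fin d → ZMod J) → ℝ}
    (hS : IsMult S m) (hT : IsMult T n) : IsMult (S + T) fun k => m k + n k := fun k U => by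
  simp [hS k U, hT k U, add_mul]

lemma IsMult.sub {S T : Grid d J →L[ℝ] Grid d J} {m n : (Fin d → ZMod J) → ℝ}
    (hS : IsMult S m) (hT : IsMult T n) : IsMult (S - T) fun k => m k - n k := fun k U => by
  simp [hS k U, hT k U, sub_mul]

lemma IsMult.mul {S T : Grid d J →L[ℝ] Grid d J} {m n : (Fin d → ZMod J) → ℝ}
    (hS : IsMult S m) (hT : IsMult T n) : IsMult (S * T) fun k => m k * n k := fun k U => by
  simp [hS k _, hT k U, mul_assoc]

lemma IsMult.smul {S : Grid d J →L[ℝ] Grid d J} {m : (Fin d → ZMod J) → ℝ}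
    (hS : IsMult S m) (r : ℝ) : IsMult (r • S) fun k => r * m k := fun k U => by
  simp [hS k U, mul_assoc]

lemma IsMult.neg {S : Grid d J →L[ℝ] Grid d J} {m : (Fin d → ZMod J) → ℝ}
    (hS : IsMult S m) : IsMult (-S) fun k => -m k := fun k U => by
  simp [hS k U]

lemma IsMult.pow {S : Grid d J →L[ℝ] Grid d J} {m : (Fin d → ZMod J) → ℝ}
    (hS : IsMult S m) (n : ℕ) : IsMult (S ^ n) fun k => m k ^ n := by
  induction n with
  | zero => simpa using IsMult.one
  | succ n ih => simpa only [pow_succ] using ih.mul hS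

/-- For fixed k and U, the map S ↦ `ft k (S U)` is a continuous linear functional of the operator,
so it can be applied termwise to the exponential series. -/
lemma IsMult.exp {S : Grid d J →L[ℝ] Grid d J} {m : (Fin d → ZMod J) → ℝ}
    (hS : IsMult S m) : IsMult (NormedSpace.exp S) fun k => Real.exp (m k) := by
  intro k U
  have h1 := NormedSpace.exp_series_hasSum_exp' (𝕂 := ℝ) S
  let ℓ : (Grid d J →L[ℝ] Grid d J) →L[ℝ] ℂ :=
    (LinearMap.toContinuousLinearMap (ft k)).comp (ContinuousLinearMap.apply ℝ (Grid d J) U)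
  have h2 := ℓ.hasSum h1
  have h3 := (NormedSpace.exp_series_hasSum_exp' (𝕂 := ℝ) (m k : ℂ)).mul_right (ft k U)
  have h4 : (fun n : ℕ => ℓ (((n.factorial : ℝ)⁻¹) • S ^ n))
      = fun n : ℕ => (((n.factorial : ℝ)⁻¹) • (m k : ℂ) ^ n) * ft k U := by
    ext n
    have := hS.pow n k U
    rw [map_smul]
    change (n.factorial : ℝ)⁻¹ • ft k ((S ^ n) U) = _
    rw [this]; push_cast; rw [smul_mul_assoc]
  have h5 : ℓ (NormedSpace.exp S) = ft k (NormedSpace.exp S U) := rfl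
  rw [h4, h5] at h2
  rw [h2.unique h3, Complex.ofReal_exp, Complex.exp_eq_exp_ℂ]

/-- A nonvanishing symbol makes the operator injective, since Fourier coefficients determine the
function; finite dimension supplies surjectivity. -/
lemma IsMult.isUnit {S : Grid d J →L[ℝ] Grid d J} {m : (Fin d → ZMod J) → ℝ}
    (hS : IsMult S m) (hm : ∀ k, m k ≠ 0) : IsUnit S := by
  rw [ContinuousLinearMap.isUnit_iff_bijective]
  have hinj : Function.Injective (S : Grid d J →ₗ[ℝ] Grid d J) := fun U V h => by
    apply ft_injective
    intro k
    have h1 := hS k U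
    have h2 := hS k V
    have h3 : S U = S V := h
    rw [h3, h2] at h1
    exact (mul_left_cancel₀ (by exact_mod_cast hm k) h1).symm
  exact ⟨hinj, LinearMap.injective_iff_surjective.1 hinj⟩

lemma IsMult.inverse {S : Grid d J →L[ℝ] Grid d J} {m : (Fin d → ZMod J) → ℝ}
    (hS : IsMult S m) (hm : ∀ k, m k ≠ 0) : IsMult (Ring.inverse S) fun k => (m k)⁻¹ := by
  intro k U
  have h1 : S * Ring.inverse S = 1 := Ring.mul_inverse_cancel _ (hS.isUnit hm)
  have h2 : S (Ring.inverse S U) = U := by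
    change (S * Ring.inverse S) U = U
    rw [h1]; rfl
  have h3 := hS k (Ring.inverse S U)
  rw [h2] at h3
  have : (m k : ℂ) ≠ 0 := by exact_mod_cast hm k
  rw [h3]; push_cast; field_simp

lemma IsMult.phi1 {S : Grid d J →L[ℝ] Grid d J} {m : (Fin d → ZMod J) → ℝ}
    (hS : IsMult S m) (hm : ∀ k, m k ≠ 0) :
    IsMult (phi1 S) fun k => (m k)⁻¹ * (Real.exp (m k) - 1) :=
  (hS.inverse hm).mul (hS.exp.sub IsMult.one)

lemma IsMult.calQ1 {S : Grid d J →L[ℝ] Grid d J} {m : (Fin d → ZMod J) → ℝ}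
    (hS : IsMult S m) (hm : ∀ k, m k ≠ 0) :
    IsMult (calQ1 S) fun k => m k * (Real.exp (m k) - 1)⁻¹ + 1 / 2 * m k := by
  refine (hS.mul ((hS.exp.sub IsMult.one).inverse fun k h => hm k ?_)).add (hS.smul _)
  have : Real.exp (m k) = 1 := by linarith
  exact Real.exp_eq_one_iff _ |>.1 this

lemma IsMult.nrm_le {S : Grid d J →L[ℝ] Grid d J} {m : (Fin d → ZMod J) → ℝ}
    (hS : IsMult S m) {h c : ℝ} (hh : 0 ≤ h) (hc : 0 ≤ c) (hm : ∀ k, |m k| ≤ c) (U : Grid d J) :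
    nrm h (S U) ≤ c * nrm h U := by
  refine le_of_sq_le_sq ?_ (mul_nonneg hc (nrm_nonneg _ _))
  have hw := fw_nonneg (d := d) (J := J) hh
  simp_rw [mul_pow, nrm_sq_ft hh, hS _ U, norm_mul, mul_pow, Complex.norm_real, Real.norm_eq_abs]
  rw [mul_left_comm (c ^ 2), Finset.mul_sum _ _ (c ^ 2)]
  refine mul_le_mul_of_nonneg_left (Finset.sum_le_sum fun k _ => ?_) hw
  gcongr
  exact hm k

/-! #### One mode of an exponential time differencing step -/

lemma one_sub_exp_neg_le (z : ℝ) : 1 - Real.exp (-z) ≤ z := by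
  linarith [Real.add_one_le_exp (-z)]

lemma mul_exp_neg_le (z : ℝ) : z * Real.exp (-z) ≤ 1 - Real.exp (-z) := by
  have h1 := Real.add_one_le_exp z
  have h2 := Real.exp_pos (-z)
  have h3 : Real.exp z * Real.exp (-z) = 1 := by rw [← Real.exp_add]; simp
  nlinarith

lemma norm_convex_sq_le {θ : ℝ} (h0 : 0 ≤ θ) (h1 : θ ≤ 1) (v w : ℂ) :
    ‖(θ : ℂ) * v + ((1 - θ : ℝ) : ℂ) * w‖ ^ 2 ≤ θ * ‖v‖ ^ 2 + (1 - θ) * ‖w‖ ^ 2 := by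
  have h2 : ‖(θ : ℂ) * v + ((1 - θ : ℝ) : ℂ) * w‖ ≤ θ * ‖v‖ + (1 - θ) * ‖w‖ := by
    refine (norm_add_le _ _).trans (le_of_eq ?_)
    rw [norm_mul, norm_mul, Complex.norm_real, Complex.norm_real, Real.norm_of_nonneg h0,
      Real.norm_of_nonneg (by linarith)]
  have h3 := pow_le_pow_left₀ (norm_nonneg _) h2 2
  refine h3.trans ?_
  nlinarith [mul_nonneg (mul_nonneg h0 (sub_nonneg.2 h1)) (sq_nonneg (‖v‖ - ‖w‖))]

/-- Maximal regularity of a single mode. -/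
lemma mode_regularity {τ Λ γ : ℝ} (hτ : 0 < τ) (hΛ : 0 ≤ Λ) (hγ : 0 < γ) (v N : ℂ) :
    (Λ + τ * Λ ^ 2) * ‖(Real.exp (-(τ * (Λ + γ))) : ℂ) * v
      + τ * (((-(τ * (Λ + γ)))⁻¹ * (Real.exp (-(τ * (Λ + γ))) - 1) : ℝ) : ℂ) * N‖ ^ 2
      ≤ Λ * ‖v‖ ^ 2 + 2 * τ * ‖N‖ ^ 2 := by
  set z := τ * (Λ + γ) with hz
  have hz0 : 0 < z := by positivity
  set θ := Real.exp (-z) with hθ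
  have hθ0 : 0 < θ := Real.exp_pos _
  have hθ1 : θ ≤ 1 := Real.exp_le_one_iff.2 (by linarith)
  have hzθ : z * θ ≤ 1 - θ := mul_exp_neg_le z
  have h1z : 1 - θ ≤ z := one_sub_exp_neg_le z
  have hΛz : τ * Λ ≤ z := by rw [hz]; nlinarith
  -- The exponential step is a convex combination of the old mode v and the stationary value (τ/z)N,
  -- with weight θ = exp(-z).
  have hform : (θ : ℂ) * v + τ * (((-z)⁻¹ * (θ - 1) : ℝ) : ℂ) * N
      = (θ : ℂ) * v + ((1 - θ : ℝ) : ℂ) * (((τ / z : ℝ) : ℂ) * N) := by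
    have : (z : ℂ) ≠ 0 := by exact_mod_cast hz0.ne'
    push_cast; field_simp; ring
  rw [hform]
  have hb := norm_convex_sq_le hθ0.le hθ1 v (((τ / z : ℝ) : ℂ) * N)
  rw [norm_mul, Complex.norm_real, Real.norm_of_nonneg (by positivity : 0 ≤ τ / z), mul_pow] at hb
  set b := ‖(θ : ℂ) * v + ((1 - θ : ℝ) : ℂ) * (((τ / z : ℝ) : ℂ) * N)‖ ^ 2
  set a := ‖v‖ ^ 2
  set n := ‖N‖ ^ 2 with hn
  have ha0 : 0 ≤ a := sq_nonneg _
  have hn0 : 0 ≤ n := sq_nonneg _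
  have hr : 0 ≤ τ / z := by positivity
  have hrΛ : τ / z * Λ ≤ 1 := by rw [div_mul_eq_mul_div, div_le_one hz0]; exact hΛz
  have hrz : τ / z * z = τ := by field_simp
  set r := τ / z
  -- The forcing is estimated twice: 1 - θ ≤ z for the weight Λ and 1 - θ ≤ 1 for the weight τΛ².
  -- Each contributes τ‖N‖², hence the factor 2.
  have e1 : Λ * ((1 - θ) * (r ^ 2 * n)) ≤ τ * n := by
    calc Λ * ((1 - θ) * (r ^ 2 * n)) ≤ Λ * (z * (r ^ 2 * n)) := by gcongr
      _ = (r * Λ) * (τ * n) := by rw [← hrz]; ring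
      _ ≤ 1 * (τ * n) := by gcongr
      _ = _ := one_mul _
  have e2 : τ * Λ ^ 2 * ((1 - θ) * (r ^ 2 * n)) ≤ τ * n := by
    have : 1 - θ ≤ 1 := by linarith
    calc τ * Λ ^ 2 * ((1 - θ) * (r ^ 2 * n)) ≤ τ * Λ ^ 2 * (1 * (r ^ 2 * n)) := by gcongr
      _ = (r * Λ) ^ 2 * (τ * n) := by ring
      _ ≤ 1 ^ 2 * (τ * n) := by gcongr
      _ = _ := by ring
  -- The extra regularity of the homogeneous part is paid for by its decay, because z·exp(-z) ≤ 1 -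
  -- exp(-z).
  have e3 : τ * Λ ^ 2 * (θ * a) ≤ Λ * (1 - θ) * a := by
    calc τ * Λ ^ 2 * (θ * a) = Λ * (τ * Λ * θ) * a := by ring
      _ ≤ Λ * (z * θ) * a := by gcongr
      _ ≤ _ := by gcongr
  calc (Λ + τ * Λ ^ 2) * b ≤ (Λ + τ * Λ ^ 2) * (θ * a + (1 - θ) * (r ^ 2 * n)) := by gcongr
    _ ≤ _ := by nlinarith

/-! #### Exponential time differencing with a positive multiplier -/

/-- One exponential time differencing step. -/
def etd (X : Grid d J →L[ℝ] Grid d J) (τ : ℝ) (U N : Grid d J) : Grid d J :=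
  NormedSpace.exp (-(τ • X)) U + τ • phi1 (-(τ • X)) N

/-- Quadratic form with Fourier symbol `w`. -/
def quad (h : ℝ) (w : (Fin d → ZMod J) → ℝ) (U : Grid d J) : ℝ :=
  fw d J h * ∑ k, w k * ‖ft k U‖ ^ 2

lemma quad_nonneg {h : ℝ} (hh : 0 ≤ h) {w : (Fin d → ZMod J) → ℝ} (hw : ∀ k, 0 ≤ w k)
    (U : Grid d J) : 0 ≤ quad h w U :=
  mul_nonneg (fw_nonneg hh) (Finset.sum_nonneg fun k _ => mul_nonneg (hw k) (sq_nonneg _))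

variable {X : Grid d J →L[ℝ] Grid d J} {Λ : (Fin d → ZMod J) → ℝ} {γ τ h : ℝ}

lemma ft_etd (hX : IsMult X fun k => Λ k + γ) (hΛ : ∀ k, 0 ≤ Λ k) (hγ : 0 < γ) (hτ : 0 < τ)
    (U N : Grid d J) (k : Fin d → ZMod J) :
    ft k (etd X τ U N) = (Real.exp (-(τ * (Λ k + γ))) : ℂ) * ft k U
      + τ * (((-(τ * (Λ k + γ)))⁻¹ * (Real.exp (-(τ * (Λ k + γ))) - 1) : ℝ) : ℂ) * ft k N := by
  have hm := (hX.smul τ).neg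
  have hm0 : ∀ k, -(τ * (Λ k + γ)) ≠ 0 := fun k => by
    have := hΛ k
    have : 0 < τ * (Λ k + γ) := by positivity
    linarith
  rw [etd, map_add, map_smul, hm.exp k U, hm.phi1 hm0 k N, Complex.real_smul, mul_assoc]

lemma nrm_etd_le (hX : IsMult X fun k => Λ k + γ) (hΛ : ∀ k, 0 ≤ Λ k) (hγ : 0 < γ) (hτ : 0 < τ)
    (hh : 0 ≤ h) (U N : Grid d J) : nrm h (etd X τ U N) ≤ nrm h U + τ * nrm h N := by
  have hm := (hX.smul τ).neg
  have hz : ∀ k, 0 < τ * (Λ k + γ) := fun k => by have := hΛ k; positivity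
  have hm0 : ∀ k, -(τ * (Λ k + γ)) ≠ 0 := fun k => by linarith [hz k]
  refine (nrm_add_le hh _ _).trans ?_
  rw [nrm_smul hh, abs_of_pos hτ]
  have h1 := hm.exp.nrm_le hh zero_le_one (fun k => by
    rw [abs_of_pos (Real.exp_pos _)]
    exact Real.exp_le_one_iff.2 (by linarith [hz k])) U
  have h2 := (hm.phi1 hm0).nrm_le hh zero_le_one (fun k => by
    have h3 := one_sub_exp_neg_le (τ * (Λ k + γ))
    have h4 : Real.exp (-(τ * (Λ k + γ))) ≤ 1 := Real.exp_le_one_iff.2 (by linarith [hz k])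
    have h5 : (-(τ * (Λ k + γ)))⁻¹ * (Real.exp (-(τ * (Λ k + γ))) - 1)
        = (1 - Real.exp (-(τ * (Λ k + γ)))) / (τ * (Λ k + γ)) := by
      have := hz k
      rw [inv_neg]; field_simp; ring
    rw [h5, abs_of_nonneg (div_nonneg (by linarith) (hz k).le), div_le_one (hz k)]
    exact h3) N
  rw [one_mul] at h1 h2
  gcongr

/-- Weighted sum of `mode_regularity` over frequencies; the free weight w sets the order of the
estimate. Positivity of γ is enough and its size never enters, which matters because γ is a multiple
of `gfac` and may be arbitrarily small. -/
lemma quad_etd_le (hX : IsMult X fun k => Λ k + γ) (hΛ : ∀ k, 0 ≤ Λ k) (hγ : 0 < γ) (hτ : 0 < τ)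
    (hh : 0 ≤ h) {w : (Fin d → ZMod J) → ℝ} (hw : ∀ k, 0 ≤ w k) (U N : Grid d J) :
    quad h (fun k => w k * Λ k) (etd X τ U N) + τ * quad h (fun k => w k * Λ k ^ 2) (etd X τ U N)
      ≤ quad h (fun k => w k * Λ k) U + 2 * τ * quad h w N := by
  have hf := fw_nonneg (d := d) (J := J) hh
  have key : ∑ k, w k * Λ k * ‖ft k (etd X τ U N)‖ ^ 2
      + τ * ∑ k, w k * Λ k ^ 2 * ‖ft k (etd X τ U N)‖ ^ 2
      ≤ ∑ k, w k * Λ k * ‖ft k U‖ ^ 2 + 2 * τ * ∑ k, w k * ‖ft k N‖ ^ 2 := by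
    rw [Finset.mul_sum, Finset.mul_sum, ← Finset.sum_add_distrib, ← Finset.sum_add_distrib]
    refine Finset.sum_le_sum fun k _ => ?_
    have := mul_le_mul_of_nonneg_left
      (mode_regularity hτ (hΛ k) hγ (ft k U) (ft k N)) (hw k)
    rw [← ft_etd hX hΛ hγ hτ] at this
    linarith
  have := mul_le_mul_of_nonneg_left key hf
  unfold quad
  linarith

lemma inn_calQ1 (hX : IsMult X fun k => Λ k + γ) (hΛ : ∀ k, 0 ≤ Λ k) (hγ : 0 < γ) (hτ : 0 < τ)
    (V : Grid d J) :
    inn h (calQ1 (τ • X) V) V = quad h (fun k => τ * (Λ k + γ) *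
      (Real.exp (τ * (Λ k + γ)) - 1)⁻¹ + 1 / 2 * (τ * (Λ k + γ))) V := by
  have hm0 : ∀ k, τ * (Λ k + γ) ≠ 0 := fun k => by have := hΛ k; positivity
  rw [inn_eq_ft, quad]
  congr 1
  refine Finset.sum_congr rfl fun k _ => ?_
  rw [(hX.smul τ).calQ1 hm0 k V, mul_assoc, Complex.mul_conj, Complex.normSq_eq_norm_sq,
    ← Complex.ofReal_mul, Complex.ofReal_re]

lemma inn_calQ1_nonneg (hX : IsMult X fun k => Λ k + γ) (hΛ : ∀ k, 0 ≤ Λ k) (hγ : 0 < γ)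
    (hτ : 0 < τ) (hh : 0 ≤ h) (V : Grid d J) : 0 ≤ inn h (calQ1 (τ • X) V) V := by
  rw [inn_calQ1 hX hΛ hγ hτ]
  refine quad_nonneg hh (fun k => ?_) V
  have hz : 0 < τ * (Λ k + γ) := by have := hΛ k; positivity
  have h1 := Real.add_one_le_exp (τ * (Λ k + γ))
  have : 0 ≤ (Real.exp (τ * (Λ k + γ)) - 1)⁻¹ := inv_nonneg.2 (by linarith)
  positivity

/-- The discrete energy identity of one exponential time differencing step. -/
lemma inn_etd_sub (hX : IsMult X fun k => Λ k + γ) (hΛ : ∀ k, 0 ≤ Λ k) (hγ : 0 < γ) (hτ : 0 < τ)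
    (hh : 0 ≤ h) (U G : Grid d J) {U' : Grid d J} (hU' : U' = etd X τ U (-G + γ • U)) :
    inn h G (U' - U) = -(1 / 2) * (quad h Λ U' - quad h Λ U)
      - 1 / τ * inn h (calQ1 (τ • X) (U' - U)) (U' - U) - γ / 2 * nrm h (U' - U) ^ 2 := by
  rw [inn_calQ1 hX hΛ hγ hτ, nrm_sq_ft hh, inn_eq_ft]
  unfold quad
  have key : ∑ k, (ft k G * conj (ft k (U' - U))).re
      = -(1 / 2) * (∑ k, Λ k * ‖ft k U'‖ ^ 2 - ∑ k, Λ k * ‖ft k U‖ ^ 2)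
        - 1 / τ * ∑ k, (τ * (Λ k + γ) * (Real.exp (τ * (Λ k + γ)) - 1)⁻¹
          + 1 / 2 * (τ * (Λ k + γ))) * ‖ft k (U' - U)‖ ^ 2
        - γ / 2 * ∑ k, ‖ft k (U' - U)‖ ^ 2 := by
    rw [← Finset.sum_sub_distrib, Finset.mul_sum, Finset.mul_sum, Finset.mul_sum,
      ← Finset.sum_sub_distrib, ← Finset.sum_sub_distrib]
    refine Finset.sum_congr rfl fun k _ => ?_
    have h1 := ft_etd hX hΛ hγ hτ U (-G + γ • U) k
    rw [← hU', map_add, map_neg, map_smul, Complex.real_smul] at h1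
    have hz : 0 < τ * (Λ k + γ) := by have := hΛ k; positivity
    have hΛγ : 0 < Λ k + γ := by have := hΛ k; positivity
    set z := τ * (Λ k + γ) with hzdef
    have hE : 0 < Real.exp z - 1 := by linarith [Real.add_one_le_exp z]
    have hE2 : Real.exp (-z) = (Real.exp z)⁻¹ := Real.exp_neg z
    have hEp := Real.exp_pos z
    set ε := Real.exp z with hε
    set v := ft k U
    set v' := ft k U'
    set g := ft k G
    have hzc : (z : ℂ) ≠ 0 := by exact_mod_cast hz.ne'
    have hec : (ε : ℂ) ≠ 0 := by exact_mod_cast hEp.ne'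
    have he1c : (ε : ℂ) - 1 ≠ 0 := by exact_mod_cast hE.ne'
    have hτc : (τ : ℂ) ≠ 0 := by exact_mod_cast hτ.ne'
    have hzc' : (z : ℂ) = τ * (Λ k + γ) := by rw [hzdef]; push_cast; ring
    rw [hE2] at h1
    -- The step is solved for the force in terms of the old mode and the increment.
    have hG : g = -(Λ k : ℂ) * v
        - ((1 / τ * (z * (ε - 1)⁻¹ + z) : ℝ) : ℂ) * (v' - v) := by
      have h2 : v' - v = (((ε - 1) / ε : ℝ) : ℂ) * (((τ / z : ℝ) : ℂ) * (-g - Λ k * v)) := by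
        rw [h1]; push_cast
        field_simp
        rw [hzc']; ring
      rw [h2]; push_cast
      field_simp
      ring
    rw [hG, map_sub]
    have h3 : ‖v'‖ ^ 2 = ‖v‖ ^ 2 + 2 * (v * conj (v' - v)).re + ‖v' - v‖ ^ 2 := by
      simp only [← Complex.normSq_eq_norm_sq, Complex.normSq_apply, Complex.mul_re, Complex.sub_re,
        Complex.sub_im, Complex.conj_re, Complex.conj_im]
      ring
    have h4 : ((-(Λ k : ℂ) * v - ((1 / τ * (z * (ε - 1)⁻¹ + z) : ℝ) : ℂ) * (v' - v))
        * conj (v' - v)).re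
        = -Λ k * (v * conj (v' - v)).re - (1 / τ * (z * (ε - 1)⁻¹ + z)) * ‖v' - v‖ ^ 2 := by
      rw [sub_mul, mul_assoc, mul_assoc, Complex.mul_conj, Complex.normSq_eq_norm_sq,
        Complex.sub_re, ← Complex.ofReal_mul, Complex.ofReal_re, ← Complex.ofReal_neg,
        Complex.re_ofReal_mul]
    rw [h4, h3]
    -- Since z/(e^z - 1) + z is the symbol of `calQ1` plus z/2, the leftover is (Λ + γ)/2 times the
    -- squared increment. Its Λ part cancels against the polarisation of Λ‖·‖², and only γ/2
    -- survives.
    have h5 : 1 / τ * z = Λ k + γ := by rw [hzdef]; field_simp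
    linear_combination (-(1 / 2) * ‖v' - v‖ ^ 2) * h5
  rw [key]; ring

end Multipliers

/-! ### Coercivity of the discrete energy and boundedness of the scalar factor -/

section Energy
variable {d J : ℕ} [NeZero J] {p : Params}

lemma mesh_pos (hL : 0 < p.L) : 0 < mesh p J :=
  div_pos hL (by exact_mod_cast NeZero.pos J)

lemma mesh_mul : mesh p J * J = p.L := by
  have : (J : ℝ) ≠ 0 := by exact_mod_cast NeZero.ne J
  rw [mesh]; field_simp

lemma mesh_pow_sum_const (r : ℝ) : mesh p J ^ d * ∑ _x : Fin d → ZMod J, r = p.L ^ d * r := by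
  rw [Finset.sum_const, Finset.card_univ, Fintype.card_fun, Fintype.card_fin, ZMod.card,
    nsmul_eq_mul, ← mul_assoc, ← mesh_mul (p := p) (J := J), mul_pow]
  push_cast; rfl

/-- Squared Frobenius norm. -/
def fro (X : Matrix (Fin d) (Fin d) ℝ) : ℝ := ∑ i, ∑ j, X i j ^ 2

lemma fro_nonneg (X : Matrix (Fin d) (Fin d) ℝ) : 0 ≤ fro X :=
  Finset.sum_nonneg fun _ _ => Finset.sum_nonneg fun _ _ => sq_nonneg _

lemma sq_le_fro (X : Matrix (Fin d) (Fin d) ℝ) (i j : Fin d) : X i j ^ 2 ≤ fro X := by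
  refine le_trans ?_ (Finset.single_le_sum (f := fun i => ∑ j, X i j ^ 2)
    (fun _ _ => Finset.sum_nonneg fun _ _ => sq_nonneg _) (Finset.mem_univ i))
  exact Finset.single_le_sum (f := fun j => X i j ^ 2) (fun _ _ => sq_nonneg _) (Finset.mem_univ j)

lemma abs_trace_mul_le (X Z : Matrix (Fin d) (Fin d) ℝ) :
    |(X * Z).trace| ≤ √(fro X) * √(fro Z) := by
  have h1 : (X * Z).trace = ∑ q : Fin d × Fin d, X q.1 q.2 * Z q.2 q.1 := by
    rw [Fintype.sum_prod_type]; simp [Matrix.trace, Matrix.mul_apply]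
  have h2 : fro X = ∑ q : Fin d × Fin d, X q.1 q.2 ^ 2 := by
    rw [Fintype.sum_prod_type]; rfl
  have h3 : fro Z = ∑ q : Fin d × Fin d, Z q.2 q.1 ^ 2 := by
    rw [Fintype.sum_prod_type, Finset.sum_comm]; rfl
  rw [← Real.sqrt_mul (fro_nonneg X)]
  apply Real.abs_le_sqrt
  rw [h1, h2, h3]
  exact Finset.sum_mul_sq_le_sq_mul_sq _ _ _

lemma fro_mul_le (X Z : Matrix (Fin d) (Fin d) ℝ) : fro (X * Z) ≤ fro X * fro Z := by
  have h3 : fro Z = ∑ j, ∑ k, Z k j ^ 2 := by rw [Finset.sum_comm]; rfl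
  rw [h3]
  unfold fro
  rw [Finset.sum_mul_sum]
  gcongr with i _ j _
  rw [Matrix.mul_apply]
  exact Finset.sum_mul_sq_le_sq_mul_sq _ _ _

lemma trace_sq_of_isSymm {X : Matrix (Fin d) (Fin d) ℝ} (hX : X.IsSymm) :
    (X ^ 2).trace = fro X := by
  rw [pow_two, Matrix.trace, fro]
  refine Finset.sum_congr rfl fun i _ => ?_
  rw [Matrix.diag_apply, Matrix.mul_apply]
  refine Finset.sum_congr rfl fun j _ => ?_
  rw [hX.apply i j, pow_two]

lemma abs_trace_cube_le (X : Matrix (Fin d) (Fin d) ℝ) :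
    |(X ^ 3).trace| ≤ √(fro X) ^ 3 := by
  rw [pow_succ]
  refine (abs_trace_mul_le _ _).trans ?_
  have h1 : √(fro (X ^ 2)) ≤ √(fro X) ^ 2 := by
    rw [Real.sq_sqrt (fro_nonneg X), pow_two]
    refine Real.sqrt_le_iff.2 ⟨fro_nonneg X, ?_⟩
    rw [pow_two]; exact fro_mul_le X X
  calc _ ≤ √(fro X) ^ 2 * √(fro X) := by gcongr
    _ = _ := by ring

/-- Half of c·y⁴ completes a square with the cubic term; the other half completes one with the
quadratic coefficient e that remains. -/
lemma quartic_lower (a b : ℝ) {c : ℝ} (hc : 0 < c) :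
    ∃ C : ℝ, 0 ≤ C ∧ ∀ y : ℝ, -(c * y ^ 4) - C ≤ a * y ^ 2 + b * y ^ 3 := by
  set e := a - b ^ 2 / (2 * c) with he
  refine ⟨e ^ 2 / (2 * c), by positivity, fun y => ?_⟩
  have h1 : 0 ≤ (c * y ^ 2 + b * y) ^ 2 / (2 * c) := by positivity
  have h2 : 0 ≤ (c * y ^ 2 + e) ^ 2 / (2 * c) := by positivity
  have h3 : (c * y ^ 2 + b * y) ^ 2 / (2 * c) + (c * y ^ 2 + e) ^ 2 / (2 * c)
      = c * y ^ 4 + b * y ^ 3 + (b ^ 2 / (2 * c) + e) * y ^ 2 + e ^ 2 / (2 * c) := by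
    field_simp; ring
  rw [he] at h3 ⊢
  linarith

lemma fs_lower (p : Params) (hc : 0 < p.c) :
    ∃ C : ℝ, 0 ≤ C ∧ ∀ y : ℝ, p.c / 8 * y ^ 4 - C ≤ fs p y := by
  obtain ⟨C, hC, H⟩ := quartic_lower (p.a / 2) (p.b / 3) (c := p.c / 8) (by positivity)
  refine ⟨C, hC, fun y => ?_⟩
  have := H y
  rw [fs]; linarith

/-- Symmetry turns tr X² into the squared Frobenius norm, and |tr X³| is at most its 3/2 power. This
reduces the density to a scalar quartic; taking -|B|/3 covers either sign of the cubic term and its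
absence. -/
lemma fbn_lower (p : Params) (hC : 0 < p.C) :
    ∃ C : ℝ, 0 ≤ C ∧ ∀ (d : ℕ) (X : Matrix (Fin d) (Fin d) ℝ), X.IsSymm →
      p.C / 8 * fro X ^ 2 - C ≤ fbn p X := by
  obtain ⟨C, hC0, H⟩ := quartic_lower (p.A / 2) (-(|p.B| / 3)) (c := p.C / 8) (by positivity)
  refine ⟨C, hC0, fun d X hX => ?_⟩
  have h1 := H √(fro X)
  have h2 : √(fro X) ^ 2 = fro X := Real.sq_sqrt (fro_nonneg X)
  have h4 : √(fro X) ^ 4 = fro X ^ 2 := by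
    calc √(fro X) ^ 4 = (√(fro X) ^ 2) ^ 2 := by ring
      _ = _ := by rw [h2]
  have h3 := abs_trace_cube_le X
  rw [h2, h4] at h1
  have h5 : (if d = 3 then p.B / 3 * (X ^ 3).trace else 0) ≤ |p.B| / 3 * √(fro X) ^ 3 := by
    have h6 : |p.B / 3 * (X ^ 3).trace| ≤ |p.B| / 3 * √(fro X) ^ 3 := by
      rw [abs_mul, abs_div, abs_of_pos (three_pos : (0 : ℝ) < 3)]; gcongr
    split_ifs
    · exact (le_abs_self _).trans h6
    · positivity
  rw [fbn, trace_sq_of_isSymm hX]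
  linarith

/-- Sum over components of the squared discrete gradients. -/
def tGrad2 (h : ℝ) (Q : TGrid d J) : ℝ := ∑ i, ∑ j, gradNrm h (comp Q i j) ^ 2

/-- Sum over components of the squared discrete Laplacians. -/
def tLap2 (h : ℝ) (Q : TGrid d J) : ℝ := ∑ i, ∑ j, nrm h (lap h (comp Q i j)) ^ 2

lemma tGrad2_nonneg (h : ℝ) (Q : TGrid d J) : 0 ≤ tGrad2 h Q :=
  Finset.sum_nonneg fun _ _ => Finset.sum_nonneg fun _ _ => sq_nonneg _

lemma tLap2_nonneg (h : ℝ) (Q : TGrid d J) : 0 ≤ tLap2 h Q :=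
  Finset.sum_nonneg fun _ _ => Finset.sum_nonneg fun _ _ => sq_nonneg _

/-- Discrete fourth power integral of a tensor field. -/
def tFour (h : ℝ) (Q : TGrid d J) : ℝ := h ^ d * ∑ x, fro (Q x) ^ 2

/-- Discrete fourth power integral of a scalar field. -/
def four (h : ℝ) (u : Grid d J) : ℝ := h ^ d * ∑ x, u x ^ 4

lemma tFour_nonneg {h : ℝ} (hh : 0 ≤ h) (Q : TGrid d J) : 0 ≤ tFour h Q :=
  mul_nonneg (by positivity) (Finset.sum_nonneg fun _ _ => sq_nonneg _)

lemma four_nonneg {h : ℝ} (hh : 0 ≤ h) (u : Grid d J) : 0 ≤ four h u :=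
  mul_nonneg (by positivity) (Finset.sum_nonneg fun _ _ => by positivity)

/-- The quantity controlled by the discrete energy. -/
def ctrl (h : ℝ) (Q : TGrid d J) (u : Grid d J) : ℝ :=
  1 + tGrad2 h Q + nrm h (lap h u) ^ 2 + tFour h Q + four h u

/-- The summand 1 in `ctrl` is there so that lower powers of it may always be replaced by higher
ones. -/
lemma one_le_ctrl {h : ℝ} (hh : 0 ≤ h) (Q : TGrid d J) (u : Grid d J) : 1 ≤ ctrl h Q u := by
  have := tGrad2_nonneg h Q
  have := tFour_nonneg hh Q
  have := four_nonneg hh u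
  unfold ctrl; nlinarith [sq_nonneg (nrm h (lap h u))]

lemma tNrm_sq (h : ℝ) (Φ : TGrid d J) : tNrm h Φ ^ 2 = ∑ i, ∑ j, nrm h (comp Φ i j) ^ 2 :=
  Real.sq_sqrt (Finset.sum_nonneg fun _ _ => Finset.sum_nonneg fun _ _ => sq_nonneg _)

lemma tNrm_nonneg (h : ℝ) (Φ : TGrid d J) : 0 ≤ tNrm h Φ := Real.sqrt_nonneg _

lemma tNrm_sq_eq {h : ℝ} (hh : 0 ≤ h) (Φ : TGrid d J) :
    tNrm h Φ ^ 2 = h ^ d * ∑ x, fro (Φ x) := by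
  rw [tNrm_sq]
  simp_rw [nrm_sq hh, inn, ← Finset.mul_sum, fro, comp]
  congr 1
  rw [Finset.sum_comm' (s := Finset.univ) (t := fun _ => Finset.univ) (t' := Finset.univ)
    (s' := fun _ => Finset.univ) (by simp)]
  simp_rw [Finset.sum_comm (s := (Finset.univ : Finset (Fin d)))
          (t := (Finset.univ : Finset (Fin d → ZMod J))), ← pow_two]
  exact Finset.sum_congr rfl fun x _ => Finset.sum_comm

lemma abs_tInn_le {h : ℝ} (hh : 0 ≤ h) (Φ Ψ : TGrid d J) :
    |tInn h Φ Ψ| ≤ tNrm h Φ * tNrm h Ψ := by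
  rw [tNrm, tNrm, ← Real.sqrt_mul (by positivity)]
  apply Real.abs_le_sqrt
  simp_rw [tInn, ← Fintype.sum_prod_type']
  calc (∑ q : Fin d × Fin d, inn h (comp Φ q.1 q.2) (comp Ψ q.1 q.2)) ^ 2
      ≤ (∑ q : Fin d × Fin d, nrm h (comp Φ q.1 q.2) * nrm h (comp Ψ q.1 q.2)) ^ 2 := by
        rw [← sq_abs]
        refine pow_le_pow_left₀ (abs_nonneg _) ?_ 2
        exact (Finset.abs_sum_le_sum_abs _ _).trans
          (Finset.sum_le_sum fun q _ => abs_inn_le hh _ _)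
    _ ≤ _ := Finset.sum_mul_sq_le_sq_mul_sq _ _ _

lemma fro_Mten_le (p : Params) (Q : TGrid d J) (x : Fin d → ZMod J) :
    fro (Mten p Q x) ≤ 2 * (1 / sPlus p d) ^ 2 * fro (Q x) + 2 := by
  set r := 1 / sPlus p d with hr
  have h1 : ∀ i j, Mten p Q x i j ^ 2
      ≤ 2 * r ^ 2 * Q x i j ^ 2 + 2 * (if i = j then (1 / (d : ℝ)) ^ 2 else 0) := by
    intro i j
    simp only [Mten, Matrix.add_apply, Matrix.smul_apply, smul_eq_mul, Matrix.one_apply, ← hr]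
    split_ifs
    · nlinarith [sq_nonneg (r * Q x i j - 1 / (d : ℝ))]
    · nlinarith [sq_nonneg (r * Q x i j)]
  have h2 : fro (Mten p Q x) ≤ ∑ i : Fin d, ∑ j : Fin d,
      (2 * r ^ 2 * Q x i j ^ 2 + 2 * (if i = j then (1 / (d : ℝ)) ^ 2 else 0)) :=
    Finset.sum_le_sum fun i _ => Finset.sum_le_sum fun j _ => h1 i j
  refine h2.trans ?_
  simp_rw [Finset.sum_add_distrib, ← Finset.mul_sum]
  have h3 : ∑ i : Fin d, ∑ j : Fin d, (if i = j then (1 / (d : ℝ)) ^ 2 else 0) ≤ 1 := by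
    simp only [Finset.sum_ite_eq, Finset.mem_univ, if_true, Finset.sum_const, Finset.card_univ,
      Fintype.card_fin, nsmul_eq_mul]
    rcases Nat.eq_zero_or_pos d with h0 | h0
    · subst h0; simp
    · have : (1 : ℝ) ≤ d := by exact_mod_cast h0
      have h4 : (d : ℝ) * (1 / d) ^ 2 = 1 / d := by field_simp
      rw [h4, div_le_one (by linarith)]; exact this
  have : fro (Q x) = ∑ i, ∑ j, Q x i j ^ 2 := rfl
  rw [this]; linarith

lemma tNrm_Mu_sq_le (hL : 0 < p.L) (Q : TGrid d J) (u : Grid d J) :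
    tNrm (mesh p J) (Mu p Q u) ^ 2 ≤ ((1 / sPlus p d) ^ 2 + 1) *
      (tFour (mesh p J) Q + four (mesh p J) u + p.L ^ d) := by
  have hm := (mesh_pos (J := J) hL).le
  rw [tNrm_sq_eq hm]
  set r := 1 / sPlus p d with hr
  have h1 : ∀ x, fro (Mu p Q u x) ≤ (r ^ 2 + 1) * (fro (Q x) ^ 2 + u x ^ 4 + 1) := by
    intro x
    have h2 : fro (Mu p Q u x) = u x ^ 2 * fro (Mten p Q x) := by
      simp only [fro, Mu, Matrix.smul_apply, smul_eq_mul, mul_pow, Finset.mul_sum]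
    have h3 := fro_Mten_le p Q x
    rw [← hr] at h3
    rw [h2]
    have h4 := mul_le_mul_of_nonneg_left h3 (sq_nonneg (u x))
    have h5 : 0 ≤ r ^ 2 * (fro (Q x) - u x ^ 2) ^ 2 := by positivity
    nlinarith [sq_nonneg (u x ^ 2 - 1), sq_nonneg r, sq_nonneg (fro (Q x))]
  calc _ ≤ mesh p J ^ d * ∑ x, (r ^ 2 + 1) * (fro (Q x) ^ 2 + u x ^ 4 + 1) := by
        gcongr with x; exact h1 x
    _ = _ := by
        rw [← Finset.mul_sum, Finset.sum_add_distrib, Finset.sum_add_distrib, tFour, four,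
          ← mul_one (p.L ^ d), ← mesh_pow_sum_const (p := p) (J := J) 1]
        ring

/-- The total discrete energy controls `ctrl`. -/
lemma exists_coercive (d : ℕ) (p : Params) (hp : p.Admissible d) :
    ∃ c C : ℝ, 0 < c ∧ ∀ (J : ℕ) [NeZero J] (Q : TGrid d J) (u : Grid d J),
      (∀ x, (Q x).IsSymm) →
      c * ctrl (mesh p J) Q u - C ≤ p.K / 2 * tGrad2 (mesh p J) Q
        + p.B₀ * nrm (mesh p J) (lap (mesh p J) u) ^ 2 + E1 p Q u := by
  obtain ⟨C1, hC1, H1⟩ := fbn_lower p hp.C_pos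
  obtain ⟨C2, hC2, H2⟩ := fs_lower p hp.c_pos
  have hL := hp.L_pos
  have hB := hp.B₀_pos
  set a := (1 / sPlus p d) ^ 2 + 1 with ha
  have ha0 : 0 < a := by positivity
  set m := min p.C p.c with hm
  have hm0 : 0 < m := lt_min hp.C_pos hp.c_pos
  -- θ is the fraction of the completed square that is kept. It is small enough that the cost
  -- 2θB₀q⁴M² stays within m/16 of the quartic terms.
  set θ := min (1 / 2) (m / (32 * p.B₀ * (p.q ^ 4 + 1) * a)) with hθ
  have hq4 : 0 ≤ p.q ^ 4 := by positivity
  have hθ0 : 0 < θ := lt_min (by norm_num) (by positivity)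
  have hθ1 : θ ≤ 1 / 2 := min_le_left _ _
  have hθ2 : 2 * θ * p.B₀ * p.q ^ 4 * a ≤ m / 16 := by
    have h1 : θ ≤ m / (32 * p.B₀ * (p.q ^ 4 + 1) * a) := min_le_right _ _
    rw [le_div_iff₀ (by positivity)] at h1
    have : 0 ≤ θ * p.B₀ * a := by positivity
    linarith
  set c := min (p.K / 2) (min (θ * p.B₀) (m / 16)) with hc
  have hK := hp.K_pos
  have hc0 : 0 < c := lt_min (by positivity) (lt_min (by positivity) (by positivity))
  have hcK : c ≤ p.K / 2 := min_le_left _ _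
  have hcθ : c ≤ θ * p.B₀ := (min_le_right _ _).trans (min_le_left _ _)
  have hcm : c ≤ m / 16 := (min_le_right _ _).trans (min_le_right _ _)
  refine ⟨c, c + (C1 + C2 + m / 16) * p.L ^ d, hc0, fun J _ Q u hQ => ?_⟩
  have hh := (mesh_pos (J := J) hL).le
  have hM := tNrm_Mu_sq_le (J := J) hL Q u
  have hT := abs_tInn_le hh (hess (mesh p J) u) (Mu p Q u)
  -- The constant one here makes the cross term at least -2B₀q²wM, which completes B₀w² and B₀q⁴M²
  -- to B₀(w - q²M)².
  have hH : tNrm (mesh p J) (hess (mesh p J) u) ≤ nrm (mesh p J) (lap (mesh p J) u) := by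
    refine le_of_sq_le_sq ?_ (nrm_nonneg _ _)
    rw [tNrm_sq]; exact sum_nrm_hess_le hh u
  have hb : p.C / 8 * tFour (mesh p J) Q - C1 * p.L ^ d
      ≤ inn (mesh p J) (fun x => fbn p (Q x)) 1 := by
    rw [inn, tFour, mul_comm C1, ← mesh_pow_sum_const (p := p) (J := J), mul_left_comm, ← mul_sub,
      Finset.mul_sum, ← Finset.sum_sub_distrib]
    gcongr with x
    simpa using H1 d (Q x) (hQ x)
  have hs : p.c / 8 * four (mesh p J) u - C2 * p.L ^ d
      ≤ inn (mesh p J) (fun x => fs p (u x)) 1 := by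
    rw [inn, four, mul_comm C2, ← mesh_pow_sum_const (p := p) (J := J), mul_left_comm, ← mul_sub,
      Finset.mul_sum, ← Finset.sum_sub_distrib]
    gcongr with x
    simpa using H2 (u x)
  rw [E1, ctrl]
  set w := nrm (mesh p J) (lap (mesh p J) u)
  set M := tNrm (mesh p J) (Mu p Q u)
  have hM0 : 0 ≤ M := tNrm_nonneg _ _
  have hw0 : 0 ≤ w := nrm_nonneg _ _
  set Z := tFour (mesh p J) Q
  set V := four (mesh p J) u
  have hZ : 0 ≤ Z := tFour_nonneg hh Q
  have hV : 0 ≤ V := four_nonneg hh u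
  have hG := tGrad2_nonneg (mesh p J) Q
  set G := tGrad2 (mesh p J) Q
  have h1 : -(w * M) ≤ tInn (mesh p J) (hess (mesh p J) u) (Mu p Q u) := by
    have h2 := (abs_le.1 hT).1
    have h3 := mul_le_mul_of_nonneg_right hH hM0
    linarith
  have h2 : -(2 * p.B₀ * p.q ^ 2 * (w * M))
      ≤ 2 * p.B₀ * p.q ^ 2 * tInn (mesh p J) (hess (mesh p J) u) (Mu p Q u) := by
    have := mul_le_mul_of_nonneg_left h1 (by positivity : 0 ≤ 2 * p.B₀ * p.q ^ 2)
    linarith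
  -- From w² ≤ 2(w - q²M)² + 2q⁴M² and 2θ ≤ 1: a multiple of w² is recovered from the square alone.
  have h3 : θ * p.B₀ * w ^ 2 - 2 * θ * p.B₀ * p.q ^ 4 * M ^ 2
      ≤ p.B₀ * (w - p.q ^ 2 * M) ^ 2 := by
    have h4 : w ^ 2 ≤ 2 * (w - p.q ^ 2 * M) ^ 2 + 2 * (p.q ^ 2 * M) ^ 2 := by
      nlinarith [sq_nonneg (w - 2 * (p.q ^ 2 * M))]
    have h5 := mul_le_mul_of_nonneg_left h4 (by positivity : 0 ≤ θ * p.B₀)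
    have h6 : θ * p.B₀ * (2 * (w - p.q ^ 2 * M) ^ 2) ≤ p.B₀ * (w - p.q ^ 2 * M) ^ 2 := by
      have : 0 ≤ p.B₀ * (w - p.q ^ 2 * M) ^ 2 := by positivity
      nlinarith
    linarith
  have h4 : 2 * θ * p.B₀ * p.q ^ 4 * M ^ 2 ≤ m / 16 * (Z + V + p.L ^ d) := by
    calc _ ≤ 2 * θ * p.B₀ * p.q ^ 4 * (a * (Z + V + p.L ^ d)) := by gcongr
      _ = (2 * θ * p.B₀ * p.q ^ 4 * a) * (Z + V + p.L ^ d) := by ring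
      _ ≤ _ := by gcongr
  have h5 : m ≤ p.C := min_le_left _ _
  have h6 : m ≤ p.c := min_le_right _ _
  have e1 : c * G ≤ p.K / 2 * G := by gcongr
  have e2 : c * w ^ 2 ≤ θ * p.B₀ * w ^ 2 := by gcongr
  have e3 : c * Z ≤ m / 16 * Z := by gcongr
  have e4 : c * V ≤ m / 16 * V := by gcongr
  have e5 : m / 8 * Z ≤ p.C / 8 * Z := by gcongr
  have e6 : m / 8 * V ≤ p.c / 8 * V := by gcongr
  have e7 : p.B₀ * (w - p.q ^ 2 * M) ^ 2
      = p.B₀ * w ^ 2 - 2 * p.B₀ * p.q ^ 2 * (w * M) + p.B₀ * p.q ^ 4 * M ^ 2 := by ring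
  rw [e7] at h3
  linarith

lemma gfac_pos (p : Params) (Q : TGrid d J) (u : Grid d J) (s : ℝ) : 0 < gfac p Q u s := by
  unfold gfac; positivity

/-- The modified energy of the scheme. -/
def modE (p : Params) (Q : TGrid d J) (u : Grid d J) (s : ℝ) : ℝ :=
  p.K / 2 * tGrad2 (mesh p J) Q + p.B₀ * nrm (mesh p J) (lap (mesh p J) u) ^ 2 + s

/-- A bound on the modified energy makes the scalar factor absorb any power of `ctrl`. -/
lemma exists_gfac_mul_ctrl_pow_le (d : ℕ) (p : Params) (hp : p.Admissible d) (E : ℝ) (m : ℕ) :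
    ∃ C : ℝ, 0 < C ∧ ∀ (J : ℕ) [NeZero J] (Q : TGrid d J) (u : Grid d J) (s : ℝ),
      (∀ x, (Q x).IsSymm) → modE p Q u s ≤ E →
      gfac p Q u s * ctrl (mesh p J) Q u ^ m ≤ C := by
  obtain ⟨c, C, hc, H⟩ := exists_coercive d p hp
  refine ⟨Real.exp (E + C) * (m.factorial / c ^ m), by positivity, fun J _ Q u s hQ hE => ?_⟩
  have h1 := H J Q u hQ
  have hY := one_le_ctrl (mesh_pos (J := J) hp.L_pos).le Q u
  set Y := ctrl (mesh p J) Q u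
  -- Subtracting coercivity from the energy bound leaves s - E₁ ≤ E + C - cY.
  have h2 : gfac p Q u s ≤ Real.exp (E + C) * Real.exp (-(c * Y)) := by
    rw [gfac, ← Real.exp_sub, ← Real.exp_add]
    apply Real.exp_le_exp.2
    unfold modE at hE
    linarith
  -- A single term of the exponential series dominates Yᵐ, so exp(-cY) absorbs it.
  have h3 := Real.pow_div_factorial_le_exp (c * Y) (by positivity) m
  have h4 : Y ^ m ≤ m.factorial / c ^ m * Real.exp (c * Y) := by
    rw [div_le_iff₀ (by positivity), mul_pow] at h3
    rw [div_mul_eq_mul_div, le_div_iff₀ (by positivity)]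
    linarith
  have h5 : Real.exp (-(c * Y)) * Real.exp (c * Y) = 1 := by rw [← Real.exp_add]; simp
  calc _ ≤ (Real.exp (E + C) * Real.exp (-(c * Y)))
        * (m.factorial / c ^ m * Real.exp (c * Y)) := by gcongr
    _ = Real.exp (E + C) * (m.factorial / c ^ m) * (Real.exp (-(c * Y)) * Real.exp (c * Y)) := by
        ring
    _ = _ := by rw [h5, mul_one]

end Energy

/-! ### Estimates for the nonlinear terms -/

section Nonlinear
variable {d J : ℕ} [NeZero J] {p : Params}

/-- Constant in the seminorm estimate of `Hvar`. -/
def hvarConst (p : Params) (d : ℕ) : ℝ :=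
  |p.A| + |p.B| * (d + d ^ 2) + |p.C| * d ^ 2 + |2 * p.B₀ * p.q ^ 2 / sPlus p d| * (1 + d)
    + |2 * p.B₀ * p.q ^ 4 / sPlus p d ^ 2|

lemma hvarConst_nonneg (p : Params) (d : ℕ) : 0 ≤ hvarConst p d := by unfold hvarConst; positivity

lemma comp_Hvar (Q : TGrid d J) (u : Grid d J) (i j : Fin d) :
    comp (Hvar p Q u) i j = p.A • comp Q i j
      - p.B • (∑ a, comp Q i a * comp Q a j
        - ((1 : Matrix (Fin d) (Fin d) ℝ) i j / d) • ∑ a, ∑ b, comp Q a b * comp Q b a)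
      + p.C • ∑ a, ∑ b, comp Q a b * comp Q b a * comp Q i j
      + (2 * p.B₀ * p.q ^ 2 / sPlus p d) • (u * comp (hess (mesh p J) u) i j
        - ((1 : Matrix (Fin d) (Fin d) ℝ) i j / d) • ∑ a, u * comp (hess (mesh p J) u) a a)
      + (2 * p.B₀ * p.q ^ 4 / sPlus p d ^ 2) • (u * u * comp Q i j) := by
  ext x
  simp only [comp, Hvar, Matrix.add_apply, Matrix.sub_apply, Matrix.smul_apply, smul_eq_mul,
    Pi.add_apply, Pi.sub_apply, Pi.smul_apply, Finset.sum_apply, Pi.mul_apply, pow_two (Q x),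
    Matrix.mul_apply, Matrix.trace, Matrix.diag_apply]
  simp_rw [← Finset.sum_mul, ← Finset.mul_sum]
  ring

lemma abs_one_apply_div_le (i j : Fin d) : |(1 : Matrix (Fin d) (Fin d) ℝ) i j / d| ≤ 1 := by
  have hd : (1 : ℝ) ≤ d := by exact_mod_cast (Nat.zero_lt_of_lt i.2)
  rw [Matrix.one_apply, abs_div, abs_of_pos (by linarith : (0 : ℝ) < d), div_le_one (by linarith)]
  split_ifs
  · simpa using hd
  · simp

/-- Stated for an arbitrary seminorm so that one expansion into monomials serves both the L² norm
and the L² norm of a difference quotient. -/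
lemma seminorm_Hvar_le (ν : Seminorm ℝ (Grid d J)) (Q : TGrid d J) (u : Grid d J)
    {a₀ a₂ a₃ b c : ℝ} (h0 : ∀ i j, ν (comp Q i j) ≤ a₀)
    (h2 : ∀ i j k l, ν (comp Q i j * comp Q k l) ≤ a₂)
    (h3 : ∀ i j k l m n, ν (comp Q i j * comp Q k l * comp Q m n) ≤ a₃)
    (hb : ∀ i j, ν (u * comp (hess (mesh p J) u) i j) ≤ b)
    (hc : ∀ i j, ν (u * u * comp Q i j) ≤ c) (i j : Fin d) :
    ν (comp (Hvar p Q u) i j) ≤ hvarConst p d * (a₀ + a₂ + a₃ + b + c) := by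
  have n0 := (apply_nonneg ν _).trans (h0 i j)
  have n2 := (apply_nonneg ν _).trans (h2 i j i j)
  have n3 := (apply_nonneg ν _).trans (h3 i j i j i j)
  have nb := (apply_nonneg ν _).trans (hb i j)
  have nc := (apply_nonneg ν _).trans (hc i j)
  have hδ := abs_one_apply_div_le i j
  set δ := (1 : Matrix (Fin d) (Fin d) ℝ) i j / d
  have s1 : ν (∑ a, comp Q i a * comp Q a j) ≤ d * a₂ := by
    refine (seminorm_sum_le ν _ _).trans ?_
    refine (Finset.sum_le_sum fun a _ => h2 i a a j).trans (le_of_eq ?_)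
    simp
  have s2 : ν (∑ a, ∑ b, comp Q a b * comp Q b a) ≤ d ^ 2 * a₂ := by
    refine (seminorm_sum_le ν _ _).trans ?_
    refine (Finset.sum_le_sum fun a _ => (seminorm_sum_le ν _ _).trans
      (Finset.sum_le_sum fun b _ => h2 a b b a)).trans (le_of_eq ?_)
    simp; ring
  have s3 : ν (∑ a, ∑ b, comp Q a b * comp Q b a * comp Q i j) ≤ d ^ 2 * a₃ := by
    refine (seminorm_sum_le ν _ _).trans ?_
    refine (Finset.sum_le_sum fun a _ => (seminorm_sum_le ν _ _).trans
      (Finset.sum_le_sum fun b _ => h3 a b b a i j)).trans (le_of_eq ?_)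
    simp; ring
  have s4 : ν (∑ a, u * comp (hess (mesh p J) u) a a) ≤ d * b := by
    refine (seminorm_sum_le ν _ _).trans ?_
    refine (Finset.sum_le_sum fun a _ => hb a a).trans (le_of_eq ?_)
    simp
  have hsub : ∀ (V W : Grid d J), ν (V - δ • W) ≤ ν V + ν W := fun V W => by
    refine (map_sub_le_add ν _ _).trans ?_
    rw [map_smul_eq_mul, Real.norm_eq_abs]
    have := mul_le_mul_of_nonneg_right hδ (apply_nonneg ν W)
    linarith
  rw [comp_Hvar]
  refine (map_add_le_add ν _ _).trans ?_
  refine (add_le_add_left (map_add_le_add ν _ _) _).trans ?_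
  refine (add_le_add_left (add_le_add_left (map_add_le_add ν _ _) _) _).trans ?_
  refine (add_le_add_left (add_le_add_left (add_le_add_left (map_sub_le_add ν _ _) _) _) _).trans ?_
  simp_rw [map_smul_eq_mul, Real.norm_eq_abs]
  have t0 := mul_le_mul_of_nonneg_left (h0 i j) (abs_nonneg p.A)
  have t1 := mul_le_mul_of_nonneg_left ((hsub _ _).trans (add_le_add s1 s2)) (abs_nonneg p.B)
  have t3 := mul_le_mul_of_nonneg_left s3 (abs_nonneg p.C)
  have tb := mul_le_mul_of_nonneg_left ((hsub _ _).trans (add_le_add (hb i j) s4))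
    (abs_nonneg (2 * p.B₀ * p.q ^ 2 / sPlus p d))
  have tc := mul_le_mul_of_nonneg_left (hc i j) (abs_nonneg (2 * p.B₀ * p.q ^ 4 / sPlus p d ^ 2))
  refine (add_le_add (add_le_add (add_le_add (add_le_add t0 t1) t3) tb) tc).trans ?_
  have e1 := abs_nonneg p.A
  have e2 : 0 ≤ |p.B| * (d + d ^ 2) := by positivity
  have e3 : 0 ≤ |p.C| * (d : ℝ) ^ 2 := by positivity
  have e4 : 0 ≤ |2 * p.B₀ * p.q ^ 2 / sPlus p d| * (1 + (d : ℝ)) := by positivity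
  have e5 := abs_nonneg (2 * p.B₀ * p.q ^ 4 / sPlus p d ^ 2)
  calc _ = |p.A| * a₀ + (|p.B| * (d + d ^ 2)) * a₂ + (|p.C| * (d : ℝ) ^ 2) * a₃
        + (|2 * p.B₀ * p.q ^ 2 / sPlus p d| * (1 + d)) * b
        + |2 * p.B₀ * p.q ^ 4 / sPlus p d ^ 2| * c := by ring
    _ ≤ |p.A| * (a₀ + a₂ + a₃ + b + c) + (|p.B| * (d + d ^ 2)) * (a₀ + a₂ + a₃ + b + c)
        + (|p.C| * (d : ℝ) ^ 2) * (a₀ + a₂ + a₃ + b + c)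
        + (|2 * p.B₀ * p.q ^ 2 / sPlus p d| * (1 + d)) * (a₀ + a₂ + a₃ + b + c)
        + |2 * p.B₀ * p.q ^ 4 / sPlus p d ^ 2| * (a₀ + a₂ + a₃ + b + c) := by
        gcongr <;> linarith
    _ = _ := by unfold hvarConst; ring

/-! #### Quantities controlled by the energy -/

lemma nrm_comp_le_tNrm (h : ℝ) (Φ : TGrid d J) (i j : Fin d) : nrm h (comp Φ i j) ≤ tNrm h Φ := by
  refine le_of_sq_le_sq ?_ (tNrm_nonneg _ _)
  rw [tNrm_sq]
  refine le_trans ?_ (Finset.single_le_sum (f := fun i => ∑ j, nrm h (comp Φ i j) ^ 2)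
    (fun _ _ => Finset.sum_nonneg fun _ _ => sq_nonneg _) (Finset.mem_univ i))
  exact Finset.single_le_sum (f := fun j => nrm h (comp Φ i j) ^ 2)
    (fun _ _ => sq_nonneg _) (Finset.mem_univ j)

lemma nrm_lap_comp_sq_le (h : ℝ) (Q : TGrid d J) (i j : Fin d) :
    nrm h (lap h (comp Q i j)) ^ 2 ≤ tLap2 h Q := by
  refine le_trans ?_ (Finset.single_le_sum (f := fun i => ∑ j, nrm h (lap h (comp Q i j)) ^ 2)
    (fun _ _ => Finset.sum_nonneg fun _ _ => sq_nonneg _) (Finset.mem_univ i))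
  exact Finset.single_le_sum (f := fun j => nrm h (lap h (comp Q i j)) ^ 2)
    (fun _ _ => sq_nonneg _) (Finset.mem_univ j)

lemma gradNrm_comp_sq_le (h : ℝ) (Q : TGrid d J) (i j : Fin d) :
    gradNrm h (comp Q i j) ^ 2 ≤ tGrad2 h Q := by
  refine le_trans ?_ (Finset.single_le_sum (f := fun i => ∑ j, gradNrm h (comp Q i j) ^ 2)
    (fun _ _ => Finset.sum_nonneg fun _ _ => sq_nonneg _) (Finset.mem_univ i))
  exact Finset.single_le_sum (f := fun j => gradNrm h (comp Q i j) ^ 2)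
    (fun _ _ => sq_nonneg _) (Finset.mem_univ j)

lemma tNrm_sq_le_ctrl (hL : 0 < p.L) (Q : TGrid d J) (u : Grid d J) :
    tNrm (mesh p J) Q ^ 2 ≤ (p.L ^ d + 1) * ctrl (mesh p J) Q u := by
  have hh := (mesh_pos (J := J) hL).le
  have h1 : tNrm (mesh p J) Q ^ 2 ≤ p.L ^ d * 1 + tFour (mesh p J) Q := by
    rw [tNrm_sq_eq hh, ← mesh_pow_sum_const (p := p) (J := J), tFour, ← mul_add,
      ← Finset.sum_add_distrib]
    gcongr with x
    nlinarith [sq_nonneg (fro (Q x) - 1)]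
  have h2 : tFour (mesh p J) Q ≤ ctrl (mesh p J) Q u := by
    have := tGrad2_nonneg (mesh p J) Q
    have := four_nonneg hh u
    unfold ctrl; nlinarith [sq_nonneg (nrm (mesh p J) (lap (mesh p J) u))]
  have h3 := one_le_ctrl hh Q u
  have : 0 < p.L ^ d := by positivity
  nlinarith

lemma nrm_sq_le_ctrl (hL : 0 < p.L) (Q : TGrid d J) (u : Grid d J) :
    nrm (mesh p J) u ^ 2 ≤ (p.L ^ d + 1) * ctrl (mesh p J) Q u := by
  have hh := (mesh_pos (J := J) hL).le
  have h1 : nrm (mesh p J) u ^ 2 ≤ p.L ^ d * 1 + four (mesh p J) u := by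
    rw [nrm_sq hh, inn, ← mesh_pow_sum_const (p := p) (J := J), four, ← mul_add,
      ← Finset.sum_add_distrib]
    gcongr with x
    nlinarith [sq_nonneg (u x ^ 2 - 1)]
  have h2 : four (mesh p J) u ≤ ctrl (mesh p J) Q u := by
    have := tGrad2_nonneg (mesh p J) Q
    have := tFour_nonneg hh Q
    unfold ctrl; nlinarith [sq_nonneg (nrm (mesh p J) (lap (mesh p J) u))]
  have h3 := one_le_ctrl hh Q u
  have : 0 < p.L ^ d := by positivity
  nlinarith

lemma nrm_lap_sq_le_ctrl {h : ℝ} (hh : 0 ≤ h) (Q : TGrid d J) (u : Grid d J) :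
    nrm h (lap h u) ^ 2 ≤ ctrl h Q u := by
  have := tGrad2_nonneg h Q
  have := tFour_nonneg hh Q
  have := four_nonneg hh u
  unfold ctrl; linarith

lemma tGrad2_le_ctrl {h : ℝ} (hh : 0 ≤ h) (Q : TGrid d J) (u : Grid d J) :
    tGrad2 h Q ≤ ctrl h Q u := by
  have := tFour_nonneg hh Q
  have := four_nonneg hh u
  unfold ctrl; nlinarith [sq_nonneg (nrm h (lap h u))]

lemma tFour_le_ctrl {h : ℝ} (hh : 0 ≤ h) (Q : TGrid d J) (u : Grid d J) :
    tFour h Q ≤ ctrl h Q u := by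
  have := tGrad2_nonneg h Q
  have := four_nonneg hh u
  unfold ctrl; nlinarith [sq_nonneg (nrm h (lap h u))]

/-- Deliberately wasteful: it avoids square roots of `ctrl`, and any power is affordable once
multiplied by `gfac`. -/
lemma le_mul_of_sq_le {x C Y : ℝ} (hC : 1 ≤ C) (hY : 1 ≤ Y) (hx : x ^ 2 ≤ C * Y) : x ≤ C * Y := by
  have h1 : 1 ≤ C * Y := by nlinarith
  nlinarith

/-- Collection of the bounds of lower order quantities by `ctrl`. -/
lemma exists_lower_order_bounds (d : ℕ) (hd : d ≤ 3) (p : Params) (hL : 0 < p.L) :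
    ∃ C : ℝ, 1 ≤ C ∧ ∀ (J : ℕ) [NeZero J] (Q : TGrid d J) (u : Grid d J),
      tNrm (mesh p J) Q ≤ C * ctrl (mesh p J) Q u ∧
      nrm (mesh p J) u ≤ C * ctrl (mesh p J) Q u ∧
      gradNrm (mesh p J) u ≤ C * ctrl (mesh p J) Q u ∧
      nrm (mesh p J) (lap (mesh p J) u) ≤ C * ctrl (mesh p J) Q u ∧
      ‖u‖ ≤ C * ctrl (mesh p J) Q u ∧
      (∀ i j, gradNrm (mesh p J) (comp Q i j) ≤ C * ctrl (mesh p J) Q u) := by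
  obtain ⟨S, hS, H⟩ := exists_sup_le d hd p.L hL one_pos
  have hLd : 0 < p.L ^ d := by positivity
  refine ⟨(1 + S) * (p.L ^ d + 1) + 1, by nlinarith [mul_pos hS hLd], fun J _ Q u => ?_⟩
  have hh := mesh_pos (J := J) hL
  have hY := one_le_ctrl hh.le Q u
  have h1 := tNrm_sq_le_ctrl (p := p) hL Q u
  have h2 := nrm_sq_le_ctrl (p := p) hL Q u
  have h3 := nrm_lap_sq_le_ctrl hh.le Q u
  have h4 := gradNrm_sq_le hh.le u
  have h5 := H J (mesh p J) hh mesh_mul u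
  have h6 := tGrad2_le_ctrl hh.le Q u
  set Y := ctrl (mesh p J) Q u
  set C := (1 + S) * (p.L ^ d + 1) + 1 with hC
  have hC1 : 1 ≤ C := by nlinarith [mul_pos hS hLd]
  have hC2 : p.L ^ d + 1 + 1 ≤ C := by nlinarith [mul_pos hS hLd]
  have hC3 : S * (p.L ^ d + 1) + 1 ≤ C := by nlinarith [mul_pos hS hLd]
  have k1 : (p.L ^ d + 1 + 1) * Y ≤ C * Y := by gcongr
  have k2 : (S * (p.L ^ d + 1) + 1) * Y ≤ C * Y := by gcongr
  have k3 : S * nrm (mesh p J) u ^ 2 ≤ S * ((p.L ^ d + 1) * Y) := by gcongr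
  refine ⟨le_mul_of_sq_le hC1 hY ?_, le_mul_of_sq_le hC1 hY ?_, le_mul_of_sq_le hC1 hY ?_,
    le_mul_of_sq_le hC1 hY ?_, le_mul_of_sq_le hC1 hY ?_, fun i j => le_mul_of_sq_le hC1 hY ?_⟩
  · linarith
  · linarith
  · linarith
  · nlinarith
  · linarith
  · have := gradNrm_comp_sq_le (mesh p J) Q i j
    nlinarith

/-- Two tensor factors are controlled by the fourth-power integral without any supremum, so a cubic
product needs the supremum only once. -/
lemma nrm_comp_mul_comp_le {h : ℝ} (hh : 0 ≤ h) (Q : TGrid d J) (u : Grid d J) (i j k l : Fin d) :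
    nrm h (comp Q i j * comp Q k l) ≤ ctrl h Q u := by
  have h1 : nrm h (comp Q i j * comp Q k l) ^ 2 ≤ tFour h Q := by
    rw [nrm_sq hh, inn, tFour]
    gcongr with x
    simp only [Pi.mul_apply, comp]
    have h2 := sq_le_fro (Q x) i j
    have h3 := sq_le_fro (Q x) k l
    calc _ = Q x i j ^ 2 * Q x k l ^ 2 := by ring
      _ ≤ fro (Q x) * fro (Q x) := mul_le_mul h2 h3 (sq_nonneg _) (fro_nonneg _)
      _ = _ := by ring
  have h2 := tFour_le_ctrl hh Q u
  have h3 := one_le_ctrl hh Q u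
  have := le_mul_of_sq_le le_rfl h3 (by linarith : nrm h (comp Q i j * comp Q k l) ^ 2 ≤ 1 * ctrl h Q u)
  linarith

/-! #### Bounds of the variations in terms of the supremum of the tensor field -/

/-- Linearity in P is the point: the cubic term is split as an L² pair times one supremum. Squaring
then gives P², which interpolates to a small multiple of `tLap2`. -/
lemma exists_nrm_Hvar_le (d : ℕ) (hd : d ≤ 3) (p : Params) (hL : 0 < p.L) :
    ∃ C : ℝ, 0 ≤ C ∧ ∀ (J : ℕ) [NeZero J] (Q : TGrid d J) (u : Grid d J) (P : ℝ),
      (∀ i j, ‖comp Q i j‖ ≤ P) → ∀ i j,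
      nrm (mesh p J) (comp (Hvar p Q u) i j) ≤ C * ctrl (mesh p J) Q u ^ 3 * (1 + P) := by
  obtain ⟨C, hC, H⟩ := exists_lower_order_bounds d hd p hL
  have hK := hvarConst_nonneg p d
  refine ⟨hvarConst p d * (4 * C ^ 3 + 1), by positivity, fun J _ Q u P hP i j => ?_⟩
  have hh := (mesh_pos (J := J) hL).le
  have hY := one_le_ctrl hh Q u
  obtain ⟨b0, b1, b2, b3, b4, b5⟩ := H J Q u
  have hP0 : 0 ≤ P := (norm_nonneg _).trans (hP i j)
  have hQQ := nrm_comp_mul_comp_le hh Q u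
  set Y := ctrl (mesh p J) Q u
  have hY0 : 0 ≤ Y := by linarith
  have hCY : 1 ≤ C * Y := by nlinarith
  have := seminorm_Hvar_le (p := p) (nrmSem d J hh) Q u
    (a₀ := C * Y) (a₂ := Y) (a₃ := Y * P) (b := (C * Y) * (C * Y)) (c := (C * Y) * (C * Y) * (C * Y))
    (fun i j => (nrm_comp_le_tNrm _ _ _ _).trans b0)
    (fun i j k l => hQQ i j k l)
    (fun i j k l m n => (nrm_mul_le' hh _ _).trans
      (mul_le_mul (hQQ i j k l) (hP m n) (norm_nonneg _) hY0))
    (fun i j => (nrm_mul_le hh _ _).trans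
      (mul_le_mul b4 ((nrm_hess_le hh u i j).trans b3) (nrm_nonneg _ _) (by linarith)))
    (fun i j => (nrm_mul_le hh _ _).trans
      (mul_le_mul ((norm_mul_le _ _).trans (mul_le_mul b4 b4 (norm_nonneg _) (by linarith)))
        ((nrm_comp_le_tNrm _ _ _ _).trans b0) (nrm_nonneg _ _) (by positivity))) i j
  refine this.trans ?_
  have e1 : C * Y ≤ (C * Y) ^ 3 := le_self_pow₀ hCY (by norm_num)
  have e2 : (C * Y) ^ 2 ≤ (C * Y) ^ 3 := pow_le_pow_right₀ hCY (by norm_num)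
  have e3 : Y ≤ Y ^ 3 := le_self_pow₀ hY (by norm_num)
  have e4 : Y * P ≤ Y ^ 3 * P := by gcongr
  have e5 : 0 ≤ C ^ 3 * Y ^ 3 * P := by positivity
  calc _ ≤ hvarConst p d * (4 * (C * Y) ^ 3 + Y ^ 3 * (1 + P) + 4 * C ^ 3 * Y ^ 3 * P) := by
        refine mul_le_mul_of_nonneg_left ?_ hK
        linarith
    _ = _ := by ring

/-- Differencing the cubic term puts the L² norm on one gradient and leaves two suprema, hence P².
Third differences of u enter linearly, through the Hessian and through the supremum of the first
difference of u. -/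
lemma exists_nrm_Dp_Hvar_le (d : ℕ) (hd : d ≤ 3) (p : Params) (hL : 0 < p.L) :
    ∃ C : ℝ, 0 ≤ C ∧ ∀ (J : ℕ) [NeZero J] (Q : TGrid d J) (u : Grid d J) (P : ℝ),
      (∀ i j, ‖comp Q i j‖ ≤ P) → ∀ i j k,
      nrm (mesh p J) (Dp (mesh p J) k (comp (Hvar p Q u) i j))
        ≤ C * ctrl (mesh p J) Q u ^ 3 * (1 + P ^ 2 + gradNrm (mesh p J) (lap (mesh p J) u)) := by
  obtain ⟨C, hC, H⟩ := exists_lower_order_bounds d hd p hL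
  obtain ⟨S, hS, HS⟩ := exists_sup_le d hd p.L hL one_pos
  have hK := hvarConst_nonneg p d
  refine ⟨hvarConst p d * (20 * (1 + S) * C ^ 3), by positivity, fun J _ Q u P hP i j k => ?_⟩
  have hh := (mesh_pos (J := J) hL).le
  have hY := one_le_ctrl hh Q u
  obtain ⟨b0, b1, b2, b3, b4, b5⟩ := H J Q u
  have hP0 : 0 ≤ P := (norm_nonneg _).trans (hP i j)
  -- Discrete Sobolev applied to the first difference of u, which commutes with the Laplacian.
  have hDu : ‖Dp (mesh p J) k u‖ ≤ (1 + S) *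
      (gradNrm (mesh p J) (lap (mesh p J) u) + gradNrm (mesh p J) u) := by
    have h1 := HS J (mesh p J) (mesh_pos hL) mesh_mul (Dp (mesh p J) k u)
    have h2 := nrm_lap_Dp_le (mesh p J) k u
    have h3 := nrm_Dp_le (mesh p J) k u
    have g1 := gradNrm_nonneg (mesh p J) u
    have g2 := gradNrm_nonneg (mesh p J) (lap (mesh p J) u)
    refine le_of_sq_le_sq (h1.trans ?_) (by positivity)
    have h4 := pow_le_pow_left₀ (nrm_nonneg _ _) h2 2
    have h5 := pow_le_pow_left₀ (nrm_nonneg _ _) h3 2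
    have h6 := mul_le_mul_of_nonneg_left h5 hS.le
    have h7 : (1 + S) ≤ (1 + S) ^ 2 := by nlinarith
    calc _ ≤ (1 + S) * (gradNrm (mesh p J) (lap (mesh p J) u) ^ 2 + gradNrm (mesh p J) u ^ 2) := by
          nlinarith [sq_nonneg (gradNrm (mesh p J) (lap (mesh p J) u)), sq_nonneg (gradNrm (mesh p J) u),
            mul_nonneg hS.le (sq_nonneg (gradNrm (mesh p J) (lap (mesh p J) u)))]
      _ ≤ (1 + S) ^ 2 * (gradNrm (mesh p J) (lap (mesh p J) u) + gradNrm (mesh p J) u) ^ 2 := by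
          gcongr
          nlinarith [mul_nonneg g1 g2]
      _ = _ := by ring
  have hu3 := gradNrm_nonneg (mesh p J) (lap (mesh p J) u)
  set Y := ctrl (mesh p J) Q u
  set u3 := gradNrm (mesh p J) (lap (mesh p J) u)
  set X := C * Y with hX
  have hY0 : 0 ≤ Y := by linarith
  have hCY : 1 ≤ X := by rw [hX]; nlinarith
  have hX0 : 0 ≤ X := by linarith
  have q1 : ∀ i j, nrm (mesh p J) (Dp (mesh p J) k (comp Q i j)) ≤ X := fun i j =>
    (nrm_Dp_le _ k _).trans (b5 i j)
  have qq : ∀ i j l m, nrm (mesh p J) (Dp (mesh p J) k (comp Q i j * comp Q l m)) ≤ 2 * X * P := by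
    intro i j l m
    refine (nrm_Dp_mul_le hh k _ _).trans ?_
    have e1 := mul_le_mul (q1 i j) (hP l m) (norm_nonneg _) hX0
    have e2 := mul_le_mul (hP i j) (q1 l m) (nrm_nonneg _ _) hP0
    linarith
  have qqq : ∀ i j l m r s, nrm (mesh p J)
      (Dp (mesh p J) k (comp Q i j * comp Q l m * comp Q r s)) ≤ 3 * X * P ^ 2 := by
    intro i j l m r s
    refine (nrm_Dp_mul_le hh k _ _).trans ?_
    have e1 := mul_le_mul (qq i j l m) (hP r s) (norm_nonneg _) (by positivity)
    have e2 := mul_le_mul ((norm_mul_le (comp Q i j) (comp Q l m)).trans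
      (mul_le_mul (hP i j) (hP l m) (norm_nonneg _) hP0)) (q1 r s) (nrm_nonneg _ _) (by positivity)
    linarith
  have uh : ∀ i j, nrm (mesh p J) (Dp (mesh p J) k (u * comp (hess (mesh p J) u) i j))
      ≤ (1 + S) * (u3 + X) * X + X * u3 := by
    intro i j
    refine (nrm_Dp_mul_le' hh k _ _).trans (add_le_add ?_ ?_)
    · exact mul_le_mul (hDu.trans (by gcongr)) ((nrm_hess_le hh u i j).trans b3) (nrm_nonneg _ _)
        (by positivity)
    · exact mul_le_mul b4 (nrm_Dp_hess_le hh k i j u) (nrm_nonneg _ _) hX0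
  have uq : ∀ i j, nrm (mesh p J) (Dp (mesh p J) k (u * u * comp Q i j))
      ≤ 2 * X ^ 2 * P + X ^ 3 := by
    intro i j
    have hDu' := (nrm_Dp_le (mesh p J) k u).trans b2
    refine (nrm_Dp_mul_le hh k _ _).trans (add_le_add ?_ ?_)
    · refine mul_le_mul ((nrm_Dp_mul_le hh k _ _).trans ?_) (hP i j) (norm_nonneg _) (by positivity)
      have e1 := mul_le_mul hDu' b4 (norm_nonneg _) hX0
      have e2 := mul_le_mul b4 hDu' (nrm_nonneg _ _) hX0
      linarith
    · have e1 := mul_le_mul ((norm_mul_le u u).trans (mul_le_mul b4 b4 (norm_nonneg _) hX0))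
        (q1 i j) (nrm_nonneg _ _) (by positivity)
      linarith
  have := seminorm_Hvar_le (p := p) ((nrmSem d J hh).comp (Dp (mesh p J) k)) Q u q1 qq qqq uh uq i j
  simp only [Seminorm.comp_apply, nrmSem_apply] at this
  refine this.trans ?_
  have e1 : X ≤ X ^ 3 := le_self_pow₀ hCY (by norm_num)
  have e2 : X ^ 2 ≤ X ^ 3 := pow_le_pow_right₀ hCY (by norm_num)
  have eP : 2 * P ≤ 1 + P ^ 2 := by nlinarith [sq_nonneg (P - 1)]
  have hX3 : 0 ≤ X ^ 3 := by positivity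
  have f1 : X + 2 * X * P + 3 * X * P ^ 2 ≤ 5 * (X ^ 3 * (1 + P ^ 2)) := by
    have : X + 2 * X * P + 3 * X * P ^ 2 = X * (1 + 2 * P + 3 * P ^ 2) := by ring
    rw [this]
    have h1 : X * (1 + 2 * P + 3 * P ^ 2) ≤ X ^ 3 * (1 + 2 * P + 3 * P ^ 2) := by gcongr
    have h2 : X ^ 3 * (1 + 2 * P + 3 * P ^ 2) ≤ X ^ 3 * (5 * (1 + P ^ 2)) := by
      gcongr; nlinarith [sq_nonneg P]
    linarith
  have f2 : (1 + S) * (u3 + X) * X + X * u3 ≤ (1 + S) * (X ^ 3 * (1 + 2 * u3)) := by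
    have h1 : X * u3 ≤ X ^ 3 * u3 := by gcongr
    have h2 : (1 + S) * (X * u3) ≤ (1 + S) * (X ^ 3 * u3) := by gcongr
    have h3 : (1 + S) * X ^ 2 ≤ (1 + S) * X ^ 3 := by gcongr
    have h4 : 0 ≤ S * (X ^ 3 * u3) := by positivity
    linarith
  have f3 : 2 * X ^ 2 * P + X ^ 3 ≤ 2 * (X ^ 3 * (1 + P ^ 2)) := by
    have h1 : X ^ 2 * (2 * P) ≤ X ^ 3 * (1 + P ^ 2) := by gcongr
    have h2 : 0 ≤ X ^ 3 * P ^ 2 := by positivity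
    linarith
  have hXe : X ^ 3 = C ^ 3 * Y ^ 3 := by rw [hX]; ring
  calc _ ≤ hvarConst p d * (20 * (1 + S) * (X ^ 3 * (1 + P ^ 2 + u3))) := by
        refine mul_le_mul_of_nonneg_left ?_ hK
        have h1 : 0 ≤ S * (X ^ 3 * (1 + P ^ 2)) := by positivity
        have h2 : 0 ≤ S * (X ^ 3 * u3) := by positivity
        have h3 : 0 ≤ X ^ 3 * u3 := by positivity
        have h4 : 0 ≤ X ^ 3 * P ^ 2 := by positivity
        have h5 : 0 ≤ S * (X ^ 3 * P ^ 2) := by positivity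
        linarith
    _ = _ := by rw [hXe]; ring

end Nonlinear

/-! ### Variation in the scalar variable, and nonlinear terms scaled by the auxiliary factor. -/

section NonlinearScaled
variable {d J : ℕ} [NeZero J] {p : Params}

lemma comp_Mten (Q : TGrid d J) (i j : Fin d) :
    comp (Mten p Q) i j = (1 / sPlus p d) • comp Q i j
      + ((1 : Matrix (Fin d) (Fin d) ℝ) i j / d) • (1 : Grid d J) := by
  ext x
  simp only [comp, Mten, Matrix.add_apply, Matrix.smul_apply, smul_eq_mul, Pi.add_apply,
    Pi.smul_apply, Pi.one_apply]
  ring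

lemma lap_one (h : ℝ) : lap h (1 : Grid d J) = 0 := by
  have : ∀ k, Dm h k (1 : Grid d J) = 0 := fun k => by ext x; simp [Dm]
  simp [lap, this]

lemma norm_one_le : ‖(1 : Grid d J)‖ ≤ 1 :=
  (pi_norm_le_iff_of_nonneg zero_le_one).2 fun x => by simp

lemma norm_comp_Mten_le {Q : TGrid d J} {P : ℝ} (hP : ∀ i j, ‖comp Q i j‖ ≤ P) (i j : Fin d) :
    ‖comp (Mten p Q) i j‖ ≤ |1 / sPlus p d| * P + 1 := by
  rw [comp_Mten]
  refine (norm_add_le _ _).trans (add_le_add ?_ ?_)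
  · rw [norm_smul, Real.norm_eq_abs]; gcongr; exact hP i j
  · rw [norm_smul, Real.norm_eq_abs]
    have := mul_le_mul (abs_one_apply_div_le i j) (norm_one_le (d := d) (J := J)) (norm_nonneg _)
      zero_le_one
    linarith

lemma nrm_lap_comp_Mten {h : ℝ} (hh : 0 ≤ h) (Q : TGrid d J) (i j : Fin d) :
    nrm h (lap h (comp (Mten p Q) i j)) = |1 / sPlus p d| * nrm h (lap h (comp Q i j)) := by
  rw [comp_Mten, map_add, map_smul, map_smul, lap_one, smul_zero, add_zero, nrm_smul hh]

lemma nrm_one_le (hL : 0 < p.L) : nrm (mesh p J) (1 : Grid d J) ≤ p.L ^ d + 1 := by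
  have hh := (mesh_pos (J := J) hL).le
  have : 0 < p.L ^ d := by positivity
  refine le_of_sq_le_sq ?_ (by positivity)
  have h1 : nrm (mesh p J) (1 : Grid d J) ^ 2 = p.L ^ d * 1 := by
    rw [nrm_sq hh, inn, ← mesh_pow_sum_const (p := p) (J := J)]; simp
  rw [h1]; nlinarith

lemma nrm_Mten_mul_self_le (hL : 0 < p.L) (Q : TGrid d J) (u : Grid d J) (i j : Fin d) :
    nrm (mesh p J) (comp (Mten p Q) i j * comp (Mten p Q) i j)
      ≤ (2 * (1 / sPlus p d) ^ 2 + 2 * (p.L ^ d + 1)) * ctrl (mesh p J) Q u := by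
  have hh := (mesh_pos (J := J) hL).le
  have h1 : nrm (mesh p J) (comp (Mten p Q) i j * comp (Mten p Q) i j)
      ≤ nrm (mesh p J) ((2 * (1 / sPlus p d) ^ 2) • (fun x => fro (Q x)) + (2 : ℝ) • 1) := by
    refine nrm_mono hh fun x => ?_
    have h2 := fro_Mten_le p Q x
    have h3 := sq_le_fro (Mten p Q x) i j
    simp only [Pi.mul_apply, comp, Pi.add_apply, Pi.smul_apply, smul_eq_mul, Pi.one_apply, mul_one]
    rw [abs_of_nonneg (mul_self_nonneg _)]
    refine le_trans ?_ (le_abs_self _)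
    nlinarith
  have hY := one_le_ctrl hh Q u
  have h4 : nrm (mesh p J) (fun x => fro (Q x)) ≤ ctrl (mesh p J) Q u := by
    have h5 : nrm (mesh p J) (fun x => fro (Q x)) ^ 2 = tFour (mesh p J) Q := by
      rw [nrm_sq hh, inn, tFour]; simp_rw [← pow_two]
    have h6 := tFour_le_ctrl hh Q u
    have := le_mul_of_sq_le le_rfl hY (x := nrm (mesh p J) (fun x => fro (Q x))) (by linarith)
    linarith
  refine h1.trans ((nrm_add_le hh _ _).trans ?_)
  rw [nrm_smul hh, nrm_smul hh, abs_of_nonneg (by positivity : 0 ≤ 2 * (1 / sPlus p d) ^ 2), abs_two]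
  have h7 := nrm_one_le (d := d) (J := J) hL
  have h8 : 0 ≤ 2 * (1 / sPlus p d) ^ 2 := by positivity
  have h9 := mul_le_mul_of_nonneg_left h4 h8
  have : 0 < p.L ^ d := by positivity
  nlinarith

lemma muvar_eq (Q : TGrid d J) (u : Grid d J) :
    muvar p Q u = p.a • u + p.b • (u * u) + p.c • (u * u * u)
      + (2 * p.B₀ * p.q ^ 2) • ∑ i, ∑ j, comp (Mten p Q) i j * comp (hess (mesh p J) u) i j
      + (2 * p.B₀ * p.q ^ 2) • ∑ i, ∑ j, Dm (mesh p J) i (Dm (mesh p J) j (comp (Mten p Q) i j * u))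
      + (2 * p.B₀ * p.q ^ 4) • ∑ i, ∑ j, comp (Mten p Q) i j * comp (Mten p Q) i j * u := by
  have hdd : divDiv (mesh p J) (Mu p Q u)
      = ∑ i, ∑ j, Dm (mesh p J) i (Dm (mesh p J) j (comp (Mten p Q) i j * u)) := by
    rw [divDiv]
    refine Finset.sum_congr rfl fun i _ => ?_
    rw [map_sum]
    refine Finset.sum_congr rfl fun j _ => ?_
    have : comp (Mu p Q u) i j = comp (Mten p Q) i j * u := by
      ext x; simp [comp, Mu, mul_comm]
    rw [this]
  ext x
  rw [muvar, hdd]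
  simp only [comp, Pi.add_apply, Pi.smul_apply, smul_eq_mul, Finset.sum_apply, Pi.mul_apply]
  simp_rw [← Finset.sum_mul, pow_two (Mten p Q x _ _)]
  ring

lemma seminorm_sum_sum_le (ν : Seminorm ℝ (Grid d J)) (f : Fin d → Fin d → Grid d J) {a : ℝ}
    (h : ∀ i j, ν (f i j) ≤ a) : ν (∑ i, ∑ j, f i j) ≤ d ^ 2 * a := by
  refine (seminorm_sum_le ν _ _).trans ?_
  refine (Finset.sum_le_sum fun i _ => (seminorm_sum_le ν _ _).trans
    (Finset.sum_le_sum fun j _ => h i j)).trans (le_of_eq ?_)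
  simp; ring

/-- Only the double divergence of the product M u involves second differences of Q. The algebra
estimate `nrm_Dm_Dm_mul_le` keeps the bound linear in l and P. -/
lemma exists_nrm_muvar_le (d : ℕ) (hd : d ≤ 3) (p : Params) (hL : 0 < p.L) :
    ∃ C : ℝ, 0 ≤ C ∧ ∀ (J : ℕ) [NeZero J] (Q : TGrid d J) (u : Grid d J) (P l : ℝ), 0 ≤ P → 0 ≤ l →
      (∀ i j, ‖comp Q i j‖ ≤ P) → (∀ i j, nrm (mesh p J) (lap (mesh p J) (comp Q i j)) ≤ l) →
      nrm (mesh p J) (muvar p Q u) ≤ C * ctrl (mesh p J) Q u ^ 3 * (1 + P + l) := by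
  obtain ⟨C, hC, H⟩ := exists_lower_order_bounds d hd p hL
  set r := |1 / sPlus p d| with hr
  have hr0 : 0 ≤ r := abs_nonneg _
  set R := 2 * (1 / sPlus p d) ^ 2 + 2 * (p.L ^ d + 1) with hR
  have hR0 : 0 ≤ R := by positivity
  set b₁ := |2 * p.B₀ * p.q ^ 2| with hb₁
  set b₂ := |2 * p.B₀ * p.q ^ 4| with hb₂
  have hb₁0 : 0 ≤ b₁ := abs_nonneg _
  have hb₂0 : 0 ≤ b₂ := abs_nonneg _
  refine ⟨(|p.a| + |p.b| + |p.c|) * C ^ 3 + b₁ * (d ^ 2 * ((r + 1) * C ^ 3))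
    + b₁ * (d ^ 2 * (8 * (r + 1) * C ^ 3)) + b₂ * (d ^ 2 * (R * C ^ 3)), by positivity,
    fun J _ Q u P l hP0 hl0 hP hl => ?_⟩
  have hh := (mesh_pos (J := J) hL).le
  have hY := one_le_ctrl hh Q u
  obtain ⟨b0, b1, b2, b3, b4, b5⟩ := H J Q u
  have hMM := nrm_Mten_mul_self_le (p := p) (J := J) hL Q u
  have hM := norm_comp_Mten_le (p := p) hP
  rw [← hr] at hM
  rw [← hR] at hMM
  set Y := ctrl (mesh p J) Q u
  have hY0 : 0 ≤ Y := by linarith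
  set X := C * Y with hX
  have hX1 : 1 ≤ X := by rw [hX]; nlinarith
  have hX0 : 0 ≤ X := by linarith
  set D := 1 + P + l with hD
  have hD1 : 1 ≤ D := by linarith
  have e1 : X ≤ X ^ 3 * D := (le_self_pow₀ hX1 (by norm_num : 3 ≠ 0)).trans
    (le_mul_of_one_le_right (by positivity) hD1)
  have e2 : X ^ 2 ≤ X ^ 3 * D := (pow_le_pow_right₀ hX1 (by norm_num : 2 ≤ 3)).trans
    (le_mul_of_one_le_right (by positivity) hD1)
  have e3 : X ^ 3 ≤ X ^ 3 * D := le_mul_of_one_le_right (by positivity) hD1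
  have eX : X ≤ X ^ 3 := le_self_pow₀ hX1 (by norm_num : 3 ≠ 0)
  have hrP : r * P + 1 ≤ (r + 1) * D := by rw [hD]; nlinarith
  have t1 : nrm (mesh p J) (u * u) ≤ X ^ 3 * D := by
    refine (nrm_mul_le hh _ _).trans (le_trans ?_ e2)
    rw [pow_two]; exact mul_le_mul b4 b1 (nrm_nonneg _ _) hX0
  have t2 : nrm (mesh p J) (u * u * u) ≤ X ^ 3 * D := by
    refine (nrm_mul_le hh _ _).trans (le_trans ?_ e3)
    rw [pow_succ, pow_two]
    exact mul_le_mul ((norm_mul_le _ _).trans (mul_le_mul b4 b4 (norm_nonneg _) hX0)) b1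
      (nrm_nonneg _ _) (by positivity)
  have t3 : nrm (mesh p J) (∑ i, ∑ j, comp (Mten p Q) i j * comp (hess (mesh p J) u) i j)
      ≤ d ^ 2 * ((r + 1) * (X ^ 3 * D)) := by
    refine seminorm_sum_sum_le (nrmSem d J hh) _ fun i j => (nrm_mul_le hh _ _).trans ?_
    refine (mul_le_mul ((hM i j).trans hrP) ((nrm_hess_le hh u i j).trans (b3.trans eX))
      (nrm_nonneg _ _) (by positivity)).trans (le_of_eq ?_)
    ring
  have t4 : nrm (mesh p J) (∑ i, ∑ j, Dm (mesh p J) i (Dm (mesh p J) j (comp (Mten p Q) i j * u)))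
      ≤ d ^ 2 * (8 * (r + 1) * (X ^ 3 * D)) := by
    refine seminorm_sum_sum_le (nrmSem d J hh) _ fun i j => (nrm_Dm_Dm_mul_le hh i j _ _).trans ?_
    rw [nrm_lap_comp_Mten hh, ← hr]
    have f1 := mul_le_mul ((hM i j).trans hrP) (b3.trans eX) (nrm_nonneg _ _) (by positivity)
    have f2 : r * nrm (mesh p J) (lap (mesh p J) (comp Q i j)) ≤ (r + 1) * D := by
      have := hl i j
      exact mul_le_mul (by linarith) (by linarith) (nrm_nonneg _ _) (by linarith)
    have f3 := mul_le_mul (b4.trans eX) f2 (mul_nonneg hr0 (nrm_nonneg _ _)) (by positivity)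
    linarith
  have t5 : nrm (mesh p J) (∑ i, ∑ j, comp (Mten p Q) i j * comp (Mten p Q) i j * u)
      ≤ d ^ 2 * (R * (X ^ 3 * D)) := by
    refine seminorm_sum_sum_le (nrmSem d J hh) _ fun i j => (nrm_mul_le' hh _ _).trans ?_
    refine (mul_le_mul (hMM i j) b4 (norm_nonneg _) (by positivity)).trans ?_
    have : Y ≤ X := by rw [hX]; nlinarith
    calc R * Y * X ≤ R * X * X := by gcongr
      _ = R * X ^ 2 := by ring
      _ ≤ _ := by gcongr
  rw [muvar_eq]
  refine (nrm_add_le hh _ _).trans ?_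
  refine (add_le_add_left (nrm_add_le hh _ _) _).trans ?_
  refine (add_le_add_left (add_le_add_left (nrm_add_le hh _ _) _) _).trans ?_
  refine (add_le_add_left (add_le_add_left (add_le_add_left (nrm_add_le hh _ _) _) _) _).trans ?_
  refine (add_le_add_left (add_le_add_left (add_le_add_left (add_le_add_left
    (nrm_add_le hh _ _) _) _) _) _).trans ?_
  simp_rw [nrm_smul hh]
  have s0 := mul_le_mul_of_nonneg_left (b1.trans e1) (abs_nonneg p.a)
  have s1 := mul_le_mul_of_nonneg_left t1 (abs_nonneg p.b)
  have s2 := mul_le_mul_of_nonneg_left t2 (abs_nonneg p.c)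
  have s3 := mul_le_mul_of_nonneg_left t3 hb₁0
  have s4 := mul_le_mul_of_nonneg_left t4 hb₁0
  have s5 := mul_le_mul_of_nonneg_left t5 hb₂0
  refine (add_le_add (add_le_add (add_le_add (add_le_add (add_le_add s0 s1) s2) s3) s4) s5).trans
    (le_of_eq ?_)
  rw [hX]; ring

/-! #### The scaled variations under an energy bound -/

/-- P is chosen with an exact formula for P², so that it can be substituted: the price of a supremum
is a small multiple of `tLap2` plus a multiple of `ctrl`. -/
lemma exists_sup_comp_le (d : ℕ) (hd : d ≤ 3) (p : Params) (hL : 0 < p.L) {δ : ℝ} (hδ : 0 < δ) :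
    ∃ C : ℝ, 0 < C ∧ ∀ (J : ℕ) [NeZero J] (Q : TGrid d J) (u : Grid d J), ∃ P : ℝ, 0 ≤ P ∧
      (∀ i j, ‖comp Q i j‖ ≤ P) ∧ P ^ 2 = δ * tLap2 (mesh p J) Q + C * ctrl (mesh p J) Q u := by
  obtain ⟨S, hS, H⟩ := exists_sup_le d hd p.L hL hδ
  have hLd : 0 < p.L ^ d := by have := hL; positivity
  refine ⟨S * (p.L ^ d + 1), by positivity, fun J _ Q u => ?_⟩
  have hh := mesh_pos (J := J) hL
  have hY := one_le_ctrl hh.le Q u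
  have hl := tLap2_nonneg (mesh p J) Q
  have hnn : 0 ≤ δ * tLap2 (mesh p J) Q + S * (p.L ^ d + 1) * ctrl (mesh p J) Q u := by positivity
  refine ⟨√(δ * tLap2 (mesh p J) Q + S * (p.L ^ d + 1) * ctrl (mesh p J) Q u), Real.sqrt_nonneg _,
    fun i j => Real.le_sqrt_of_sq_le ?_, Real.sq_sqrt hnn⟩
  refine (H J (mesh p J) hh mesh_mul (comp Q i j)).trans ?_
  have h1 := nrm_lap_comp_sq_le (mesh p J) Q i j
  have h2 := (pow_le_pow_left₀ (nrm_nonneg _ _) (nrm_comp_le_tNrm (mesh p J) Q i j) 2).trans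
    (tNrm_sq_le_ctrl (p := p) hL Q u)
  rw [mul_assoc S]
  gcongr

/-- All powers of `ctrl` disappear into the scalar factor; what remains of P² is an arbitrarily
small multiple of `tLap2`, ready to be absorbed by parabolic smoothing. -/
lemma exists_gfac_nrm_Hvar_sq_le (d : ℕ) (hd : d ≤ 3) (p : Params) (hp : p.Admissible d) (E : ℝ)
    {δ : ℝ} (hδ : 0 < δ) :
    ∃ C : ℝ, 0 ≤ C ∧ ∀ (J : ℕ) [NeZero J] (Q : TGrid d J) (u : Grid d J) (s : ℝ),
      (∀ x, (Q x).IsSymm) → modE p Q u s ≤ E → ∀ i j,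
      (gfac p Q u s * nrm (mesh p J) (comp (Hvar p Q u) i j)) ^ 2
        ≤ C + δ * tLap2 (mesh p J) Q := by
  obtain ⟨C, hC, H⟩ := exists_nrm_Hvar_le d hd p hp.L_pos
  obtain ⟨G3, hG3, H3⟩ := exists_gfac_mul_ctrl_pow_le d p hp E 3
  obtain ⟨G4, hG4, H4⟩ := exists_gfac_mul_ctrl_pow_le d p hp E 4
  obtain ⟨S, hS, HS⟩ := exists_sup_comp_le d hd p hp.L_pos
    -- Compensates the factor 2C²G₃² appearing below; the added 1 keeps the denominator positive.
    (δ := δ / (2 * C ^ 2 * G3 ^ 2 + 1)) (by positivity)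
  refine ⟨2 * C ^ 2 * (G3 ^ 2 + S * (G3 * G4)), by positivity, fun J _ Q u s hQ hE i j => ?_⟩
  obtain ⟨P, hP0, hP, hPsq⟩ := HS J Q u
  have h1 := H J Q u P hP i j
  have h3 := H3 J Q u s hQ hE
  have h4 := H4 J Q u s hQ hE
  have hg := gfac_pos p Q u s
  have hY := one_le_ctrl (mesh_pos (J := J) hp.L_pos).le Q u
  have hl := tLap2_nonneg (mesh p J) Q
  set g := gfac p Q u s
  set Y := ctrl (mesh p J) Q u
  set l := tLap2 (mesh p J) Q
  have hA : 0 ≤ g * Y ^ 3 := by positivity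
  have hsq : (g * Y ^ 3) ^ 2 ≤ G3 ^ 2 := by gcongr
  have hsqY : (g * Y ^ 3) ^ 2 * Y ≤ G3 * G4 := by
    calc _ = (g * Y ^ 3) * (g * Y ^ 4) := by ring
      _ ≤ _ := by gcongr
  have hn := nrm_nonneg (mesh p J) (comp (Hvar p Q u) i j)
  calc _ ≤ (g * (C * Y ^ 3 * (1 + P))) ^ 2 := by gcongr
    _ = C ^ 2 * ((g * Y ^ 3) ^ 2 * (1 + P) ^ 2) := by ring
    _ ≤ C ^ 2 * ((g * Y ^ 3) ^ 2 * (2 * (1 + P ^ 2))) := by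
        gcongr; nlinarith [sq_nonneg (P - 1)]
    _ = 2 * C ^ 2 * ((g * Y ^ 3) ^ 2 + S * ((g * Y ^ 3) ^ 2 * Y))
        + 2 * C ^ 2 * (g * Y ^ 3) ^ 2 * (δ / (2 * C ^ 2 * G3 ^ 2 + 1) * l) := by rw [hPsq]; ring
    _ ≤ 2 * C ^ 2 * (G3 ^ 2 + S * (G3 * G4))
        + 2 * C ^ 2 * G3 ^ 2 * (δ / (2 * C ^ 2 * G3 ^ 2 + 1) * l) := by gcongr
    _ ≤ _ := by
        refine add_le_add_right ?_ _
        have : 2 * C ^ 2 * G3 ^ 2 * (δ / (2 * C ^ 2 * G3 ^ 2 + 1) * l)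
            = (2 * C ^ 2 * G3 ^ 2 / (2 * C ^ 2 * G3 ^ 2 + 1)) * (δ * l) := by ring
        rw [this]
        refine mul_le_of_le_one_left (by positivity) ?_
        rw [div_le_one (by positivity)]; linarith

/-- No small coefficient is required here: this bound is applied only after the time sum of `tLap2`
has been controlled. -/
lemma exists_gfac_nrm_muvar_sq_le (d : ℕ) (hd : d ≤ 3) (p : Params) (hp : p.Admissible d) (E : ℝ) :
    ∃ C : ℝ, 0 ≤ C ∧ ∀ (J : ℕ) [NeZero J] (Q : TGrid d J) (u : Grid d J) (s : ℝ),
      (∀ x, (Q x).IsSymm) → modE p Q u s ≤ E →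
      (gfac p Q u s * nrm (mesh p J) (muvar p Q u)) ^ 2 ≤ C * (1 + tLap2 (mesh p J) Q) := by
  obtain ⟨C, hC, H⟩ := exists_nrm_muvar_le d hd p hp.L_pos
  obtain ⟨G3, hG3, H3⟩ := exists_gfac_mul_ctrl_pow_le d p hp E 3
  obtain ⟨G4, hG4, H4⟩ := exists_gfac_mul_ctrl_pow_le d p hp E 4
  obtain ⟨S, hS, HS⟩ := exists_sup_comp_le d hd p hp.L_pos one_pos
  refine ⟨3 * C ^ 2 * (2 * G3 ^ 2 + S * (G3 * G4)), by positivity, fun J _ Q u s hQ hE => ?_⟩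
  obtain ⟨P, hP0, hP, hPsq⟩ := HS J Q u
  have hl := tLap2_nonneg (mesh p J) Q
  have h1 := H J Q u P √(tLap2 (mesh p J) Q) hP0 (Real.sqrt_nonneg _) hP (fun i j =>
    Real.le_sqrt_of_sq_le (nrm_lap_comp_sq_le _ Q i j))
  have hlsq := Real.sq_sqrt hl
  have h3 := H3 J Q u s hQ hE
  have h4 := H4 J Q u s hQ hE
  have hg := gfac_pos p Q u s
  have hY := one_le_ctrl (mesh_pos (J := J) hp.L_pos).le Q u
  set g := gfac p Q u s
  set Y := ctrl (mesh p J) Q u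
  set l := tLap2 (mesh p J) Q
  have hA : 0 ≤ g * Y ^ 3 := by positivity
  have hsq : (g * Y ^ 3) ^ 2 ≤ G3 ^ 2 := by gcongr
  have hsqY : (g * Y ^ 3) ^ 2 * Y ≤ G3 * G4 := by
    calc _ = (g * Y ^ 3) * (g * Y ^ 4) := by ring
      _ ≤ _ := by gcongr
  have hn := nrm_nonneg (mesh p J) (muvar p Q u)
  calc _ ≤ (g * (C * Y ^ 3 * (1 + P + √l))) ^ 2 := by gcongr
    _ = C ^ 2 * ((g * Y ^ 3) ^ 2 * (1 + P + √l) ^ 2) := by ring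
    _ ≤ C ^ 2 * ((g * Y ^ 3) ^ 2 * (3 * (1 + P ^ 2 + √l ^ 2))) := by
        gcongr; nlinarith [sq_nonneg (P - 1), sq_nonneg (P - √l), sq_nonneg (√l - 1)]
    _ = 3 * C ^ 2 * ((g * Y ^ 3) ^ 2 * (1 + 2 * l) + S * ((g * Y ^ 3) ^ 2 * Y)) := by
        rw [hPsq, hlsq]; ring
    _ ≤ 3 * C ^ 2 * (G3 ^ 2 * (1 + 2 * l) + S * (G3 * G4)) := by gcongr
    _ ≤ _ := by
        rw [mul_assoc (3 * C ^ 2)]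
        refine mul_le_mul_of_nonneg_left ?_ (by positivity)
        have : 0 ≤ S * (G3 * G4) * l := by positivity
        nlinarith [sq_nonneg G3]

lemma exists_gfac_nrm_Dp_Hvar_le (d : ℕ) (hd : d ≤ 3) (p : Params) (hp : p.Admissible d) (E : ℝ) :
    ∃ C : ℝ, 0 ≤ C ∧ ∀ (J : ℕ) [NeZero J] (Q : TGrid d J) (u : Grid d J) (s : ℝ),
      (∀ x, (Q x).IsSymm) → modE p Q u s ≤ E → ∀ i j k,
      gfac p Q u s * nrm (mesh p J) (Dp (mesh p J) k (comp (Hvar p Q u) i j))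
        ≤ C * (1 + tLap2 (mesh p J) Q + gradNrm (mesh p J) (lap (mesh p J) u)) := by
  obtain ⟨C, hC, H⟩ := exists_nrm_Dp_Hvar_le d hd p hp.L_pos
  obtain ⟨G3, hG3, H3⟩ := exists_gfac_mul_ctrl_pow_le d p hp E 3
  obtain ⟨G4, hG4, H4⟩ := exists_gfac_mul_ctrl_pow_le d p hp E 4
  obtain ⟨S, hS, HS⟩ := exists_sup_comp_le d hd p hp.L_pos one_pos
  refine ⟨C * (G3 + S * G4), by positivity, fun J _ Q u s hQ hE i j k => ?_⟩
  obtain ⟨P, hP0, hP, hPsq⟩ := HS J Q u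
  have hl := tLap2_nonneg (mesh p J) Q
  have h1 := H J Q u P hP i j k
  have h3 := H3 J Q u s hQ hE
  have h4 := H4 J Q u s hQ hE
  have hg := gfac_pos p Q u s
  have hY := one_le_ctrl (mesh_pos (J := J) hp.L_pos).le Q u
  have hu3 := gradNrm_nonneg (mesh p J) (lap (mesh p J) u)
  set g := gfac p Q u s
  set Y := ctrl (mesh p J) Q u
  set l := tLap2 (mesh p J) Q
  set u3 := gradNrm (mesh p J) (lap (mesh p J) u)
  calc _ ≤ g * (C * Y ^ 3 * (1 + P ^ 2 + u3)) := by gcongr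
    _ = C * ((g * Y ^ 3) * (1 + l + u3) + S * (g * Y ^ 4)) := by rw [hPsq]; ring
    _ ≤ C * (G3 * (1 + l + u3) + S * G4) := by gcongr
    _ ≤ _ := by
        rw [mul_assoc]
        gcongr
        have : 0 ≤ S * G4 * (l + u3) := by positivity
        linarith

/-! #### The nonlinear terms of the scheme -/

lemma comp_NQ (Q : TGrid d J) (u : Grid d J) (s : ℝ) (i j : Fin d) :
    comp (NQ p Q u s) i j = -(gfac p Q u s • comp (Hvar p Q u) i j)
      + (gfac p Q u s * p.κ₁) • comp Q i j := by
  ext x; simp [comp, NQ]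

lemma exists_gfac_lower_order_le (d : ℕ) (hd : d ≤ 3) (p : Params) (hp : p.Admissible d) (E : ℝ) :
    ∃ C : ℝ, 0 ≤ C ∧ ∀ (J : ℕ) [NeZero J] (Q : TGrid d J) (u : Grid d J) (s : ℝ),
      (∀ x, (Q x).IsSymm) → modE p Q u s ≤ E →
      gfac p Q u s ≤ C ∧ gfac p Q u s * nrm (mesh p J) u ≤ C ∧ gfac p Q u s * tNrm (mesh p J) Q ≤ C ∧
      ∀ i j, gfac p Q u s * gradNrm (mesh p J) (comp Q i j) ≤ C := by
  obtain ⟨C, hC, H⟩ := exists_lower_order_bounds d hd p hp.L_pos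
  obtain ⟨G, hG, HG⟩ := exists_gfac_mul_ctrl_pow_le d p hp E 1
  refine ⟨C * G, by positivity, fun J _ Q u s hQ hE => ?_⟩
  obtain ⟨b0, b1, b2, b3, b4, b5⟩ := H J Q u
  have hg := gfac_pos p Q u s
  have hY := one_le_ctrl (mesh_pos (J := J) hp.L_pos).le Q u
  have h1 := HG J Q u s hQ hE
  rw [pow_one] at h1
  have key : ∀ x, x ≤ C * ctrl (mesh p J) Q u → gfac p Q u s * x ≤ C * G := fun x hx => by
    calc _ ≤ gfac p Q u s * (C * ctrl (mesh p J) Q u) := by gcongr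
      _ = C * (gfac p Q u s * ctrl (mesh p J) Q u) := by ring
      _ ≤ _ := by gcongr
  refine ⟨?_, key _ b1, key _ b0, fun i j => key _ (b5 i j)⟩
  have := key 1 (by nlinarith)
  linarith

lemma sum_sum_le_of_le {f : Fin d → Fin d → ℝ} {a : ℝ} (h : ∀ i j, f i j ≤ a) :
    ∑ i, ∑ j, f i j ≤ (d : ℝ) ^ 2 * a := by
  refine (Finset.sum_le_sum fun i _ => Finset.sum_le_sum fun j _ => h i j).trans (le_of_eq ?_)
  simp; ring

lemma exists_tNrm_NQ_sq_le (d : ℕ) (hd : d ≤ 3) (p : Params) (hp : p.Admissible d) (E : ℝ)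
    {δ : ℝ} (hδ : 0 < δ) :
    ∃ C : ℝ, 0 ≤ C ∧ ∀ (J : ℕ) [NeZero J] (Q : TGrid d J) (u : Grid d J) (s : ℝ),
      (∀ x, (Q x).IsSymm) → modE p Q u s ≤ E →
      tNrm (mesh p J) (NQ p Q u s) ^ 2 ≤ C + δ * tLap2 (mesh p J) Q := by
  obtain ⟨C, hC, H⟩ := exists_gfac_nrm_Hvar_sq_le d hd p hp E
    (δ := δ / (2 * (d : ℝ) ^ 2 + 1)) (by positivity)
  obtain ⟨G, hG, HG⟩ := exists_gfac_lower_order_le d hd p hp E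
  refine ⟨(d : ℝ) ^ 2 * (2 * C + 2 * (p.κ₁ * G) ^ 2), by positivity, fun J _ Q u s hQ hE => ?_⟩
  have hh := (mesh_pos (J := J) hp.L_pos).le
  obtain ⟨g0, g1, g2, g3⟩ := HG J Q u s hQ hE
  have hg := gfac_pos p Q u s
  have hκ := hp.κ₁_pos
  have hl := tLap2_nonneg (mesh p J) Q
  rw [tNrm_sq]
  refine (sum_sum_le_of_le (a := 2 * (C + δ / (2 * (d : ℝ) ^ 2 + 1) * tLap2 (mesh p J) Q)
    + 2 * (p.κ₁ * G) ^ 2) fun i j => ?_).trans ?_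
  · have h1 := H J Q u s hQ hE i j
    have h2 : nrm (mesh p J) (comp (NQ p Q u s) i j)
        ≤ gfac p Q u s * nrm (mesh p J) (comp (Hvar p Q u) i j) + p.κ₁ * G := by
      rw [comp_NQ]
      refine (nrm_add_le hh _ _).trans ?_
      rw [nrm_neg hh, nrm_smul hh, nrm_smul hh, abs_of_pos hg, abs_of_pos (by positivity)]
      have h3 := nrm_comp_le_tNrm (mesh p J) Q i j
      have h4 : gfac p Q u s * p.κ₁ * nrm (mesh p J) (comp Q i j) ≤ p.κ₁ * G := by
        calc _ ≤ p.κ₁ * (gfac p Q u s * tNrm (mesh p J) Q) := by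
              rw [mul_comm (gfac p Q u s), mul_assoc]; gcongr
          _ ≤ _ := by gcongr
      linarith
    have h5 := pow_le_pow_left₀ (nrm_nonneg _ _) h2 2
    nlinarith [sq_nonneg (gfac p Q u s * nrm (mesh p J) (comp (Hvar p Q u) i j) - p.κ₁ * G)]
  · have : (d : ℝ) ^ 2 * (2 * (δ / (2 * (d : ℝ) ^ 2 + 1) * tLap2 (mesh p J) Q))
        ≤ δ * tLap2 (mesh p J) Q := by
      have e : (d : ℝ) ^ 2 * (2 * (δ / (2 * (d : ℝ) ^ 2 + 1) * tLap2 (mesh p J) Q))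
          = (2 * (d : ℝ) ^ 2 / (2 * (d : ℝ) ^ 2 + 1)) * (δ * tLap2 (mesh p J) Q) := by ring
      rw [e]
      refine mul_le_of_le_one_left (by positivity) ?_
      rw [div_le_one (by positivity)]; linarith
    linarith

lemma exists_nrm_Nu_sq_le (d : ℕ) (hd : d ≤ 3) (p : Params) (hp : p.Admissible d) (E : ℝ) :
    ∃ C : ℝ, 0 ≤ C ∧ ∀ (J : ℕ) [NeZero J] (Q : TGrid d J) (u : Grid d J) (s : ℝ),
      (∀ x, (Q x).IsSymm) → modE p Q u s ≤ E →
      nrm (mesh p J) (Nu p Q u s) ^ 2 ≤ C * (1 + tLap2 (mesh p J) Q) := by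
  obtain ⟨C, hC, H⟩ := exists_gfac_nrm_muvar_sq_le d hd p hp E
  obtain ⟨G, hG, HG⟩ := exists_gfac_lower_order_le d hd p hp E
  refine ⟨2 * C + 2 * (p.κ₂ * G) ^ 2, by positivity, fun J _ Q u s hQ hE => ?_⟩
  have hh := (mesh_pos (J := J) hp.L_pos).le
  obtain ⟨g0, g1, g2, g3⟩ := HG J Q u s hQ hE
  have hg := gfac_pos p Q u s
  have hκ := hp.κ₂_pos
  have hl := tLap2_nonneg (mesh p J) Q
  have h1 := H J Q u s hQ hE
  have h2 : nrm (mesh p J) (Nu p Q u s)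
      ≤ gfac p Q u s * nrm (mesh p J) (muvar p Q u) + p.κ₂ * G := by
    rw [Nu]
    refine (nrm_add_le hh _ _).trans ?_
    rw [nrm_neg hh, nrm_smul hh, nrm_smul hh, abs_of_pos hg, abs_of_pos (by positivity)]
    have h4 : gfac p Q u s * p.κ₂ * nrm (mesh p J) u ≤ p.κ₂ * G := by
      calc _ = p.κ₂ * (gfac p Q u s * nrm (mesh p J) u) := by ring
        _ ≤ _ := by gcongr
    linarith
  have h5 := pow_le_pow_left₀ (nrm_nonneg _ _) h2 2
  have h6 : 0 ≤ (p.κ₂ * G) ^ 2 * tLap2 (mesh p J) Q := by positivity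
  nlinarith [sq_nonneg (gfac p Q u s * nrm (mesh p J) (muvar p Q u) - p.κ₂ * G)]

/-- Quadratic growth in `tLap2` is what Gronwall still tolerates: one factor is the unknown and the
other is a coefficient already summable in time. -/
lemma exists_grad_NQ_sq_le (d : ℕ) (hd : d ≤ 3) (p : Params) (hp : p.Admissible d) (E : ℝ) :
    ∃ C : ℝ, 0 ≤ C ∧ ∀ (J : ℕ) [NeZero J] (Q : TGrid d J) (u : Grid d J) (s : ℝ),
      (∀ x, (Q x).IsSymm) → modE p Q u s ≤ E →
      tGrad2 (mesh p J) (NQ p Q u s)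
        ≤ C * (1 + tLap2 (mesh p J) Q ^ 2 + gradNrm (mesh p J) (lap (mesh p J) u) ^ 2) := by
  obtain ⟨C, hC, H⟩ := exists_gfac_nrm_Dp_Hvar_le d hd p hp E
  obtain ⟨G, hG, HG⟩ := exists_gfac_lower_order_le d hd p hp E
  have hκ := hp.κ₁_pos
  refine ⟨(d : ℝ) ^ 2 * (d * (3 * (C + p.κ₁ * G) ^ 2)), by positivity, fun J _ Q u s hQ hE => ?_⟩
  have hh := (mesh_pos (J := J) hp.L_pos).le
  obtain ⟨g0, g1, g2, g3⟩ := HG J Q u s hQ hE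
  have hg := gfac_pos p Q u s
  have hl := tLap2_nonneg (mesh p J) Q
  have hu3 := gradNrm_nonneg (mesh p J) (lap (mesh p J) u)
  have h1 := H J Q u s hQ hE
  set l := tLap2 (mesh p J) Q
  set u3 := gradNrm (mesh p J) (lap (mesh p J) u)
  rw [mul_assoc]
  refine sum_sum_le_of_le fun i j => ?_
  rw [gradNrm_sq]
  have h2 : ∀ k, nrm (mesh p J) (Dp (mesh p J) k (comp (NQ p Q u s) i j)) ^ 2
      ≤ 3 * (C + p.κ₁ * G) ^ 2 * (1 + l ^ 2 + u3 ^ 2) := by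
    intro k
    have h3 : nrm (mesh p J) (Dp (mesh p J) k (comp (NQ p Q u s) i j))
        ≤ (C + p.κ₁ * G) * (1 + l + u3) := by
      rw [comp_NQ, map_add, map_neg, map_smul, map_smul]
      refine (nrm_add_le hh _ _).trans ?_
      rw [nrm_neg hh, nrm_smul hh, nrm_smul hh, abs_of_pos hg, abs_of_pos (by positivity)]
      have h4 := nrm_Dp_le (mesh p J) k (comp Q i j)
      have h5 : gfac p Q u s * p.κ₁ * nrm (mesh p J) (Dp (mesh p J) k (comp Q i j)) ≤ p.κ₁ * G := by
        calc _ ≤ p.κ₁ * (gfac p Q u s * gradNrm (mesh p J) (comp Q i j)) := by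
              rw [mul_comm (gfac p Q u s), mul_assoc]; gcongr
          _ ≤ _ := by gcongr; exact g3 i j
      have h6 := h1 i j k
      have h7 : 0 ≤ p.κ₁ * G * (l + u3) := by positivity
      linarith
    have h8 := pow_le_pow_left₀ (nrm_nonneg _ _) h3 2
    refine h8.trans ?_
    rw [mul_pow, mul_comm (3 : ℝ), mul_assoc]
    gcongr
    nlinarith [sq_nonneg (l - 1), sq_nonneg (u3 - 1), sq_nonneg (l - u3)]
  refine (Finset.sum_le_sum fun k _ => h2 k).trans (le_of_eq ?_)
  simp; ring

end NonlinearScaled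

/-! ### One step of the scheme -/

section Scheme
variable {d J : ℕ} [NeZero J] {p : Params}

lemma isMult_Lop (p : Params) (g : ℝ) :
    IsMult (Lop p d J g) fun k => p.K * lam (mesh p J) k + g * p.κ₁ := by
  intro k U
  have : Lop p d J g U = -(p.K • lap (mesh p J) U) + (g * p.κ₁) • U := rfl
  rw [this, map_add, map_neg, map_smul, map_smul, ft_lap, Complex.real_smul, Complex.real_smul]
  push_cast; ring

lemma isMult_Dop (p : Params) (g : ℝ) :
    IsMult (Dop p d J g) fun k => 2 * p.B₀ * lam (mesh p J) k ^ 2 + g * p.κ₂ := by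
  intro k U
  have : Dop p d J g U = (2 * p.B₀) • lap (mesh p J) (lap (mesh p J) U) + (g * p.κ₂) • U := rfl
  rw [this, map_add, map_smul, map_smul, ft_lap, ft_lap, Complex.real_smul, Complex.real_smul]
  push_cast; ring

lemma comp_stepQ (τ : ℝ) (Q : TGrid d J) (u : Grid d J) (s : ℝ) (i j : Fin d) :
    comp (stepQ p τ Q u s) i j
      = etd (Lop p d J (gfac p Q u s)) τ (comp Q i j) (comp (NQ p Q u s) i j) := by
  ext x; simp [comp, stepQ, etd, onComp]

lemma stepU_eq (τ : ℝ) (Q : TGrid d J) (u : Grid d J) (s : ℝ) :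
    stepU p τ Q u s = etd (Dop p d J (gfac p Q u s)) τ u (Nu p Q u s) := rfl

lemma Dc_comm (h : ℝ) (i j : Fin d) (U : Grid d J) : Dc h i (Dc h j U) = Dc h j (Dc h i U) := by
  apply ft_injective
  intro k
  rw [ft_Dc, ft_Dc, ft_Dc, ft_Dc]; ring

lemma isSymm_iff_comp {Q : TGrid d J} :
    (∀ x, (Q x).IsSymm) ↔ ∀ i j, comp Q i j = comp Q j i := by
  constructor
  · intro h i j; ext x; exact (h x).apply j i
  · intro h x; exact Matrix.IsSymm.ext fun i j => congrFun (h j i) x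

lemma isSymm_NQ {Q : TGrid d J} (hQ : ∀ x, (Q x).IsSymm) (u : Grid d J) (s : ℝ) (x : Fin d → ZMod J) :
    (NQ p Q u s x).IsSymm := by
  have hh : (hess (mesh p J) u x).IsSymm := Matrix.IsSymm.ext fun i j => by
    simp only [hess, Matrix.of_apply]
    rw [Dc_comm]
  have h2 : (Q x ^ 2).IsSymm := (hQ x).pow 2
  have h1 : (1 : Matrix (Fin d) (Fin d) ℝ).IsSymm := Matrix.isSymm_one
  have hH : (Hvar p Q u x).IsSymm := by
    unfold Hvar
    exact ((((((hQ x).smul _).sub ((h2.sub (h1.smul _)).smul _))).add ((hQ x).smul _)).add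
      (((hh.smul _).sub (h1.smul _)).smul _)).add ((hQ x).smul _)
  have : NQ p Q u s x = -(gfac p Q u s • Hvar p Q u x) + (gfac p Q u s * p.κ₁) • Q x := rfl
  rw [this]
  exact (hH.smul _).neg.add ((hQ x).smul _)

/-- Symmetry is propagated because coercivity reads tr Q² as a Frobenius norm. The operators act by
the same scalar map on every component, so it survives the step. -/
lemma isSymm_stepQ {Q : TGrid d J} (hQ : ∀ x, (Q x).IsSymm) (τ : ℝ) (u : Grid d J) (s : ℝ)
    (x : Fin d → ZMod J) : (stepQ p τ Q u s x).IsSymm := by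
  revert x
  rw [isSymm_iff_comp]
  intro i j
  rw [comp_stepQ, comp_stepQ, isSymm_iff_comp.1 hQ i j, isSymm_iff_comp.1 (isSymm_NQ hQ u s) i j]

lemma quad_mul_lam {h : ℝ} (hh : 0 ≤ h) (c : ℝ) (U : Grid d J) :
    quad h (fun k => c * lam h k) U = c * gradNrm h U ^ 2 := by
  rw [gradNrm_sq_ft hh, quad, mul_left_comm, Finset.mul_sum _ _ c]; simp_rw [mul_assoc]

lemma quad_mul_lam_sq {h : ℝ} (hh : 0 ≤ h) (c : ℝ) (U : Grid d J) :
    quad h (fun k => c * lam h k ^ 2) U = c * nrm h (lap h U) ^ 2 := by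
  rw [nrm_lap_sq_ft hh, quad, mul_left_comm, Finset.mul_sum _ _ c]; simp_rw [mul_assoc]

lemma quad_mul_lam_pow_four {h : ℝ} (hh : 0 ≤ h) (c : ℝ) (U : Grid d J) :
    quad h (fun k => c * lam h k ^ 4) U = c * nrm h (lap h (lap h U)) ^ 2 := by
  rw [nrm_lap_lap_sq_ft hh, quad, mul_left_comm, Finset.mul_sum _ _ c]; simp_rw [mul_assoc]

lemma quad_one {h : ℝ} (hh : 0 ≤ h) (U : Grid d J) :
    quad h (fun _ => 1) U = nrm h U ^ 2 := by
  rw [nrm_sq_ft hh, quad]; simp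

lemma quad_lam {h : ℝ} (hh : 0 ≤ h) (U : Grid d J) : quad h (lam h) U = gradNrm h U ^ 2 := by
  rw [gradNrm_sq_ft hh, quad]

lemma gradNrm_lap_sq_le {h : ℝ} (hh : 0 ≤ h) (U : Grid d J) :
    gradNrm h (lap h U) ^ 2 ≤ nrm h (lap h U) ^ 2 + nrm h (lap h (lap h U)) ^ 2 := by
  have hw := fw_nonneg (d := d) (J := J) hh
  rw [gradNrm_lap_sq_ft hh, nrm_lap_sq_ft hh, nrm_lap_lap_sq_ft hh, ← mul_add,
    ← Finset.sum_add_distrib]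
  gcongr with k
  rw [← add_mul]
  gcongr
  nlinarith [sq_nonneg (lam h k ^ 2 - lam h k), lam_nonneg h k, pow_nonneg (lam_nonneg h k) 3]

/-- First order parabolic estimate for the tensor step. -/
lemma tGrad2_stepQ_le (hp : p.Admissible d) {τ : ℝ} (hτ : 0 < τ) (Q : TGrid d J) (u : Grid d J)
    (s : ℝ) :
    p.K * tGrad2 (mesh p J) (stepQ p τ Q u s) + τ * (p.K ^ 2 * tLap2 (mesh p J) (stepQ p τ Q u s))
      ≤ p.K * tGrad2 (mesh p J) Q + 2 * τ * tNrm (mesh p J) (NQ p Q u s) ^ 2 := by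
  have hh := (mesh_pos (J := J) hp.L_pos).le
  have hK := hp.K_pos
  rw [tNrm_sq]
  simp only [tGrad2, tLap2, Finset.mul_sum, ← Finset.sum_add_distrib]
  refine Finset.sum_le_sum fun i _ => Finset.sum_le_sum fun j _ => ?_
  have := quad_etd_le (isMult_Lop p (gfac p Q u s))
    (fun k => mul_nonneg hK.le (lam_nonneg (mesh p J) k))
    (mul_pos (gfac_pos p Q u s) hp.κ₁_pos) hτ hh (w := fun _ => 1) (fun _ => zero_le_one)
    (comp Q i j) (comp (NQ p Q u s) i j)
  rw [← comp_stepQ] at this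
  simp only [one_mul, mul_pow] at this
  rwa [quad_mul_lam hh, quad_mul_lam_sq hh, quad_mul_lam hh, quad_one hh] at this

/-- Second order parabolic estimate for the tensor step. -/
lemma tLap2_stepQ_le (hp : p.Admissible d) {τ : ℝ} (hτ : 0 < τ) (Q : TGrid d J) (u : Grid d J)
    (s : ℝ) :
    p.K * tLap2 (mesh p J) (stepQ p τ Q u s)
      ≤ p.K * tLap2 (mesh p J) Q + 2 * τ * tGrad2 (mesh p J) (NQ p Q u s) := by
  have hh := (mesh_pos (J := J) hp.L_pos).le
  have hK := hp.K_pos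
  simp only [tGrad2, tLap2, Finset.mul_sum, ← Finset.sum_add_distrib]
  refine Finset.sum_le_sum fun i _ => Finset.sum_le_sum fun j _ => ?_
  have := quad_etd_le (isMult_Lop p (gfac p Q u s))
    (fun k => mul_nonneg hK.le (lam_nonneg (mesh p J) k))
    (mul_pos (gfac_pos p Q u s) hp.κ₁_pos) hτ hh (w := lam (mesh p J)) (lam_nonneg _)
    (comp Q i j) (comp (NQ p Q u s) i j)
  rw [← comp_stepQ] at this
  have h1 : (fun k : Fin d → ZMod J => lam (mesh p J) k * (p.K * lam (mesh p J) k))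
      = fun k => p.K * lam (mesh p J) k ^ 2 := by ext k; ring
  -- The third-order smoothing term is nonnegative and is discarded.
  have h2 := quad_nonneg hh (w := fun k : Fin d → ZMod J =>
    lam (mesh p J) k * (p.K * lam (mesh p J) k) ^ 2)
    (fun k => mul_nonneg (lam_nonneg _ _) (sq_nonneg _)) (comp (stepQ p τ Q u s) i j)
  rw [h1, quad_mul_lam_sq hh, quad_mul_lam_sq hh, quad_lam hh] at this
  have h3 := mul_nonneg hτ.le h2
  linarith

/-- Parabolic estimate for the scalar step. -/
lemma nrm_lap_stepU_le (hp : p.Admissible d) {τ : ℝ} (hτ : 0 < τ) (Q : TGrid d J) (u : Grid d J)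
    (s : ℝ) :
    2 * p.B₀ * nrm (mesh p J) (lap (mesh p J) (stepU p τ Q u s)) ^ 2
      + τ * ((2 * p.B₀) ^ 2 * nrm (mesh p J) (lap (mesh p J) (lap (mesh p J) (stepU p τ Q u s))) ^ 2)
      ≤ 2 * p.B₀ * nrm (mesh p J) (lap (mesh p J) u) ^ 2
        + 2 * τ * nrm (mesh p J) (Nu p Q u s) ^ 2 := by
  have hh := (mesh_pos (J := J) hp.L_pos).le
  have hB := hp.B₀_pos
  have := quad_etd_le (isMult_Dop p (gfac p Q u s))
    (fun k => mul_nonneg (by positivity) (sq_nonneg (lam (mesh p J) k)))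
    (mul_pos (gfac_pos p Q u s) hp.κ₂_pos) hτ hh (w := fun _ => 1) (fun _ => zero_le_one)
    u (Nu p Q u s)
  rw [← stepU_eq] at this
  simp only [one_mul, mul_pow _ (_ ^ 2), ← pow_mul] at this
  rwa [quad_mul_lam_sq hh, quad_mul_lam_pow_four hh, quad_mul_lam_sq hh, quad_one hh] at this

lemma nrm_comp_stepQ_le (hp : p.Admissible d) {τ : ℝ} (hτ : 0 < τ) (Q : TGrid d J) (u : Grid d J)
    (s : ℝ) (i j : Fin d) :
    nrm (mesh p J) (comp (stepQ p τ Q u s) i j)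
      ≤ nrm (mesh p J) (comp Q i j) + τ * tNrm (mesh p J) (NQ p Q u s) := by
  rw [comp_stepQ]
  refine (nrm_etd_le (isMult_Lop p (gfac p Q u s))
    (fun k => mul_nonneg hp.K_pos.le (lam_nonneg (mesh p J) k))
    (mul_pos (gfac_pos p Q u s) hp.κ₁_pos) hτ (mesh_pos hp.L_pos).le _ _).trans ?_
  gcongr
  exact nrm_comp_le_tNrm _ _ _ _

lemma nrm_stepU_le (hp : p.Admissible d) {τ : ℝ} (hτ : 0 < τ) (Q : TGrid d J) (u : Grid d J)
    (s : ℝ) :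
    nrm (mesh p J) (stepU p τ Q u s) ≤ nrm (mesh p J) u + τ * nrm (mesh p J) (Nu p Q u s) := by
  have hB := hp.B₀_pos
  exact nrm_etd_le (isMult_Dop p (gfac p Q u s))
    (fun k => mul_nonneg (by positivity) (sq_nonneg (lam (mesh p J) k)))
    (mul_pos (gfac_pos p Q u s) hp.κ₂_pos) hτ (mesh_pos hp.L_pos).le _ _

lemma inn_smul_left (h r : ℝ) (U V : Grid d J) : inn h (r • U) V = r * inn h U V := by
  simp only [inn, Pi.smul_apply, smul_eq_mul, mul_assoc, ← Finset.mul_sum]; ring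

lemma dissip_nonneg (hp : p.Admissible d) {τ : ℝ} (hτ : 0 < τ) (Q : TGrid d J) (u : Grid d J)
    (s : ℝ) (Q' : TGrid d J) (u' : Grid d J) : 0 ≤ dissip p τ Q u s Q' u' := by
  have hh := (mesh_pos (J := J) hp.L_pos).le
  have hB := hp.B₀_pos
  refine mul_nonneg (by positivity) (add_nonneg ?_ ?_)
  · refine Finset.sum_nonneg fun i _ => Finset.sum_nonneg fun j _ => ?_
    exact inn_calQ1_nonneg (isMult_Lop p (gfac p Q u s))
      (fun k => mul_nonneg hp.K_pos.le (lam_nonneg (mesh p J) k))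
      (mul_pos (gfac_pos p Q u s) hp.κ₁_pos) hτ hh (comp (Q' - Q) i j)
  · exact inn_calQ1_nonneg (isMult_Dop p (gfac p Q u s))
      (fun k => mul_nonneg (by positivity) (sq_nonneg (lam (mesh p J) k)))
      (mul_pos (gfac_pos p Q u s) hp.κ₂_pos) hτ hh (u' - u)

/-- The discrete energy dissipation law of the unrelaxed step. -/
lemma energy_step_le (hp : p.Admissible d) {τ : ℝ} (hτ : 0 < τ) (Q : TGrid d J) (u : Grid d J)
    (s : ℝ) {Q' : TGrid d J} {u' : Grid d J} (hQ' : Q' = stepQ p τ Q u s)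
    (hu' : u' = stepU p τ Q u s) :
    modE p Q' u' (sTilde p Q u s Q' u') + dissip p τ Q u s Q' u' ≤ modE p Q u s := by
  have hh := (mesh_pos (J := J) hp.L_pos).le
  have hB := hp.B₀_pos
  have hg := gfac_pos p Q u s
  -- The force is scaled by `gfac`, so its work is exactly what `sTilde` adds to s. The energy
  -- identities of both fields then sum to the modified energy.
  have hu := inn_etd_sub (isMult_Dop p (gfac p Q u s))
    (fun k => mul_nonneg (by positivity) (sq_nonneg (lam (mesh p J) k)))
    (mul_pos (gfac_pos p Q u s) hp.κ₂_pos) hτ hh u (gfac p Q u s • muvar p Q u)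
    (U' := u') (by rw [hu', stepU_eq]; rfl)
  have hQ : ∀ i j, _ := fun i j => inn_etd_sub (isMult_Lop p (gfac p Q u s))
    (fun k => mul_nonneg hp.K_pos.le (lam_nonneg (mesh p J) k))
    (mul_pos (gfac_pos p Q u s) hp.κ₁_pos) hτ hh (comp Q i j) (gfac p Q u s • comp (Hvar p Q u) i j)
    (U' := comp Q' i j) (by rw [hQ', comp_stepQ, comp_NQ])
  simp only [quad_mul_lam hh, quad_mul_lam_sq hh, inn_smul_left] at hu hQ
  have h1 : ∀ i j, comp (Q' - Q) i j = comp Q' i j - comp Q i j := fun i j => rfl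
  have hQs : gfac p Q u s * tInn (mesh p J) (Hvar p Q u) (Q' - Q)
      ≤ -(1 / 2) * (p.K * tGrad2 (mesh p J) Q' - p.K * tGrad2 (mesh p J) Q)
        - 1 / τ * tInn (mesh p J) (onComp (calQ1 (τ • Lop p d J (gfac p Q u s))) (Q' - Q))
          (Q' - Q) := by
    simp only [tInn, tGrad2, Finset.mul_sum, ← Finset.sum_sub_distrib]
    refine Finset.sum_le_sum fun i _ => Finset.sum_le_sum fun j _ => ?_
    have h2 : comp (onComp (calQ1 (τ • Lop p d J (gfac p Q u s))) (Q' - Q)) i j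
        = calQ1 (τ • Lop p d J (gfac p Q u s)) (comp (Q' - Q) i j) := rfl
    rw [h2, h1, hQ i j]
    -- The stabilisation term gκ₁/2 times the squared increment has a favourable sign and is
    -- dropped.
    have := mul_nonneg (mul_pos hg hp.κ₁_pos).le (sq_nonneg (nrm (mesh p J) (comp Q' i j - comp Q i j)))
    linarith
  have h3 := mul_nonneg (mul_pos hg hp.κ₂_pos).le (sq_nonneg (nrm (mesh p J) (u' - u)))
  unfold modE sTilde dissip
  linarith

end Scheme

/-! ### Discrete Gronwall inequalities -/

section Gronwall

lemma telescope_le {N : ℕ} {a b c : ℕ → ℝ} (h : ∀ n < N, a (n + 1) + b (n + 1) ≤ a n + c n) :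
    ∀ m ≤ N, a m + ∑ n ∈ Finset.range m, b (n + 1) ≤ a 0 + ∑ n ∈ Finset.range m, c n := by
  intro m hm
  induction m with
  | zero => simp
  | succ m ih =>
    have h1 := ih (by omega)
    have h2 := h m (by omega)
    rw [Finset.sum_range_succ, Finset.sum_range_succ]
    linarith

lemma discrete_gronwall {N : ℕ} {y α β : ℕ → ℝ} (hy : ∀ n, 0 ≤ y n) (hα : ∀ n, 0 ≤ α n)
    (hβ : ∀ n, 0 ≤ β n) (h : ∀ n < N, y (n + 1) ≤ (1 + α n) * y n + β n) :
    ∀ m ≤ N, y m ≤ Real.exp (∑ n ∈ Finset.range m, α n) * (y 0 + ∑ n ∈ Finset.range m, β n) := by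
  intro m hm
  induction m with
  | zero => simp
  | succ m ih =>
    have h1 := ih (by omega)
    have h2 := h m (by omega)
    rw [Finset.sum_range_succ, Finset.sum_range_succ, Real.exp_add]
    have h3 : 1 + α m ≤ Real.exp (α m) := by linarith [Real.add_one_le_exp (α m)]
    have h4 : 1 ≤ Real.exp (∑ n ∈ Finset.range m, α n) :=
      Real.one_le_exp (Finset.sum_nonneg fun n _ => hα n)
    have h5 : 1 ≤ Real.exp (α m) := Real.one_le_exp (hα m)
    have h6 : 1 ≤ Real.exp (∑ n ∈ Finset.range m, α n) * Real.exp (α m) := by nlinarith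
    calc y (m + 1) ≤ Real.exp (α m) * y m + β m := h2.trans (by gcongr; exact hy m)
      _ ≤ Real.exp (α m) * (Real.exp (∑ n ∈ Finset.range m, α n)
          * (y 0 + ∑ n ∈ Finset.range m, β n))
          + (Real.exp (∑ n ∈ Finset.range m, α n) * Real.exp (α m)) * β m := by
          gcongr
          exact le_mul_of_one_le_left (hβ m) h6
      _ = _ := by ring

/-- Smoothing is gained at the new time level while the nonlinearity is evaluated at the old one.
The mismatch is a single term τ·f(0), harmless since τ ≤ T as soon as one step is taken. -/
lemma sum_range_le_of_shift {f : ℕ → ℝ} {τ T : ℝ} (hτ : 0 < τ) (hT : 0 ≤ T) (hf : ∀ n, 0 ≤ f n)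
    {m : ℕ} (hm : m * τ ≤ T) :
    ∑ n ∈ Finset.range m, τ * f n ≤ T * f 0 + ∑ n ∈ Finset.range m, τ * f (n + 1) := by
  rcases Nat.eq_zero_or_pos m with h0 | h0
  · subst h0; simpa using mul_nonneg hT (hf 0)
  · have h1 : τ ≤ T := by
      have : (1 : ℝ) ≤ m := by exact_mod_cast h0
      nlinarith
    have h2 := Finset.sum_range_succ' (fun n => τ * f n) m
    rw [Finset.sum_range_succ] at h2
    have h3 := mul_nonneg hτ.le (hf m)
    have h4 := mul_le_mul_of_nonneg_right h1 (hf 0)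
    linarith

end Gronwall

/-! ### Regularity of solutions with bounded modified energy -/

/-- A run of the two field updates over `[0, T]` with controlled initial data along which the
modified energy stays below `E`. -/
structure BoundedRun (p : Params) {d J : ℕ} [NeZero J] (T R E τ : ℝ) (N : ℕ)
    (Q : ℕ → TGrid d J) (u : ℕ → Grid d J) (s : ℕ → ℝ) : Prop where
  τ_pos : 0 < τ
  time_le : N * τ ≤ T
  symm_init : ∀ x, (Q 0 x).IsSymm
  step_Q : ∀ n < N, Q (n + 1) = stepQ p τ (Q n) (u n) (s n)
  step_u : ∀ n < N, u (n + 1) = stepU p τ (Q n) (u n) (s n)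
  energy_le : ∀ n ≤ N, modE p (Q n) (u n) (s n) ≤ E
  init_Q : tH2Nrm (mesh p J) (Q 0) ≤ R
  init_u : h4Nrm (mesh p J) (u 0) ≤ R

section Regularity

lemma tH2Nrm_sq {d J : ℕ} [NeZero J] (h : ℝ) (Q : TGrid d J) :
    tH2Nrm h Q ^ 2 = tNrm h Q ^ 2 + tGrad2 h Q + tLap2 h Q := by
  have h1 := tGrad2_nonneg h Q
  have h2 := tLap2_nonneg h Q
  have h3 := sq_nonneg (tNrm h Q)
  have : tH2Nrm h Q = √(tNrm h Q ^ 2 + tGrad2 h Q + tLap2 h Q) := rfl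
  rw [this, Real.sq_sqrt (by positivity)]

lemma h4Nrm_sq {d J : ℕ} [NeZero J] (h : ℝ) (U : Grid d J) :
    h4Nrm h U ^ 2 = nrm h U ^ 2 + gradNrm h U ^ 2 + nrm h (lap h U) ^ 2
    + gradNrm h (lap h U) ^ 2 + nrm h (lap h (lap h U)) ^ 2 := by
  rw [h4Nrm, Real.sq_sqrt (by positivity)]

namespace BoundedRun

variable {p : Params} {d J : ℕ} [NeZero J] {T R E τ : ℝ} {N : ℕ}
  {Q : ℕ → TGrid d J} {u : ℕ → Grid d J} {s : ℕ → ℝ}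

lemma isSymm (H : BoundedRun p T R E τ N Q u s) : ∀ n ≤ N, ∀ x, (Q n x).IsSymm := by
  intro n hn
  induction n with
  | zero => exact H.symm_init
  | succ n ih =>
    rw [H.step_Q n (by omega)]
    exact isSymm_stepQ (ih (by omega)) _ _ _

lemma partial_time_le (H : BoundedRun p T R E τ N Q u s) {m : ℕ} (hm : m ≤ N) : m * τ ≤ T := by
  have : (m : ℝ) ≤ N := by exact_mod_cast hm
  exact (mul_le_mul_of_nonneg_right this H.τ_pos.le).trans H.time_le

lemma init_Q_sq (H : BoundedRun p T R E τ N Q u s) :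
    tNrm (mesh p J) (Q 0) ^ 2 + tGrad2 (mesh p J) (Q 0) + tLap2 (mesh p J) (Q 0) ≤ R ^ 2 := by
  rw [← tH2Nrm_sq]
  exact pow_le_pow_left₀ (Real.sqrt_nonneg _) H.init_Q 2

lemma init_u_sq (H : BoundedRun p T R E τ N Q u s) :
    nrm (mesh p J) (u 0) ^ 2 + gradNrm (mesh p J) (u 0) ^ 2 + nrm (mesh p J) (lap (mesh p J) (u 0)) ^ 2
    + gradNrm (mesh p J) (lap (mesh p J) (u 0)) ^ 2
    + nrm (mesh p J) (lap (mesh p J) (lap (mesh p J) (u 0))) ^ 2 ≤ R ^ 2 := by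
  rw [← h4Nrm_sq]
  exact pow_le_pow_left₀ (Real.sqrt_nonneg _) H.init_u 2

end BoundedRun

variable (d : ℕ) (hd : d ≤ 3) (p : Params) (hp : p.Admissible d) (T R E : ℝ) (hT : 0 ≤ T)
include hd hp hT

/-- With δ = K²/4 the forcing costs (K²/2)τl at the old level against a gain of K²τl at the new one.
After the index shift half of the gain remains, with no restriction on the step size. -/
lemma exists_sum_tLap2_le : ∃ C : ℝ, 0 ≤ C ∧ ∀ (J : ℕ) [NeZero J] (τ : ℝ) (N : ℕ)
    (Q : ℕ → TGrid d J) (u : ℕ → Grid d J) (s : ℕ → ℝ), BoundedRun p T R E τ N Q u s →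
    ∀ m ≤ N, ∑ n ∈ Finset.range m, τ * tLap2 (mesh p J) (Q n) ≤ C := by
  have hK := hp.K_pos
  obtain ⟨C, hC, HN⟩ := exists_tNrm_NQ_sq_le d hd p hp E (δ := p.K ^ 2 / 4) (by positivity)
  refine ⟨T * R ^ 2 + (2 / p.K ^ 2) * (p.K * R ^ 2 + p.K ^ 2 / 2 * (T * R ^ 2) + 2 * C * T),
    by positivity, fun J _ τ N Q u s H m hm => ?_⟩
  have hτ := H.τ_pos
  have hl : ∀ n, 0 ≤ tLap2 (mesh p J) (Q n) := fun n => tLap2_nonneg _ _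
  have hG : ∀ n, 0 ≤ tGrad2 (mesh p J) (Q n) := fun n => tGrad2_nonneg _ _
  have h0 := H.init_Q_sq
  have hl0 : tLap2 (mesh p J) (Q 0) ≤ R ^ 2 := by nlinarith [hG 0, sq_nonneg (tNrm (mesh p J) (Q 0))]
  have hG0 : tGrad2 (mesh p J) (Q 0) ≤ R ^ 2 := by
    nlinarith [hl 0, sq_nonneg (tNrm (mesh p J) (Q 0))]
  have hmT := H.partial_time_le hm
  have hshift := sum_range_le_of_shift hτ hT hl hmT
  have htel := telescope_le (N := N) (a := fun n => p.K * tGrad2 (mesh p J) (Q n))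
    (b := fun n => p.K ^ 2 * (τ * tLap2 (mesh p J) (Q n)))
    (c := fun n => 2 * C * τ + p.K ^ 2 / 2 * (τ * tLap2 (mesh p J) (Q n))) (fun n hn => by
      have h1 := tGrad2_stepQ_le hp hτ (Q n) (u n) (s n)
      rw [← H.step_Q n hn] at h1
      have h2 := HN J (Q n) (u n) (s n) (H.isSymm n hn.le) (H.energy_le n hn.le)
      have h3 := mul_le_mul_of_nonneg_left h2 (by positivity : 0 ≤ 2 * τ)
      linarith) m hm
  simp only [Finset.sum_add_distrib, ← Finset.mul_sum (a := p.K ^ 2),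
    ← Finset.mul_sum (a := p.K ^ 2 / 2), Finset.sum_const, Finset.card_range, nsmul_eq_mul] at htel
  set S := ∑ n ∈ Finset.range m, τ * tLap2 (mesh p J) (Q n)
  set S' := ∑ n ∈ Finset.range m, τ * tLap2 (mesh p J) (Q (n + 1))
  have e1 : T * tLap2 (mesh p J) (Q 0) ≤ T * R ^ 2 := by gcongr
  have e2 : (m : ℝ) * (2 * C * τ) ≤ 2 * C * T := by
    calc _ = 2 * C * (m * τ) := by ring
      _ ≤ _ := by gcongr
  have e3 : 0 ≤ p.K * tGrad2 (mesh p J) (Q m) := mul_nonneg hK.le (hG m)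
  have e4 : p.K * tGrad2 (mesh p J) (Q 0) ≤ p.K * R ^ 2 := by gcongr
  -- The absorption: the old-level sum is replaced by the new-level sum plus the initial
  -- contribution.
  have e5 : p.K ^ 2 / 2 * S ≤ p.K ^ 2 / 2 * (T * R ^ 2 + S') := by gcongr; linarith
  have e6 : p.K ^ 2 / 2 * S' ≤ p.K * R ^ 2 + p.K ^ 2 / 2 * (T * R ^ 2) + 2 * C * T := by linarith
  have e7 : S' ≤ (2 / p.K ^ 2) * (p.K * R ^ 2 + p.K ^ 2 / 2 * (T * R ^ 2) + 2 * C * T) := by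
    calc S' = (2 / p.K ^ 2) * (p.K ^ 2 / 2 * S') := by field_simp
      _ ≤ _ := by gcongr
  linarith

/-- The source in the scalar equation is now summable in time. The smoothing term controls the sum
of ‖Δ²u‖², and third differences follow by interpolating between ‖Δu‖ and ‖Δ²u‖. -/
lemma exists_lap_u_le : ∃ C : ℝ, 0 ≤ C ∧ ∀ (J : ℕ) [NeZero J] (τ : ℝ) (N : ℕ)
    (Q : ℕ → TGrid d J) (u : ℕ → Grid d J) (s : ℕ → ℝ), BoundedRun p T R E τ N Q u s →
    ∀ m ≤ N, nrm (mesh p J) (lap (mesh p J) (u m)) ^ 2 ≤ C ∧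
      ∑ n ∈ Finset.range m, τ * gradNrm (mesh p J) (lap (mesh p J) (u n)) ^ 2 ≤ C := by
  have hB := hp.B₀_pos
  obtain ⟨C, hC, HN⟩ := exists_nrm_Nu_sq_le d hd p hp E
  obtain ⟨S, hS, HS⟩ := exists_sum_tLap2_le d hd p hp T R E hT
  set M := 2 * p.B₀ * R ^ 2 + 2 * C * (T + S) with hM
  have hM0 : 0 ≤ M := by positivity
  refine ⟨M / (2 * p.B₀) + (T * R ^ 2 + (T * (M / (2 * p.B₀)) + M / (2 * p.B₀) ^ 2)),
    by positivity, fun J _ τ N Q u s H => ?_⟩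
  have hτ := H.τ_pos
  have h0 := H.init_u_sq
  set w := fun n => nrm (mesh p J) (lap (mesh p J) (u n)) ^ 2 with hw
  set w3 := fun n => gradNrm (mesh p J) (lap (mesh p J) (u n)) ^ 2 with hw3
  set w4 := fun n => nrm (mesh p J) (lap (mesh p J) (lap (mesh p J) (u n))) ^ 2 with hw4
  have hw0 : ∀ n, 0 ≤ w n := fun n => sq_nonneg _
  have hw30 : ∀ n, 0 ≤ w3 n := fun n => sq_nonneg _
  have hw40 : ∀ n, 0 ≤ w4 n := fun n => sq_nonneg _
  have hh := (mesh_pos (J := J) hp.L_pos).le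
  have hw34 : ∀ n, w3 n ≤ w n + w4 n := fun n => gradNrm_lap_sq_le hh (u n)
  have h1 : w 0 ≤ R ^ 2 := by
    simp only [hw]
    nlinarith [sq_nonneg (nrm (mesh p J) (u 0)), sq_nonneg (gradNrm (mesh p J) (u 0)), hw30 0, hw40 0]
  have h3 : w3 0 ≤ R ^ 2 := by
    simp only [hw3]
    nlinarith [sq_nonneg (nrm (mesh p J) (u 0)), sq_nonneg (gradNrm (mesh p J) (u 0)), hw0 0, hw40 0]
  have htel := telescope_le (N := N) (a := fun n => 2 * p.B₀ * w n)
    (b := fun n => (2 * p.B₀) ^ 2 * (τ * w4 n))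
    (c := fun n => 2 * C * (τ + τ * tLap2 (mesh p J) (Q n))) (fun n hn => by
      have h1 := nrm_lap_stepU_le hp hτ (Q n) (u n) (s n)
      rw [← H.step_u n hn] at h1
      have h2 := HN J (Q n) (u n) (s n) (H.isSymm n hn.le) (H.energy_le n hn.le)
      have h3 := mul_le_mul_of_nonneg_left h2 (by positivity : 0 ≤ 2 * τ)
      simp only [hw, hw4]
      linarith)
  have hbound : ∀ m ≤ N, 2 * p.B₀ * w m + (2 * p.B₀) ^ 2 * ∑ n ∈ Finset.range m, τ * w4 (n + 1)
      ≤ M := by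
    intro m hm
    have h4 := htel m hm
    simp only [← Finset.mul_sum (a := (2 * p.B₀) ^ 2), ← Finset.mul_sum (a := 2 * C),
      Finset.sum_add_distrib, Finset.sum_const, Finset.card_range, nsmul_eq_mul] at h4
    have h5 := HS J τ N Q u s H m hm
    have h6 := H.partial_time_le hm
    have h7 : 2 * p.B₀ * w 0 ≤ 2 * p.B₀ * R ^ 2 := by gcongr
    have h8 : 2 * C * (m * τ + ∑ n ∈ Finset.range m, τ * tLap2 (mesh p J) (Q n))
        ≤ 2 * C * (T + S) := by gcongr
    linarith
  have hsum0 : ∀ m, 0 ≤ ∑ n ∈ Finset.range m, τ * w4 (n + 1) := fun m =>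
    Finset.sum_nonneg fun n _ => mul_nonneg hτ.le (hw40 _)
  have hwm : ∀ m ≤ N, w m ≤ M / (2 * p.B₀) := by
    intro m hm
    rw [le_div_iff₀ (by positivity)]
    have := hbound m hm
    have := mul_nonneg (sq_nonneg (2 * p.B₀)) (hsum0 m)
    linarith
  intro m hm
  have hMB : 0 ≤ M / (2 * p.B₀) := by positivity
  have hMB2 : 0 ≤ M / (2 * p.B₀) ^ 2 := by positivity
  constructor
  · have := hwm m hm
    have : 0 ≤ T * R ^ 2 + (T * (M / (2 * p.B₀)) + M / (2 * p.B₀) ^ 2) := by positivity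
    simp only [hw] at *
    linarith
  · have hmT := H.partial_time_le hm
    -- Third differences are gained only from level 1 on; the initial norm of u supplies level 0.
    have hshift := sum_range_le_of_shift hτ hT hw30 hmT
    have h5 : ∑ n ∈ Finset.range m, τ * w3 (n + 1)
        ≤ ∑ n ∈ Finset.range m, (τ * (M / (2 * p.B₀)) + τ * w4 (n + 1)) := by
      refine Finset.sum_le_sum fun n hn => ?_
      rw [← mul_add]
      have := Finset.mem_range.1 hn
      have h6 := hwm (n + 1) (by omega)
      have h7 := hw34 (n + 1)
      gcongr; linarith
    have h6 : ∑ n ∈ Finset.range m, τ * w4 (n + 1) ≤ M / (2 * p.B₀) ^ 2 := by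
      rw [le_div_iff₀ (by positivity)]
      have h8 := hbound m hm
      have h9 : 0 ≤ 2 * p.B₀ * w m := mul_nonneg (by positivity) (hw0 m)
      linarith
    rw [Finset.sum_add_distrib, Finset.sum_const, Finset.card_range, nsmul_eq_mul, ← mul_assoc] at h5
    have h7 : m * τ * (M / (2 * p.B₀)) ≤ T * (M / (2 * p.B₀)) := by gcongr
    have h8 : T * w3 0 ≤ T * R ^ 2 := by gcongr
    simp only [hw3] at *
    linarith

/-- Gronwall with coefficient proportional to τ·`tLap2` and source proportional to τ(1 + ‖∇Δu‖²),
both summable by the two preceding lemmas. -/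
lemma exists_tLap2_le : ∃ C : ℝ, 0 ≤ C ∧ ∀ (J : ℕ) [NeZero J] (τ : ℝ) (N : ℕ)
    (Q : ℕ → TGrid d J) (u : ℕ → Grid d J) (s : ℕ → ℝ), BoundedRun p T R E τ N Q u s →
    ∀ m ≤ N, tLap2 (mesh p J) (Q m) ≤ C := by
  have hK := hp.K_pos
  obtain ⟨C, hC, HN⟩ := exists_grad_NQ_sq_le d hd p hp E
  obtain ⟨S, hS, HS⟩ := exists_sum_tLap2_le d hd p hp T R E hT
  obtain ⟨W, hW, HW⟩ := exists_lap_u_le d hd p hp T R E hT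
  refine ⟨Real.exp (2 * C / p.K * S) * (R ^ 2 + 2 * C / p.K * (T + W)), by positivity,
    fun J _ τ N Q u s H m hm => ?_⟩
  have hτ := H.τ_pos
  have hl : ∀ n, 0 ≤ tLap2 (mesh p J) (Q n) := fun n => tLap2_nonneg _ _
  have hc : 0 ≤ 2 * C / p.K := by positivity
  have h0 := H.init_Q_sq
  have hl0 : tLap2 (mesh p J) (Q 0) ≤ R ^ 2 := by
    nlinarith [tGrad2_nonneg (mesh p J) (Q 0), sq_nonneg (tNrm (mesh p J) (Q 0))]
  have hgr := discrete_gronwall (N := N) (y := fun n => tLap2 (mesh p J) (Q n))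
    (α := fun n => 2 * C / p.K * (τ * tLap2 (mesh p J) (Q n)))
    (β := fun n => 2 * C / p.K * (τ + τ * gradNrm (mesh p J) (lap (mesh p J) (u n)) ^ 2)) hl
    (fun n => mul_nonneg hc (mul_nonneg hτ.le (hl n))) (fun n => by positivity) (fun n hn => by
      have h1 := tLap2_stepQ_le hp hτ (Q n) (u n) (s n)
      rw [← H.step_Q n hn] at h1
      have h2 := HN J (Q n) (u n) (s n) (H.isSymm n hn.le) (H.energy_le n hn.le)
      have h3 := mul_le_mul_of_nonneg_left h2 (by positivity : 0 ≤ 2 * τ)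
      have h4 := h1.trans (add_le_add_right h3 _)
      rw [mul_comm, ← le_div_iff₀ hK] at h4
      refine h4.trans (le_of_eq ?_)
      field_simp; ring) m hm
  refine hgr.trans ?_
  simp only [← Finset.mul_sum (a := 2 * C / p.K), Finset.sum_add_distrib, Finset.sum_const,
    Finset.card_range, nsmul_eq_mul]
  have h5 := HS J τ N Q u s H m hm
  have h6 := (HW J τ N Q u s H m hm).2
  have h7 := H.partial_time_le hm
  have h8 : 0 ≤ ∑ n ∈ Finset.range m, τ * gradNrm (mesh p J) (lap (mesh p J) (u n)) ^ 2 :=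
    Finset.sum_nonneg fun n _ => by positivity
  have h9 := hl 0
  have h10 : 0 ≤ (m : ℝ) * τ := by positivity
  gcongr

/-- Uniform bounds along runs with bounded modified energy. -/
lemma exists_run_bounds : ∃ C : ℝ, 0 ≤ C ∧ ∀ (J : ℕ) [NeZero J] (τ : ℝ) (N : ℕ)
    (Q : ℕ → TGrid d J) (u : ℕ → Grid d J) (s : ℕ → ℝ), BoundedRun p T R E τ N Q u s →
    ∀ m ≤ N, tLap2 (mesh p J) (Q m) ≤ C ∧ nrm (mesh p J) (lap (mesh p J) (u m)) ≤ C ∧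
      tNrm (mesh p J) (NQ p (Q m) (u m) (s m)) ≤ C ∧
      nrm (mesh p J) (Nu p (Q m) (u m) (s m)) ≤ C ∧
      (∀ i j, nrm (mesh p J) (comp (Q m) i j) ≤ C) ∧ nrm (mesh p J) (u m) ≤ C := by
  obtain ⟨A, hA, HA⟩ := exists_tLap2_le d hd p hp T R E hT
  obtain ⟨W, hW, HW⟩ := exists_lap_u_le d hd p hp T R E hT
  obtain ⟨C₁, hC₁, H₁⟩ := exists_tNrm_NQ_sq_le d hd p hp E one_pos
  obtain ⟨C₂, hC₂, H₂⟩ := exists_nrm_Nu_sq_le d hd p hp E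
  set D := A + (W + 1) + (C₁ + A + 1) + (C₂ * (1 + A) + 1) with hD
  have hD0 : 0 ≤ D := by positivity
  refine ⟨D + |R| + T * D, by positivity, fun J _ τ N Q u s H => ?_⟩
  have hτ := H.τ_pos
  have hle1 : ∀ {x y : ℝ}, 0 ≤ x → x ^ 2 ≤ y → x ≤ y + 1 := fun {x y} _ h => by
    nlinarith [sq_nonneg (x - 1)]
  have hCA : 0 ≤ C₂ * (1 + A) := by positivity
  have hNQ : ∀ n ≤ N, tNrm (mesh p J) (NQ p (Q n) (u n) (s n)) ≤ D := fun n hn => by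
    have h1 := H₁ J (Q n) (u n) (s n) (H.isSymm n hn) (H.energy_le n hn)
    have h2 := HA J τ N Q u s H n hn
    have := hle1 (tNrm_nonneg _ _) (h1.trans (by linarith : _ ≤ C₁ + A))
    linarith
  have hNu : ∀ n ≤ N, nrm (mesh p J) (Nu p (Q n) (u n) (s n)) ≤ D := fun n hn => by
    have h1 := H₂ J (Q n) (u n) (s n) (H.isSymm n hn) (H.energy_le n hn)
    have h2 := HA J τ N Q u s H n hn
    have h3 : C₂ * (1 + tLap2 (mesh p J) (Q n)) ≤ C₂ * (1 + A) := by gcongr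
    have := hle1 (nrm_nonneg _ _) (h1.trans h3)
    linarith
  have hR : 0 ≤ |R| := abs_nonneg R
  have hTD : 0 ≤ T * D := by positivity
  intro m hm
  have hmT := H.partial_time_le hm
  have hmD : (m : ℝ) * (τ * D) ≤ T * D := by rw [← mul_assoc]; gcongr
  refine ⟨?_, ?_, ?_, ?_, fun i j => ?_, ?_⟩
  · have := HA J τ N Q u s H m hm; linarith
  · have := hle1 (nrm_nonneg _ _) (HW J τ N Q u s H m hm).1; linarith
  · have := hNQ m hm; linarith
  · have := hNu m hm; linarith
  -- The propagator is an L² contraction, so the norm grows by at most τD per step, hence by TD in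
  -- total.
  · have htel := telescope_le (N := N) (a := fun n => nrm (mesh p J) (comp (Q n) i j))
      (b := fun _ => 0) (c := fun _ => τ * D) (fun n hn => by
        have h1 := nrm_comp_stepQ_le hp hτ (Q n) (u n) (s n) i j
        rw [← H.step_Q n hn] at h1
        have h2 := mul_le_mul_of_nonneg_left (hNQ n hn.le) hτ.le
        linarith) m hm
    simp only [Finset.sum_const, Finset.card_range, nsmul_eq_mul, mul_zero, add_zero] at htel
    have h0 : nrm (mesh p J) (comp (Q 0) i j) ≤ |R| := by
      refine (nrm_comp_le_tNrm _ _ _ _).trans ((le_abs_self _).trans (abs_le_of_sq_le_sq ?_ hR))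
      rw [sq_abs]
      nlinarith [H.init_Q_sq, tGrad2_nonneg (mesh p J) (Q 0), tLap2_nonneg (mesh p J) (Q 0)]
    linarith
  · have htel := telescope_le (N := N) (a := fun n => nrm (mesh p J) (u n))
      (b := fun _ => 0) (c := fun _ => τ * D) (fun n hn => by
        have h1 := nrm_stepU_le hp hτ (Q n) (u n) (s n)
        rw [← H.step_u n hn] at h1
        have h2 := mul_le_mul_of_nonneg_left (hNu n hn.le) hτ.le
        linarith) m hm
    simp only [Finset.sum_const, Finset.card_range, nsmul_eq_mul, mul_zero, add_zero] at htel
    have h0 : nrm (mesh p J) (u 0) ≤ |R| := by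
      refine (le_abs_self _).trans (abs_le_of_sq_le_sq ?_ hR)
      rw [sq_abs]
      nlinarith [H.init_u_sq, sq_nonneg (gradNrm (mesh p J) (u 0)),
        sq_nonneg (nrm (mesh p J) (lap (mesh p J) (u 0))),
        sq_nonneg (gradNrm (mesh p J) (lap (mesh p J) (u 0))),
        sq_nonneg (nrm (mesh p J) (lap (mesh p J) (lap (mesh p J) (u 0))))]
    linarith

end Regularity

/-! ### Boundedness of the modified energy -/

section EnergyBound

lemma fs_le_of_abs_le (p : Params) {y v : ℝ} (hy : |y| ≤ v) :
    fs p y ≤ |p.a| / 2 * v ^ 2 + |p.b| / 3 * v ^ 3 + |p.c| / 4 * v ^ 4 := by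
  have key : ∀ (r : ℝ) (n : ℕ), r * y ^ n ≤ |r| * v ^ n := fun r n => by
    refine (le_abs_self _).trans ?_
    rw [abs_mul, abs_pow]
    gcongr
  have h1 := key (p.a / 2) 2
  have h2 := key (p.b / 3) 3
  have h3 := key (p.c / 4) 4
  rw [abs_div, abs_of_pos (by norm_num : (0 : ℝ) < 2)] at h1
  rw [abs_div, abs_of_pos (by norm_num : (0 : ℝ) < 3)] at h2
  rw [abs_div, abs_of_pos (by norm_num : (0 : ℝ) < 4)] at h3
  rw [fs]; linarith

lemma fbn_le_of_fro_le (p : Params) {d : ℕ} {X : Matrix (Fin d) (Fin d) ℝ} (hX : X.IsSymm) {F : ℝ}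
    (hF : fro X ≤ F) : fbn p X ≤ |p.A| / 2 * F + |p.B| / 3 * √F ^ 3 + |p.C| / 4 * F ^ 2 := by
  have h0 := fro_nonneg X
  have h1 : p.A / 2 * fro X ≤ |p.A| / 2 * F := by
    have := le_abs_self p.A
    gcongr
  have h2 : p.C / 4 * fro X ^ 2 ≤ |p.C| / 4 * F ^ 2 := by
    have := le_abs_self p.C
    gcongr
  have h3 : -(if d = 3 then p.B / 3 * (X ^ 3).trace else 0) ≤ |p.B| / 3 * √F ^ 3 := by
    split_ifs
    · refine (neg_le_abs _).trans ?_
      rw [abs_mul, abs_div, abs_of_pos (three_pos : (0 : ℝ) < 3)]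
      have := (abs_trace_cube_le X).trans (pow_le_pow_left₀ (Real.sqrt_nonneg _)
        (Real.sqrt_le_sqrt hF) 3)
      gcongr
    · rw [neg_zero]; positivity
  rw [fbn, trace_sq_of_isSymm hX]
  linarith

/-- The initial norms bound both fields pointwise through the Sobolev inequality, hence E₁ from
above; s lies within S₀ of E₁. -/
lemma exists_initial_energy_le (d : ℕ) (hd : d ≤ 3) (p : Params) (hp : p.Admissible d) (R S₀ : ℝ) :
    ∃ E : ℝ, ∀ (J : ℕ) [NeZero J] (Q : TGrid d J) (u : Grid d J) (s : ℝ), (∀ x, (Q x).IsSymm) →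
      tH2Nrm (mesh p J) Q ≤ R → h4Nrm (mesh p J) u ≤ R → |s - E1 p Q u| ≤ S₀ →
      modE p Q u s ≤ E := by
  have hL := hp.L_pos
  have hB := hp.B₀_pos
  have hK := hp.K_pos
  obtain ⟨S, hS, HS⟩ := exists_sup_le d hd p.L hL one_pos
  set V := (1 + S) * R ^ 2 with hV
  set F := (d : ℝ) ^ 2 * V with hF
  set m := ((1 / sPlus p d) ^ 2 + 1) * (p.L ^ d * F ^ 2 + p.L ^ d * V ^ 2 + p.L ^ d) with hm
  refine ⟨p.K / 2 * R ^ 2 + p.B₀ * R ^ 2 + (2 * p.B₀ * p.q ^ 2 * ((R ^ 2 + m) / 2)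
    + p.B₀ * p.q ^ 4 * m
    + p.L ^ d * (|p.A| / 2 * F + |p.B| / 3 * √F ^ 3 + |p.C| / 4 * F ^ 2)
    + p.L ^ d * (|p.a| / 2 * √V ^ 2 + |p.b| / 3 * √V ^ 3 + |p.c| / 4 * √V ^ 4)) + S₀,
    fun J _ Q u s hQ hQR huR hs => ?_⟩
  have hh := mesh_pos (J := J) hL
  have hQ2 : tH2Nrm (mesh p J) Q ^ 2 ≤ R ^ 2 := pow_le_pow_left₀ (Real.sqrt_nonneg _) hQR 2
  have hu2 : h4Nrm (mesh p J) u ^ 2 ≤ R ^ 2 := pow_le_pow_left₀ (Real.sqrt_nonneg _) huR 2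
  rw [tH2Nrm_sq] at hQ2
  rw [h4Nrm_sq] at hu2
  have n1 := tGrad2_nonneg (mesh p J) Q
  have n2 := tLap2_nonneg (mesh p J) Q
  have n3 := sq_nonneg (tNrm (mesh p J) Q)
  have n4 := sq_nonneg (nrm (mesh p J) u)
  have n5 := sq_nonneg (gradNrm (mesh p J) u)
  have n6 := sq_nonneg (nrm (mesh p J) (lap (mesh p J) u))
  have n7 := sq_nonneg (gradNrm (mesh p J) (lap (mesh p J) u))
  have n8 := sq_nonneg (nrm (mesh p J) (lap (mesh p J) (lap (mesh p J) u)))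
  have hw : nrm (mesh p J) (lap (mesh p J) u) ^ 2 ≤ R ^ 2 := by linarith
  have hG : tGrad2 (mesh p J) Q ≤ R ^ 2 := by linarith
  have hV0 : 0 ≤ V := by positivity
  have huV : ‖u‖ ^ 2 ≤ V := by
    refine (HS J (mesh p J) hh mesh_mul u).trans ?_
    have : S * nrm (mesh p J) u ^ 2 ≤ S * R ^ 2 :=
      mul_le_mul_of_nonneg_left (by linarith) hS.le
    rw [hV]; linarith
  have hQV : ∀ i j, ‖comp Q i j‖ ^ 2 ≤ V := fun i j => by
    refine (HS J (mesh p J) hh mesh_mul (comp Q i j)).trans ?_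
    have h1 := nrm_lap_comp_sq_le (mesh p J) Q i j
    have h2 := pow_le_pow_left₀ (nrm_nonneg _ _) (nrm_comp_le_tNrm (mesh p J) Q i j) 2
    have : S * nrm (mesh p J) (comp Q i j) ^ 2 ≤ S * R ^ 2 :=
      mul_le_mul_of_nonneg_left (by linarith) hS.le
    rw [hV]; linarith
  have hux : ∀ x, |u x| ≤ √V := fun x => (abs_apply_le u x).trans (Real.le_sqrt_of_sq_le huV)
  have hfro : ∀ x, fro (Q x) ≤ F := fun x => sum_sum_le_of_le fun i j => by
    refine le_trans ?_ (hQV i j)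
    rw [← sq_abs]
    exact pow_le_pow_left₀ (abs_nonneg _) (abs_apply_le (comp Q i j) x) 2
  have hu4 : ∀ x, u x ^ 4 ≤ V ^ 2 := fun x => by
    have : u x ^ 2 ≤ V := by
      rw [← sq_abs, ← Real.sq_sqrt hV0]
      exact pow_le_pow_left₀ (abs_nonneg _) (hux x) 2
    calc u x ^ 4 = (u x ^ 2) ^ 2 := by ring
      _ ≤ _ := by gcongr
  have hF4 : tFour (mesh p J) Q ≤ p.L ^ d * F ^ 2 := by
    rw [tFour, ← mesh_pow_sum_const (p := p) (J := J)]
    gcongr with x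
    · exact fro_nonneg _
    · exact hfro x
  have hV4 : four (mesh p J) u ≤ p.L ^ d * V ^ 2 := by
    rw [four, ← mesh_pow_sum_const (p := p) (J := J)]
    gcongr with x; exact hu4 x
  have hM : tNrm (mesh p J) (Mu p Q u) ^ 2 ≤ m := by
    refine (tNrm_Mu_sq_le hL Q u).trans ?_
    rw [hm]; gcongr
  have hH : tNrm (mesh p J) (hess (mesh p J) u) ^ 2 ≤ R ^ 2 := by
    rw [tNrm_sq]; exact (sum_nrm_hess_le hh.le u).trans hw
  have hT : tInn (mesh p J) (hess (mesh p J) u) (Mu p Q u) ≤ (R ^ 2 + m) / 2 := by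
    have h1 := (le_abs_self _).trans (abs_tInn_le hh.le (hess (mesh p J) u) (Mu p Q u))
    nlinarith [sq_nonneg (tNrm (mesh p J) (hess (mesh p J) u) - tNrm (mesh p J) (Mu p Q u))]
  have hb : inn (mesh p J) (fun x => fbn p (Q x)) 1
      ≤ p.L ^ d * (|p.A| / 2 * F + |p.B| / 3 * √F ^ 3 + |p.C| / 4 * F ^ 2) := by
    rw [inn, ← mesh_pow_sum_const (p := p) (J := J)]
    gcongr with x
    simpa using fbn_le_of_fro_le p (hQ x) (hfro x)
  have hf : inn (mesh p J) (fun x => fs p (u x)) 1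
      ≤ p.L ^ d * (|p.a| / 2 * √V ^ 2 + |p.b| / 3 * √V ^ 3 + |p.c| / 4 * √V ^ 4) := by
    rw [inn, ← mesh_pow_sum_const (p := p) (J := J)]
    gcongr with x
    simpa using fs_le_of_abs_le p (hux x)
  have hE1 : E1 p Q u ≤ 2 * p.B₀ * p.q ^ 2 * ((R ^ 2 + m) / 2) + p.B₀ * p.q ^ 4 * m
    + p.L ^ d * (|p.A| / 2 * F + |p.B| / 3 * √F ^ 3 + |p.C| / 4 * F ^ 2)
    + p.L ^ d * (|p.a| / 2 * √V ^ 2 + |p.b| / 3 * √V ^ 3 + |p.c| / 4 * √V ^ 4) := by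
    rw [E1]; gcongr
  have hs' := (abs_le.1 hs).2
  have g1 : p.K / 2 * tGrad2 (mesh p J) Q ≤ p.K / 2 * R ^ 2 := by gcongr
  have g2 : p.B₀ * nrm (mesh p J) (lap (mesh p J) u) ^ 2 ≤ p.B₀ * R ^ 2 := by gcongr
  rw [modE]
  linarith

/-- The dissipation rate of the next step is bounded along runs with bounded modified energy. -/
lemma exists_dissip_le (d : ℕ) (hd : d ≤ 3) (p : Params) (hp : p.Admissible d) (T R E : ℝ)
    (hT : 0 ≤ T) :
    ∃ B : ℝ, 0 ≤ B ∧ ∀ (J : ℕ) [NeZero J] (τ : ℝ) (N : ℕ)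
      (Q : ℕ → TGrid d J) (u : ℕ → Grid d J) (s : ℕ → ℝ), BoundedRun p T R E τ N Q u s → τ ≤ T →
      ∀ (Q' : TGrid d J) (u' : Grid d J), Q' = stepQ p τ (Q N) (u N) (s N) →
      u' = stepU p τ (Q N) (u N) (s N) → dissip p τ (Q N) (u N) (s N) Q' u' ≤ B := by
  have hK := hp.K_pos
  have hB := hp.B₀_pos
  obtain ⟨C, hC, H⟩ := exists_run_bounds d hd p hp T R E hT
  obtain ⟨C₁, hC₁, H₁⟩ := exists_gfac_nrm_Hvar_sq_le d hd p hp E one_pos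
  obtain ⟨C₂, hC₂, H₂⟩ := exists_gfac_nrm_muvar_sq_le d hd p hp E
  refine ⟨p.K / 2 * (d ^ 2 * (C ^ 2 + C)) + p.B₀ * C ^ 2
    + (d ^ 2 * ((C₁ + C + 1) * (2 * C + T * C)) + (C₂ * (1 + C) + 1) * (2 * C + T * C)),
    by positivity, fun J _ τ N Q u s hrun hτT Q' u' hQ' hu' => ?_⟩
  have hτ := hrun.τ_pos
  have hh := (mesh_pos (J := J) hp.L_pos).le
  obtain ⟨b1, b2, b3, b4, b5, b6⟩ := H J τ N Q u s hrun N le_rfl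
  have hsym := hrun.isSymm N le_rfl
  have hE := hrun.energy_le N le_rfl
  have a1 := H₁ J (Q N) (u N) (s N) hsym hE
  have a2 := H₂ J (Q N) (u N) (s N) hsym hE
  -- The dissipation is read off from the energy balance rather than from the operator `calQ1`,
  -- whose symbol grows under mesh refinement. In the difference of energies s cancels, and the
  -- quadratic terms at the new level have a good sign. What remains is bounded at the old level,
  -- apart from the work of the forces, which Cauchy–Schwarz bounds.
  have hen := energy_step_le hp hτ (Q N) (u N) (s N) hQ' hu'
  have hg := gfac_pos p (Q N) (u N) (s N)
  have hle1 : ∀ {x y : ℝ}, x ^ 2 ≤ y → x ≤ y + 1 := fun {x y} h => by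
    nlinarith [sq_nonneg (x - 1)]
  have hτC : τ * C ≤ T * C := by gcongr
  have hδQ : ∀ i j, nrm (mesh p J) (comp (Q' - Q N) i j) ≤ 2 * C + T * C := fun i j => by
    have h1 : comp (Q' - Q N) i j = comp Q' i j + -comp (Q N) i j := by
      rw [← sub_eq_add_neg]; rfl
    rw [h1]
    refine (nrm_add_le hh _ _).trans ?_
    rw [nrm_neg hh, hQ']
    have h2 := nrm_comp_stepQ_le hp hτ (Q N) (u N) (s N) i j
    have h3 := mul_le_mul_of_nonneg_left b3 hτ.le
    have h4 := b5 i j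
    linarith
  have hδu : nrm (mesh p J) (u' - u N) ≤ 2 * C + T * C := by
    rw [sub_eq_add_neg]
    refine (nrm_add_le hh _ _).trans ?_
    rw [nrm_neg hh, hu']
    have h2 := nrm_stepU_le hp hτ (Q N) (u N) (s N)
    have h3 := mul_le_mul_of_nonneg_left b4 hτ.le
    linarith
  have hD : 0 ≤ 2 * C + T * C := by positivity
  have hi : -(d ^ 2 * ((C₁ + C + 1) * (2 * C + T * C)))
      ≤ gfac p (Q N) (u N) (s N) * tInn (mesh p J) (Hvar p (Q N) (u N)) (Q' - Q N) := by
    rw [tInn, Finset.mul_sum, neg_le, ← Finset.sum_neg_distrib]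
    simp_rw [Finset.mul_sum, ← Finset.sum_neg_distrib]
    refine sum_sum_le_of_le fun i j => ?_
    refine (neg_le_abs _).trans ?_
    rw [abs_mul, abs_of_pos hg]
    have h1 := mul_le_mul_of_nonneg_left
      (abs_inn_le hh (comp (Hvar p (Q N) (u N)) i j) (comp (Q' - Q N) i j)) hg.le
    refine h1.trans ?_
    rw [← mul_assoc]
    have h2 := hle1 (a1 i j)
    exact mul_le_mul (by linarith) (hδQ i j) (nrm_nonneg _ _) (by positivity)
  have hj : -((C₂ * (1 + C) + 1) * (2 * C + T * C))
      ≤ gfac p (Q N) (u N) (s N) * inn (mesh p J) (muvar p (Q N) (u N)) (u' - u N) := by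
    rw [neg_le]
    refine (neg_le_abs _).trans ?_
    rw [abs_mul, abs_of_pos hg]
    have h1 := mul_le_mul_of_nonneg_left
      (abs_inn_le hh (muvar p (Q N) (u N)) (u' - u N)) hg.le
    refine h1.trans ?_
    rw [← mul_assoc]
    have h2 := hle1 a2
    have h3 : C₂ * (1 + tLap2 (mesh p J) (Q N)) ≤ C₂ * (1 + C) := by gcongr
    exact mul_le_mul (by linarith) hδu (nrm_nonneg _ _) (by positivity)
  have hG : tGrad2 (mesh p J) (Q N) ≤ d ^ 2 * (C ^ 2 + C) := sum_sum_le_of_le fun i j => by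
    have h1 := gradNrm_sq_le hh (comp (Q N) i j)
    have h2 := nrm_lap_comp_sq_le (mesh p J) (Q N) i j
    have h3 := pow_le_pow_left₀ (nrm_nonneg _ _) (b5 i j) 2
    linarith
  have hw := pow_le_pow_left₀ (nrm_nonneg _ _) b2 2
  have e1 : p.K / 2 * tGrad2 (mesh p J) (Q N) ≤ p.K / 2 * (d ^ 2 * (C ^ 2 + C)) := by gcongr
  have e2 : p.B₀ * nrm (mesh p J) (lap (mesh p J) (u N)) ^ 2 ≤ p.B₀ * C ^ 2 := by gcongr
  have e3 : 0 ≤ p.K / 2 * tGrad2 (mesh p J) Q' := mul_nonneg (by positivity) (tGrad2_nonneg _ _)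
  have e4 : 0 ≤ p.B₀ * nrm (mesh p J) (lap (mesh p J) u') ^ 2 := by positivity
  simp only [modE, sTilde, mul_add] at hen
  linarith

/-- The step dissipates R, and feasibility of ξ allows relaxation to raise s by at most η₀τR. -/
lemma modE_succ_le {p : Params} {d J : ℕ} [NeZero J] {τ : ℝ} {N : ℕ} {Q : ℕ → TGrid d J}
    {u : ℕ → Grid d J} {s : ℕ → ℝ} (hp : p.Admissible d) (hτ : 0 < τ)
    (H : IsNumericalSolution p τ N Q u s) {n : ℕ} (hn : n < N) :
    modE p (Q (n + 1)) (u (n + 1)) (s (n + 1)) ≤ modE p (Q n) (u n) (s n)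
      + (p.η₀ * τ - 1) * dissip p τ (Q n) (u n) (s n) (Q (n + 1)) (u (n + 1)) := by
  obtain ⟨ξ, ⟨_, _, hξ⟩, hs⟩ := H.step_s n hn
  have h1 := energy_step_le hp hτ (Q n) (u n) (s n) (H.step_Q n hn) (H.step_u n hn)
  rw [← hs] at hξ
  simp only [modE] at h1 ⊢
  linarith

/-- For τ ≤ 1 the relaxation never outweighs the dissipation. For τ > 1 the number of steps is at
most T, and a bootstrap applies: a bound up to level n yields regularity up to n, hence a bound on
the next dissipation and on the energy at n + 1. -/
lemma exists_energy_le (d : ℕ) (hd : d ≤ 3) (p : Params) (hp : p.Admissible d) (T R S₀ : ℝ)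
    (hT : 0 ≤ T) :
    ∃ E : ℝ, ∀ (J : ℕ) [NeZero J] (τ : ℝ) (N : ℕ), 0 < τ → N * τ ≤ T →
      ∀ (Q : ℕ → TGrid d J) (u : ℕ → Grid d J) (s : ℕ → ℝ), IsNumericalSolution p τ N Q u s →
      tH2Nrm (mesh p J) (Q 0) ≤ R → h4Nrm (mesh p J) (u 0) ≤ R →
      |s 0 - E1 p (Q 0) (u 0)| ≤ S₀ → BoundedRun p T R E τ N Q u s := by
  obtain ⟨E₀, hE₀⟩ := exists_initial_energy_le d hd p hp R S₀
  choose B hB0 hB using fun E => exists_dissip_le d hd p hp T R E hT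
  -- The recursion records the worst growth per large step: the net factor η₀τ - 1 is at most T, and
  -- the dissipation is at most B at the current energy level.
  let F : ℕ → ℝ := fun n => Nat.rec E₀ (fun _ E => E + T * B E) n
  have hF : ∀ n, F (n + 1) = F n + T * B (F n) := fun n => rfl
  have hmono : Monotone F := monotone_nat_of_le_succ fun n => by
    rw [hF]; have := mul_nonneg hT (hB0 (F n)); linarith
  refine ⟨F ⌊T⌋₊, fun J _ τ N hτ hN Q u s H hQR huR hs => ?_⟩
  have hsym : ∀ x, (Q 0 x).IsSymm := fun x => (H.init_mem x).1
  have h0 : modE p (Q 0) (u 0) (s 0) ≤ F 0 := hE₀ J (Q 0) (u 0) (s 0) hsym hQR huR hs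
  refine ⟨hτ, hN, hsym, H.step_Q, H.step_u, ?_, hQR, huR⟩
  rcases le_or_gt τ 1 with hτ1 | hτ1
  · intro n hn
    refine le_trans ?_ (h0.trans (hmono (Nat.zero_le _)))
    induction n with
    | zero => exact le_rfl
    | succ n ih =>
      refine (modE_succ_le hp hτ H (by omega)).trans ?_
      have h1 := dissip_nonneg hp hτ (Q n) (u n) (s n) (Q (n + 1)) (u (n + 1))
      have h2 : p.η₀ * τ ≤ 1 := by
        have := mul_le_mul hp.η₀_le_one hτ1 hτ.le zero_le_one
        linarith
      have h3 := mul_nonneg (sub_nonneg.2 h2) h1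
      have h4 := ih (by omega)
      linarith
  · have key : ∀ n ≤ N, ∀ k ≤ n, modE p (Q k) (u k) (s k) ≤ F n := by
      intro n hn
      induction n with
      | zero => intro k hk; rw [Nat.le_zero.1 hk]; exact h0
      | succ n ih =>
        have ih' := ih (by omega)
        intro k hk
        rcases Nat.lt_or_ge k (n + 1) with h1 | h1
        · exact (ih' k (by omega)).trans (hmono (Nat.le_succ n))
        · have hk' : k = n + 1 := by omega
          subst hk'
          have hτT : ∀ m : ℕ, m ≤ N → (m : ℝ) * τ ≤ T := fun m hm => by
            have : (m : ℝ) ≤ N := by exact_mod_cast hm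
            exact (mul_le_mul_of_nonneg_right this hτ.le).trans hN
          have h2 : τ ≤ T := by simpa using hτT 1 (by omega)
          have hrun : BoundedRun p T R (F n) τ n Q u s :=
            ⟨hτ, hτT n (by omega), hsym, fun m hm => H.step_Q m (by omega),
              fun m hm => H.step_u m (by omega), ih', hQR, huR⟩
          have h3 := hB (F n) J τ n Q u s hrun h2 _ _ (H.step_Q n (by omega)) (H.step_u n (by omega))
          have h4 := dissip_nonneg hp hτ (Q n) (u n) (s n) (Q (n + 1)) (u (n + 1))
          refine (modE_succ_le hp hτ H (by omega)).trans ?_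
          have h5 := ih' n le_rfl
          have h6 : p.η₀ * τ - 1 ≤ T := by
            have := mul_le_mul hp.η₀_le_one h2 hτ.le zero_le_one
            linarith
          have h7 := (mul_le_mul_of_nonneg_right h6 h4).trans (mul_le_mul_of_nonneg_left h3 hT)
          rw [hF]; linarith
    intro n hn
    -- Since τ > 1, n ≤ N ≤ Nτ ≤ T, so ⌊T⌋ iterations of F suffice for every mesh and step size.
    refine (key n hn n le_rfl).trans (hmono (Nat.le_floor ?_))
    have h1 : (n : ℝ) ≤ N := by exact_mod_cast hn
    have h2 : (0 : ℝ) ≤ N := Nat.cast_nonneg N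
    nlinarith

end EnergyBound
end SmA
end

/-! ### Assembly of the uniform bounds. -/

theorem theorem8 (d : ℕ) (p : Params) (hp : p.Admissible d)
    (T R₀ S₀ : ℝ) (hT : 0 < T) :
    (∀ ε : ℝ, 0 < ε → ε < 1 / 4 → ∃ Cε : ℝ,
      ∀ (J : ℕ) [NeZero J] (τ : ℝ) (N : ℕ), 0 < τ → N * τ ≤ T →
      ∀ (Q : ℕ → TGrid d J) (u : ℕ → Grid d J) (s : ℕ → ℝ),
        IsNumericalSolution p τ N Q u s →
        tH2Nrm (mesh p J) (Q 0) ≤ R₀ → h4Nrm (mesh p J) (u 0) ≤ R₀ →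
        |s 0 - E1 p (Q 0) (u 0)| ≤ S₀ →
        (⨆ n : Fin (N + 1), tH2Nrm (mesh p J) (Q n))
          + (⨆ n : Fin (N + 1), nrm (mesh p J) (lap (mesh p J) (u n))) ≤ Cε) ∧
    (∃ C₁ : ℝ,
      ∀ (J : ℕ) [NeZero J] (τ : ℝ) (N : ℕ), 0 < τ → N * τ ≤ T →
      ∀ (Q : ℕ → TGrid d J) (u : ℕ → Grid d J) (s : ℕ → ℝ),
        IsNumericalSolution p τ N Q u s →
        tH2Nrm (mesh p J) (Q 0) ≤ R₀ → h4Nrm (mesh p J) (u 0) ≤ R₀ →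
        |s 0 - E1 p (Q 0) (u 0)| ≤ S₀ →
        (⨆ n : Fin (N + 1), tNrm (mesh p J) (NQ p (Q n) (u n) (s n)))
          + (⨆ n : Fin (N + 1), nrm (mesh p J) (Nu p (Q n) (u n) (s n))) ≤ C₁) := by
  have hd : d ≤ 3 := by rcases hp.regime with h | h <;> omega
  obtain ⟨E, hE⟩ := exists_energy_le d hd p hp T R₀ S₀ hT.le
  obtain ⟨C, hC, H⟩ := exists_run_bounds d hd p hp T R₀ E hT.le
  refine ⟨fun ε _ _ => ⟨√((d : ℝ) ^ 2 * C ^ 2 + (d : ℝ) ^ 2 * (C ^ 2 + C) + C) + C,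
    fun J _ τ N hτ hN Q u s hsol hQR huR hs => ?_⟩,
    ⟨C + C, fun J _ τ N hτ hN Q u s hsol hQR huR hs => ?_⟩⟩
  · have hb := H J τ N Q u s (hE J τ N hτ hN Q u s hsol hQR huR hs)
    have hh := (mesh_pos (J := J) hp.L_pos).le
    refine add_le_add (ciSup_le fun n => ?_) (ciSup_le fun n => ?_)
    · obtain ⟨b1, _, _, _, b5, _⟩ := hb n (Nat.lt_succ_iff.1 n.2)
      refine Real.le_sqrt_of_sq_le ?_
      rw [tH2Nrm_sq, tNrm_sq]
      have hsq : ∀ i j, nrm (mesh p J) (comp (Q n) i j) ^ 2 ≤ C ^ 2 := fun i j =>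
        pow_le_pow_left₀ (nrm_nonneg _ _) (b5 i j) 2
      refine add_le_add (add_le_add (sum_sum_le_of_le hsq) (sum_sum_le_of_le fun i j => ?_)) b1
      have h1 := gradNrm_sq_le hh (comp (Q n) i j)
      have h2 := nrm_lap_comp_sq_le (mesh p J) (Q n) i j
      have h3 := hsq i j
      linarith
    · exact (hb n (Nat.lt_succ_iff.1 n.2)).2.1
  · have hb := H J τ N Q u s (hE J τ N hτ hN Q u s hsol hQR huR hs)
    exact add_le_add (ciSup_le fun n => (hb n (Nat.lt_succ_iff.1 n.2)).2.2.1)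
      (ciSup_le fun n => (hb n (Nat.lt_succ_iff.1 n.2)).2.2.2.1)
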